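/- **(A)** Let $L$ be a first-order language, $U$ an $L$-theory, $\bar\delta$ a set of new unary function symbols, and $U'$ an $L^{\bar\delta}$-theory expanding $U$. Let $\Gamma$ be the free monoid on $\bar\delta$ (finite words, acting by composition), and for a tuple of variables or elements $\bar x$ let $\bar x^{\Gamma}=(\gamma x_i)_{i,\gamma\in\Gamma}$; for a set $B$ let $B^\Gamma=\{\gamma b: b\in B,\gamma\in\Gamma\}$. Assume that for every $L^{\bar\delta}$-formula $\alpha(\bar x)$ there is an $L$-formula $\beta(\bar y)$ with $U'\models\forall\bar x\,(\alpha(\bar x)\leftrightarrow\beta(\bar x^{\Gamma}))$. Then: 1. for every $M\models U'$, every finite tuple $\bar a$ in $M$ and every $B\subseteq M$, the $L^{\bar\delta}$-type of $\bar a$ over $B$ is determined by the $L$-type of $\bar a^\Gamma$ over $B^\Gamma$ (i.e. if $\bar a,\bar a'\in M^n$ are such that $\bar a^\Gamma,\bar a'^\Gamma$ have the same $L$-type over $B^\Gamma$, then $\bar a,\bar a'$ have the same $L^{\bar\delta}$-type over $B$); 2. if $U$ is stable, then $U'$ is stable; 3. if $U$ is NIP, then $U'$ is NIP. (A theory is stable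 if there are no formula $\varphi(\bar x;\bar y)$, model $M$ and tuples $\bar a_i,\bar b_j$ $(i,j\in\mathbb N)$ in $M$ with $M\models\varphi(\bar a_i,\bar b_j)\Leftrightarrow i<j$; it is NIP if there are no $\varphi$, $M$, $\bar a_i$ $(i\in\mathbb N)$, $\bar b_s$ $(s\subseteq\mathbb N)$ with $M\models\varphi(\bar a_i,\bar b_s)\Leftrightarrow i\in s$.) **(B)** Let $\mathbb K$ be an $L$-structure expanding a field of characteristic $0$, $T=\mathrm{Th}(\mathbb K)$, $F=\mathrm{dcl}(\emptyset)$, and assume that $\mathbb K$ is algebraically bounded over $F$: for every $L$-formula $\varphi(\bar x,y)$ there are $p_1,\dots,p_m\in F[\bar x,y]$ such that whenever $\varphi(\bar a,\mathbb K)$ is finite, it is contained in the zero set of some $p_i(\bar a,y)$ with $p_i(\bar a,y)\not\equiv0$. Let $k\in\mathbb N$ and let $\eta_1,\dots,\eta_k$ be derivations of $F$. If $T$ is stable (respectively NIP), then so is the theory $T^{\bar\delta,nc}_g$ of generic non-commuting derivations; if moreover the $\eta_i$ commute with each other, then so is the theory $T^{\bar\delta}_g$ of generic commuting derivations. Here a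 set $X\subseteq M^I$ definable with parameters in $M\models T$ is *large* if $\dim X=|I|$, i.e. if in some elementary extension of $M$ it has a point whose coordinates are independent over $M$ for the model-theoretic algebraic closure, and the two theories are as follows. * $T^{\bar\delta,nc}_g$: the models are the $(M,\delta_1,\dots,\delta_k)$ with $M\models T$, each $\delta_i$ a derivation of $M$ extending $\eta_i$, such that: for every finite $\mathcal V\subset\Gamma$ closed under right factors (where $\Gamma$ is the free monoid on $\delta_1,\dots,\delta_k$, ordered by $\beta\preceq\alpha\beta$), with set of $\preceq$-maximal elements $\mathcal P$, and every $Z\subseteq M^{\mathcal V}$ definable in $L$ with parameters in $M$ whose projection to $M^{\mathcal V\setminus\mathcal P}$ is large, there is $c\in M$ with $(\gamma c)_{\gamma\in\mathcal V}\in Z$. * $T^{\bar\delta}_g$: the models are the $(M,\delta_1,\dots,\delta_k)$ with $M\models T$, the $\delta_i$ pairwise commuting derivations of $M$ extending the $\eta_i$, such that: for every commutative configuration $(W;p_\pi:\pi\in\mathcal P)$ over $M$ and every $X\subseteq W$ definable in $L$ with parameters in $M$ with $\Pi_{\mathcal F}(X)$ large, there is $c\in M$ with $(\mu c)_{\mu\in\mathcal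 V}\in X$. A *configuration* over $M$ consists of a finite anti-chain $\mathcal P$ in the free commutative monoid $\Theta\cong\mathbb N^k$ on $\bar\delta$ (with its natural order $\preceq$) such that the set $\mathcal F$ of the $\mu\in\Theta$ lying above no element of $\mathcal P$ is non-empty; polynomials $p_\pi$ over $M$ $(\pi\in\mathcal P)$ in the variables $x_\pi$ and $x_\mu$ ($\mu\in\mathcal F$, $\mu<\pi$ in the degree-lexicographic order), of positive degree in $x_\pi$; and, with $\mathcal V=\mathcal F\cup\mathcal P$, a set $W$ defined by finitely many polynomial equations over $M$ inside $\{x\in M^{\mathcal V}: p_\pi(x)=0\neq\frac{\partial p_\pi}{\partial x_\pi}(x)\ \forall\pi\in\mathcal P\}$, such that the projection $\Pi_{\mathcal F}(W)$ is large. Define rational functions $f_\alpha,f_{v,\pi}\in M(x_{\mathcal V})$ ($\alpha\in\Theta$, $v\in\Gamma$, $\pi\in\mathcal P$) by: $f_\alpha=x_\alpha$ for $\alpha\in\mathcal V$, and otherwise $f_\alpha$ is any of the $f_{v,\pi}$ with $[v]\pi=\alpha$ ($[v]$ being the class of $v$ in $\Theta$); $f_{\emptyset,\pi}=x_\pi$;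 $f_{\delta,\pi}=-\bigl(p_\pi^{\delta}+\sum_{\mu\in\mathcal F}\frac{\partial p_\pi}{\partial x_\mu}f_{\delta\mu}\bigr)\big/\frac{\partial p_\pi}{\partial x_\pi}$ for $\delta\in\bar\delta$; and $f_{\delta w,\pi}=f_{w,\pi}^{\delta}+\sum_{\mu\in\mathcal V}\frac{\partial f_{w,\pi}}{\partial x_\mu}f_{\delta,\mu}$ for $w\neq\emptyset$, where $f_{\delta,\mu}=f_{\delta\mu}$ for $\mu\in\mathcal F$ and $h^\delta$ is $h$ with $\delta$ applied to its coefficients. The configuration is *commutative* if, for every $\alpha\in\Theta$ that is at most the $\preceq$-least upper bound of $\mathcal P$ in the degree-lexicographic order, all $f_{v,\pi}$ with $[v]\pi=\alpha$ coincide on $W$ outside a subset of dimension smaller than $\dim W$ (equivalently, at the points of $W$ in elementary extensions of $M$ whose coordinates in $\mathcal F$ are independent over $M$). -/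

import Mathlib

open FirstOrder FirstOrder.Language

universe u v w x

namespace GenDer

/-! ## Languages with additional unary function symbols -/

/-- Function symbols of the language with one unary symbol `der i` for every `i : ι`. -/
inductive DerFunc (ι : Type w) : ℕ → Type w
  | der (i : ι) : DerFunc ι 1

/-- The language whose only symbols are unary function symbols indexed by `ι`. -/
def derLang (ι : Type w) : FirstOrder.Language.{w, 0} where
  Functions := DerFunc ι
  Relations := fun _ => Empty

/-- The function symbol of `derLang ι` with index `i`. -/
def derSymb {ι : Type w} (i : ι) : (derLang ι).Functions 1 := DerFunc.der i

/-- The expansion of `L` by new unary function symbols indexed by `ι`. -/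
abbrev withDer (L : FirstOrder.Language.{u, v}) (ι : Type w) : FirstOrder.Language.{max u w, v} :=
  L.sum (derLang ι)

/-- A family of unary functions on `M`, seen as a structure for `derLang ι`. -/
@[reducible]
def derStructure {ι : Type w} {M : Type x} (d : ι → M → M) : (derLang ι).Structure M where
  funMap := fun f y => match f, y with
    | DerFunc.der i, y => d i (y 0)
  RelMap := fun r => nomatch r

/-- The interpretation in `M` of the symbol with index `i`. -/
def derMap {ι : Type w} (M : Type x) [(derLang ι).Structure M] (i : ι) (y : M) : M :=
  Structure.funMap (derSymb i) ![y]

/-- The action of a word `γ = i₁ i₂ ⋯ iₙ` of the free monoid on `ι`: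
`γ y = d i₁ (d i₂ (⋯ (d iₙ y)))`. -/
def applyWord {ι : Type w} {M : Type x} (d : ι → M → M) (γ : List ι) (y : M) : M :=
  γ.foldr d y

/-- The term `γ t`, for a word `γ` and a term `t`. -/
def wordTerm {L : FirstOrder.Language.{u, v}} {ι : Type w} {α : Type x} (γ : List ι)
    (t : (withDer L ι).Term α) : (withDer L ι).Term α :=
  γ.foldr (fun i s => Term.func (Sum.inr (derSymb i)) ![s]) t

/-- For an `L`-formula `β` whose variables are indexed by pairs `(i, γ)`, the formula `β(x^Γ)`,
in which the term `γ xᵢ` is substituted for the variable `(i, γ)`. -/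
def substJet {L : FirstOrder.Language.{u, v}} {ι : Type w} {n : ℕ} (β : L.Formula (Fin n × List ι)) :
    (withDer L ι).Formula (Fin n) :=
  BoundedFormula.subst ((LHom.sumInl : L →ᴸ withDer L ι).onFormula β)
    (fun p => wordTerm p.2 (Term.var p.1))

/-- The tuple `a^Γ` of all `γ aᵢ`. -/
def jet {ι : Type w} {M : Type x} {n : ℕ} (d : ι → M → M) (a : Fin n → M) :
    Fin n × List ι → M :=
  fun p => applyWord d p.2 (a p.1)

/-- The set `B^Γ` of all `γ b` with `b ∈ B`. -/
def jetSet {ι : Type w} {M : Type x} (d : ι → M → M) (B : Set M) : Set M :=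
  {y | ∃ b ∈ B, ∃ γ : List ι, y = applyWord d γ b}

/-! ## Types, stability, NIP -/

/-- The complete `L`-type of the tuple `a` over the parameter set `B`. -/
def typeOver (L : FirstOrder.Language.{u, v}) {M : Type w} [L.Structure M] [Nonempty M] (B : Set M)
    {α : Type x} (a : α → M) : (L[[B]].completeTheory M).CompleteType α :=
  (L[[B]].completeTheory M).typeOf a

/-- A theory is stable if no formula has the order property in one of its models.
(By the downward Löwenheim–Skolem theorem, models in `Type (max u v)` suffice.) -/
def IsStable {L : FirstOrder.Language.{u, v}} (T : L.Theory) : Prop :=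
  ∀ (m n : ℕ) (φ : L.Formula (Fin m ⊕ Fin n)) (M : T.ModelType.{u, v, max u v})
    (a : ℕ → Fin m → M) (b : ℕ → Fin n → M),
    ¬ ∀ i j : ℕ, φ.Realize (Sum.elim (a i) (b j)) ↔ i < j

/-- A theory is NIP if no formula has the independence property in one of its models. -/
def IsNIP {L : FirstOrder.Language.{u, v}} (T : L.Theory) : Prop :=
  ∀ (m n : ℕ) (φ : L.Formula (Fin m ⊕ Fin n)) (M : T.ModelType.{u, v, max u v})
    (a : ℕ → Fin m → M) (b : Set ℕ → Fin n → M),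
    ¬ ∀ (i : ℕ) (s : Set ℕ), φ.Realize (Sum.elim (a i) (b s)) ↔ i ∈ s

/-! ## Algebraic closure, definable closure, largeness -/

/-- The model-theoretic algebraic closure of `A` in `M`. -/
def acl (L : FirstOrder.Language.{u, v}) {M : Type w} [L.Structure M] (A : Set M) : Set M :=
  {y | ∃ D : Set M, A.Definable₁ L D ∧ D.Finite ∧ y ∈ D}

/-- The family `a` is independent over `A` for the algebraic closure `acl`. -/
def AclIndep (L : FirstOrder.Language.{u, v}) {M : Type w} [L.Structure M] (A : Set M)
    {I : Type x} (a : I → M) : Prop :=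
  ∀ i, a i ∉ acl L (A ∪ a '' {i}ᶜ)

/-- The formula `ψ` defines the singleton `{y}` in `M`. -/
def DefinesPoint {L : FirstOrder.Language.{u, v}} {M : Type w} [L.Structure M] (ψ : L.Formula Unit)
    (y : M) : Prop :=
  ∀ z : M, ψ.Realize (fun _ => z) ↔ z = y

/-- Let `φ` be an `L`-formula with parameters in `M` (the variables `Sum.inr m` stand for the
parameters `m : M`), defining a set `X ⊆ M ^ I`, and let `J ⊆ I`. The projection `Π_J(X) ⊆ M ^ J`
is large, that is, of dimension `|J|`: in some elementary extension of `M` there is a point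
of `X` whose coordinates in `J` have rank `|J|` over `M` (are algebraically independent
over `M`). -/
def ProjIsLarge {L : FirstOrder.Language.{u, v}} {M : Type w} [L.Structure M] {I : Type x}
    (φ : L.Formula (I ⊕ M)) (J : Set I) : Prop :=
  ∃ (N : Type w) (_ : L.Structure N) (j : M ↪ₑ[L] N) (a : I → N),
    φ.Realize (Sum.elim a j) ∧ AclIndep L (Set.range j) (fun i : J => a i)

section Field

/- In what follows `ρ : FirstOrder.Language.ring →ᴸ L` says which symbols of `L` are the ring operations;
`[ρ.IsExpansionOn M]` says that the `L`-structure `M` expands the field `M`. -/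

theorem realize_ringTerm {L : FirstOrder.Language.{u, v}} (ρ : FirstOrder.Language.ring →ᴸ L) (K : Type w) [Field K]
    [FirstOrder.Ring.CompatibleRing K] [L.Structure K] [ρ.IsExpansionOn K] {α : Type x}
    (t : FirstOrder.Language.ring.Term α) (a : α → K) :
    (ρ.onTerm t).realize a = t.realize a := by
  simp

theorem exists_definesPoint_term {L : FirstOrder.Language.{u, v}} {K : Type w} [L.Structure K] {n : ℕ}
    (t : L.Term (Fin n)) (a : Fin n → K) (ha : ∀ i, ∃ ψ : L.Formula Unit, DefinesPoint ψ (a i)) :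
    ∃ ψ : L.Formula Unit, DefinesPoint ψ (t.realize a) := by
  choose ψ hψ using ha
  refine ⟨Formula.iExs (Fin n)
    ((BoundedFormula.iInf (fun i : Fin n =>
      (ψ i).relabel (fun _ : Unit => (Sum.inr i : Unit ⊕ Fin n)))) ⊓
      (Term.equal (Term.var (Sum.inl ())) (t.relabel Sum.inr))), fun z => ?_⟩
  rw [Formula.realize_iExs]
  constructor
  · rintro ⟨b, hb⟩
    rw [Formula.realize_inf] at hb
    obtain ⟨h1, h2⟩ := hb
    have h1' : ∀ i, b i = a i := by
      intro i
      have h1a := (BoundedFormula.realize_iInf.1 h1) i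
      have h3 : ((ψ i).relabel (fun _ : Unit => (Sum.inr i : Unit ⊕ Fin n))).Realize
        (Sum.elim (fun _ : Unit => z) b) := h1a
      rw [Formula.realize_relabel] at h3
      exact (hψ i (b i)).1 h3
    have hba : b = a := funext h1'
    simp only [Formula.realize_equal, Term.realize_var, Term.realize_relabel, Sum.elim_inl,
      Sum.elim_comp_inr] at h2
    rw [← hba]
    exact h2
  · rintro rfl
    refine ⟨a, ?_⟩
    rw [Formula.realize_inf]
    constructor
    · refine BoundedFormula.realize_iInf.2 fun i => ?_
      change ((ψ i).relabel (fun _ : Unit => (Sum.inr i : Unit ⊕ Fin n))).Realize _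
      rw [Formula.realize_relabel]
      exact (hψ i (a i)).2 rfl
    · simp only [Formula.realize_equal, Term.realize_var, Term.realize_relabel, Sum.elim_inl,
        Sum.elim_comp_inr]

/-- The definable closure `dcl(∅)` of the empty set in `K`, as a subring of `K`. -/
def dclEmpty {L : FirstOrder.Language.{u, v}} (ρ : FirstOrder.Language.ring →ᴸ L) (K : Type w) [Field K]
    [FirstOrder.Ring.CompatibleRing K] [L.Structure K] [ρ.IsExpansionOn K] : Subring K where
  carrier := {y | ∃ ψ : L.Formula Unit, DefinesPoint ψ y}
  zero_mem' := by
    have h := exists_definesPoint_term (K := K) (ρ.onTerm (0 : FirstOrder.Language.ring.Term (Fin 0)))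
      ![] (fun i => i.elim0)
    rwa [realize_ringTerm, FirstOrder.Ring.realize_zero] at h
  one_mem' := by
    have h := exists_definesPoint_term (K := K) (ρ.onTerm (1 : FirstOrder.Language.ring.Term (Fin 0)))
      ![] (fun i => i.elim0)
    rwa [realize_ringTerm, FirstOrder.Ring.realize_one] at h
  add_mem' := by
    intro y z hy hz
    have h := exists_definesPoint_term (K := K)
      (ρ.onTerm (Term.var 0 + Term.var 1 : FirstOrder.Language.ring.Term (Fin 2)))
      ![y, z] (fun i => by fin_cases i <;> assumption)
    rwa [realize_ringTerm, FirstOrder.Ring.realize_add] at h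
  mul_mem' := by
    intro y z hy hz
    have h := exists_definesPoint_term (K := K)
      (ρ.onTerm (Term.var 0 * Term.var 1 : FirstOrder.Language.ring.Term (Fin 2)))
      ![y, z] (fun i => by fin_cases i <;> assumption)
    rwa [realize_ringTerm, FirstOrder.Ring.realize_mul] at h
  neg_mem' := by
    intro y hy
    have h := exists_definesPoint_term (K := K)
      (ρ.onTerm (-Term.var 0 : FirstOrder.Language.ring.Term (Fin 1)))
      ![y] (fun i => by fin_cases i; assumption)
    rwa [realize_ringTerm, FirstOrder.Ring.realize_neg] at h

/-- `K` is algebraically bounded over `F`: for every formula `φ(x̄, y)` there are finitely many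
polynomials `p ∈ F[x̄][y]` such that every finite set `φ(ā, K)` is contained in the zero set of
one of the polynomials `p(ā, y)`, with `p(ā, y) ≠ 0`. -/
def AlgBounded (L : FirstOrder.Language.{u, v}) {K : Type w} [Field K] [L.Structure K] (F : Subring K) :
    Prop :=
  ∀ (n : ℕ) (φ : L.Formula (Fin n ⊕ Unit)),
    ∃ ps : Finset (Polynomial (MvPolynomial (Fin n) F)), ∀ a : Fin n → K,
      {y : K | φ.Realize (Sum.elim a fun _ => y)}.Finite →
        ∃ p ∈ ps, p.map (MvPolynomial.aeval a : MvPolynomial (Fin n) F →ₐ[F] K).toRingHom ≠ 0 ∧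
          ∀ y : K, φ.Realize (Sum.elim a fun _ => y) →
            (p.map (MvPolynomial.aeval a : MvPolynomial (Fin n) F →ₐ[F] K).toRingHom).eval y = 0

/-- `(M, δ)`, with `δ` a tuple of derivations on the field `M`, is a model of `T = Th(K)` and
`δ i` extends the derivation `η i` of `dcl(∅)` (an element of `dcl(∅)` is identified in `M` with
the unique realization of a formula that defines it in `K`). -/
def IsDerModel {L : FirstOrder.Language.{u, v}} (ρ : FirstOrder.Language.ring →ᴸ L) (K : Type w) [Field K]
    [FirstOrder.Ring.CompatibleRing K] [L.Structure K] [ρ.IsExpansionOn K] {k : ℕ}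
    (η : Fin k → Derivation ℤ (dclEmpty ρ K) (dclEmpty ρ K))
    (M : Type x) [Field M] [L.Structure M] (δ : Fin k → Derivation ℤ M M) : Prop :=
  M ⊨ L.completeTheory K ∧
    ∀ (i : Fin k) (c : dclEmpty ρ K) (ψ χ : L.Formula Unit),
      DefinesPoint ψ (c : K) → DefinesPoint χ (η i c : K) →
        ∀ y : M, ψ.Realize (fun _ => y) → χ.Realize (fun _ => δ i y)

/-! ## Generic non-commuting derivations -/

/-- The axiom scheme for generic non-commuting derivations. The free monoid `Γ` consists of
the words `List (Fin k)`; one has `β ≼ αβ`, so `≼` is the suffix order. For every finite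
`≼`-initial `V ⊆ Γ`, with set of maximal elements `P`, and every set `Z ⊆ M ^ V` definable with
parameters: if the projection of `Z` to the coordinates in `V \ P` is large, then `Z` contains
a point `(γ c)_{γ ∈ V}`. -/
def NcDeep (L : FirstOrder.Language.{u, v}) {M : Type w} [L.Structure M] {k : ℕ} (δ : Fin k → M → M) :
    Prop :=
  ∀ V : Finset (List (Fin k)), (∀ β γ : List (Fin k), γ ∈ V → β <:+ γ → β ∈ V) →
    ∀ φ : L.Formula (V ⊕ M),
      ProjIsLarge φ {γ : V | ∃ γ' : V, γ' ≠ γ ∧ (γ : List (Fin k)) <:+ γ'} →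
        ∃ c : M, φ.Realize (Sum.elim (fun γ : V => applyWord δ γ c) id)

/-- The theory of generic non-commuting derivations: the theory of all models `(M, δ)` of
`T = Th(K)`, expanded by derivations extending `η`, that satisfy the scheme `NcDeep`. -/
def ncGenericTheory {L : FirstOrder.Language.{u, v}} (ρ : FirstOrder.Language.ring →ᴸ L) (K : Type w) [Field K]
    [FirstOrder.Ring.CompatibleRing K] [L.Structure K] [ρ.IsExpansionOn K] {k : ℕ}
    (η : Fin k → Derivation ℤ (dclEmpty ρ K) (dclEmpty ρ K)) : (withDer L (Fin k)).Theory :=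
  {σ | ∀ (M : Type (max u v)) [Field M] [FirstOrder.Ring.CompatibleRing M] [L.Structure M]
      [ρ.IsExpansionOn M] (δ : Fin k → Derivation ℤ M M),
      IsDerModel ρ K η M δ → NcDeep L (fun i => δ i) →
        letI : (derLang (Fin k)).Structure M := derStructure (fun i => δ i)
        M ⊨ σ}

/-! ## Generic commuting derivations -/

/-- The free commutative monoid on `k` generators, written additively as `ℕ ^ k`; its canonical
partial order is the coordinatewise one. -/
abbrev Theta (k : ℕ) : Type := Fin k → ℕ

/-- The total order on `Theta k`: first compare the length, then lexicographically. -/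
def degLexLT {k : ℕ} (μ ν : Theta k) : Prop :=
  ∑ i, μ i < ∑ i, ν i ∨ (∑ i, μ i = ∑ i, ν i ∧ toLex μ < toLex ν)

/-- The class in `Theta k` of a word in the generators. -/
def wordClass {k : ℕ} (γ : List (Fin k)) : Theta k := fun i => γ.count i

/-- The word `δ₁^{μ₁} ⋯ δₖ^{μₖ}` that represents `μ`. -/
def canonicalWord {k : ℕ} (μ : Theta k) : List (Fin k) :=
  (List.finRange k).flatMap fun i => List.replicate (μ i) i

/-- `μ` is a leader: it lies above an element of `P`. -/
def IsLeader {k : ℕ} (P : Finset (Theta k)) (μ : Theta k) : Prop := ∃ π ∈ P, π ≤ μ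

/-- The set `V = F ∪ P`, where `F` is the set of free elements, i.e. of those that are not
leaders. -/
abbrev VSet {k : ℕ} (P : Finset (Theta k)) : Type := {μ : Theta k // ¬ IsLeader P μ ∨ μ ∈ P}

/-- The coordinates in `F`. -/
def freeSet {k : ℕ} (P : Finset (Theta k)) : Set (VSet P) := {μ | ¬ IsLeader P μ}

/-- An element of `P`, as a coordinate in `V`. -/
def ofP {k : ℕ} {P : Finset (Theta k)} (π : P) : VSet P := ⟨π, Or.inr π.2⟩

/-- The polynomial `p^d`, obtained by applying `d` to the coefficients of `p`. -/
noncomputable def coeffDer {σ : Type x} {M : Type w} [Field M] (d : M → M)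
    (p : MvPolynomial σ M) : MvPolynomial σ M :=
  ∑ m ∈ p.support, MvPolynomial.monomial m (d (p.coeff m))

/-- A configuration with parameters in the field `M`, apart from the requirement that
`Π_F(W)` is large, which is `Configuration.IsLarge`. Here `P` is an anti-chain (finite, by
Dickson's lemma) whose set of free elements is nonempty, `p π` is a polynomial in `x_π` and
the `x_μ` with `μ ∈ F`, `μ < π`, of positive degree in `x_π`, and `W` is the set
of points `a` with `p π (a) = 0`, `(∂p π / ∂x_π)(a) ≠ 0` for all `π ∈ P`, and `q(a) = 0` for all
`q ∈ eqs`. -/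
structure Configuration (k : ℕ) (M : Type w) [Field M] where
  P : Finset (Theta k)
  antichain : IsAntichain (· ≤ ·) (P : Set (Theta k))
  free_nonempty : ∃ μ : Theta k, ¬ IsLeader P μ
  p : P → MvPolynomial (VSet P) M
  vars_p : ∀ (π : P) (μ : VSet P), μ ∈ (p π).vars →
    μ = ofP π ∨ (¬ IsLeader P (μ : Theta k) ∧ degLexLT (μ : Theta k) π)
  degree_p : ∀ π : P, (p π).degreeOf (ofP π) ≠ 0
  eqs : Finset (MvPolynomial (VSet P) M)

namespace Configuration

variable {k : ℕ} {M : Type w} [Field M]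

/-- The point `a`, with coordinates in an extension `j : M →+* N`, lies on `W`. -/
def MemW (S : Configuration k M) {N : Type x} [Field N] (j : M →+* N) (a : VSet S.P → N) :
    Prop :=
  (∀ π : S.P, (S.p π).eval₂ j a = 0 ∧ (MvPolynomial.pderiv (ofP π) (S.p π)).eval₂ j a ≠ 0) ∧
    ∀ q ∈ S.eqs, q.eval₂ j a = 0

/-- The field of rational functions `M(x_V)`. -/
abbrev Rat (S : Configuration k M) : Type w := FractionRing (MvPolynomial (VSet S.P) M)

/-- A polynomial in the variables `x_V`, as a rational function. -/
noncomputable def toRat (S : Configuration k M) (q : MvPolynomial (VSet S.P) M) : S.Rat :=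
  algebraMap (MvPolynomial (VSet S.P) M) S.Rat q

open Classical in
/-- The data induced by a configuration. `f α` is the rational function `f_α`, and `R i` is the
derivation of `M(x_V)` that extends `δ i` with `R i x_μ = f_{δᵢ, μ}`, i.e.
`R i h = h^{δᵢ} + ∑_{μ ∈ V} (∂h/∂μ) f_{δᵢ, μ}`; so `f_{v, π} = R^v x_π` for every word `v`.
One has `f_α = x_α` for `α ∈ V`, while for the other `α` the function `f_α` is
an arbitrary one among the `f_{v, π}` with `[v] π = α`. -/
structure IsProlongation (S : Configuration k M) (δ : Fin k → Derivation ℤ M M)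
    (R : Fin k → Derivation ℤ S.Rat S.Rat) (f : Theta k → S.Rat) : Prop where
  coeff : ∀ (i : Fin k) (m : M), R i (S.toRat (MvPolynomial.C m)) =
    S.toRat (MvPolynomial.C (δ i m))
  f_mem : ∀ μ : VSet S.P, f μ = S.toRat (MvPolynomial.X μ)
  f_leader : ∀ α : Theta k, IsLeader S.P α → ∃ (v : List (Fin k)) (π : S.P),
    wordClass v + π = α ∧
      f α = applyWord (fun i => R i) v (S.toRat (MvPolynomial.X (ofP π)))
  R_free : ∀ (i : Fin k) (μ : VSet S.P), μ ∈ freeSet S.P →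
    R i (S.toRat (MvPolynomial.X μ)) = f ((μ : Theta k) + Pi.single i 1)
  R_leader : ∀ (i : Fin k) (π : S.P), R i (S.toRat (MvPolynomial.X (ofP π))) =
    -((S.toRat (coeffDer (δ i) (S.p π)) +
        ∑ μ ∈ (S.p π).vars.erase (ofP π),
          S.toRat (MvPolynomial.pderiv μ (S.p π)) * f ((μ : Theta k) + Pi.single i 1)) /
      S.toRat (MvPolynomial.pderiv (ofP π) (S.p π)))

/-- The rational function `h` is defined at `a`, with value `0`. -/
def VanishesAt (S : Configuration k M) {N : Type x} [Field N] (j : M →+* N) (a : VSet S.P → N)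
    (h : S.Rat) : Prop :=
  ∃ q r : MvPolynomial (VSet S.P) M, h * S.toRat r = S.toRat q ∧
    r.eval₂ j a ≠ 0 ∧ q.eval₂ j a = 0

variable (L : FirstOrder.Language.{u, v}) [L.Structure M]

/-- `a` is a generic point of `W`: a point of `W` in an elementary extension of `M` whose
coordinates in `F` are algebraically independent over `M`. As the coordinates in `P` are
algebraic over the previous ones, these are the points of `W` of maximal rank over `M`, and a
property holds on `W` outside a subset of smaller dimension iff it holds at all of them. -/
def IsGenericPoint (S : Configuration k M) {N : Type w} [Field N] [L.Structure N]
    (j : M ↪ₑ[L] N) (r : M →+* N) (a : VSet S.P → N) : Prop :=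
  (∀ m, r m = j m) ∧ S.MemW r a ∧ AclIndep L (Set.range j) (fun μ : freeSet S.P => a μ)

/-- `Π_F(W)` is large. -/
def IsLarge (ρ : FirstOrder.Language.ring →ᴸ L) (S : Configuration k M) : Prop :=
  ∃ (N : Type w) (_ : Field N) (_ : FirstOrder.Ring.CompatibleRing N) (_ : L.Structure N)
    (_ : ρ.IsExpansionOn N) (j : M ↪ₑ[L] N) (r : M →+* N) (a : VSet S.P → N),
    S.IsGenericPoint L j r a

/-- The configuration commutes (locally): for every `α ≤ θ`, where `θ` is the least upper
bound of `P`, any two functions `f_{v, π}` and `f_{v', π'}` with `[v] π = α = [v'] π'` coincide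
almost everywhere on `W`. -/
def Commutes (ρ : FirstOrder.Language.ring →ᴸ L) (S : Configuration k M) (δ : Fin k → Derivation ℤ M M) :
    Prop :=
  ∃ (R : Fin k → Derivation ℤ S.Rat S.Rat) (f : Theta k → S.Rat), S.IsProlongation δ R f ∧
    ∀ α : Theta k, (α = S.P.sup id ∨ degLexLT α (S.P.sup id)) →
      ∀ (v v' : List (Fin k)) (π π' : S.P), wordClass v + π = α → wordClass v' + π' = α →
        ∀ (N : Type w) [Field N] [FirstOrder.Ring.CompatibleRing N] [L.Structure N] [ρ.IsExpansionOn N]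
          (j : M ↪ₑ[L] N) (r : M →+* N) (a : VSet S.P → N), S.IsGenericPoint L j r a →
          S.VanishesAt r a
            (applyWord (fun i => R i) v (S.toRat (MvPolynomial.X (ofP π))) -
              applyWord (fun i => R i) v' (S.toRat (MvPolynomial.X (ofP π'))))

end Configuration

/-- The axiom scheme for generic commuting derivations: for every configuration that commutes
and every set `X ⊆ W`, definable with parameters, whose projection to the coordinates in `F` is
large, there is `c` with `c^V ∈ X`. -/
def KDeep {L : FirstOrder.Language.{u, v}} (ρ : FirstOrder.Language.ring →ᴸ L) {M : Type w} [Field M] [L.Structure M]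
    {k : ℕ} (δ : Fin k → Derivation ℤ M M) : Prop :=
  ∀ S : Configuration k M, S.IsLarge L ρ → S.Commutes L ρ δ →
    ∀ φ : L.Formula (VSet S.P ⊕ M),
      (∀ a : VSet S.P → M, φ.Realize (Sum.elim a id) → S.MemW (RingHom.id M) a) →
      ProjIsLarge φ (freeSet S.P) →
        ∃ c : M, φ.Realize
          (Sum.elim (fun μ : VSet S.P => applyWord (fun i => δ i) (canonicalWord μ) c) id)

/-- The theory of generic commuting derivations: the theory of all models `(M, δ)` of
`T = Th(K)`, expanded by commuting derivations extending `η`, that satisfy the scheme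
`KDeep`. -/
def commGenericTheory {L : FirstOrder.Language.{u, v}} (ρ : FirstOrder.Language.ring →ᴸ L) (K : Type w) [Field K]
    [FirstOrder.Ring.CompatibleRing K] [L.Structure K] [ρ.IsExpansionOn K] {k : ℕ}
    (η : Fin k → Derivation ℤ (dclEmpty ρ K) (dclEmpty ρ K)) : (withDer L (Fin k)).Theory :=
  {σ | ∀ (M : Type (max u v)) [Field M] [FirstOrder.Ring.CompatibleRing M] [L.Structure M]
      [ρ.IsExpansionOn M] (δ : Fin k → Derivation ℤ M M),
      IsDerModel ρ K η M δ → (∀ i i' y, δ i (δ i' y) = δ i' (δ i y)) → KDeep ρ δ →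
        letI : (derLang (Fin k)).Structure M := derStructure (fun i => δ i)
        M ⊨ σ}

end Field

end GenDer

-- Part (A). Modulo `U'`, a formula φ(x; y) is equivalent to some β(x^Γ; y^Γ), and β mentions only
-- finitely many coordinates of the two jets. An order or independence pattern for φ in a model of
-- `U'` is therefore a pattern for an `L`-formula, carried by finite pieces of the jets, in the
-- reduct, which is a model of `U`. The same rewriting with parameters gives the statement on types.
--
-- Part (B) follows from (A) once every formula is equivalent to an `L`-formula in jets. It suffices
-- to eliminate one existential quantifier (`JetExists`), and by compactness this is a local problem
-- (`jetExists_of_local`): given a solution c of β over a in one model, find χ true of a^Γ that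
-- forces a solution in every model.
--
-- To find χ, well-order the derivatives μc and call μ a leader if μc is algebraic over a^Γ and the
-- earlier derivatives. In characteristic 0, differentiating a minimal polynomial shows that leaders
-- are stable under the derivations (`AlgLead.s_lead`). There are finitely many minimal leaders π:
-- by Dickson's lemma for commuting derivations, and after a cut-off at the longest word in β for
-- non-commuting ones. Each is a simple root of a polynomial p_π over the preceding free
-- derivatives. Differentiating p_π expresses all further derivatives rationally in the variables
-- x_V and a^Γ. The universal ring `Eqns.U`, with formal inverses of the separants, carries out this
-- computation independently of the model: `Eqns.G` α represents the α-th derivative, and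
-- `IsDerEval.ev_G` says that it evaluates correctly at every differential solution. Thus β turns
-- into an `L`-formula Φ(a^Γ, x_V), which holds at (μc) with independent free coordinates.
--
-- Largeness of the projection of Φ(a^Γ, ·) to the free coordinates is definable: algebraic
-- boundedness bounds finite fibres uniformly, so "infinitely many" means "more than D", and this is
-- iterated over the coordinates (`exists_large_formula`). This condition is χ. Conversely, if χ
-- holds of b^Γ, then solutions of Φ(b^Γ, ·) avoid the zeros of any nonzero polynomial in the free
-- coordinates; compactness gives a generic solution in an elementary extension, and algebraic
-- boundedness makes it independent for acl. The axiom scheme now yields d whose derivatives satisfy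
-- Φ, and `IsDerEval.ev_G` turns Φ back into β.
--
-- In the commuting case the scheme applies only to commutative configurations. Commutation up to
-- the degree of the least upper bound of P is expressed by finitely many polynomials
-- (`Eqns.exists_commute_eqs`). They vanish at the original solution because it comes from commuting
-- derivations, so they may be added to the equations of W.

universe y

namespace GenDer

/-! ### Compactness and reduction to finitely many variables -/

section General

/-- Compactness for sets of formulas in free variables. -/
theorem exists_realize_of_finite {L : FirstOrder.Language.{u, v}} {T : L.Theory} {α : Type w}
    (S : Set (L.Formula α))
    (h : ∀ s : Finset (L.Formula α), (s : Set (L.Formula α)) ⊆ S →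
      ∃ (M : Type x) (_ : Nonempty M) (_ : L.Structure M) (_ : M ⊨ T) (v : α → M),
        ∀ φ ∈ s, φ.Realize v) :
    ∃ (M : T.ModelType.{u, v, max u v w}) (v : α → M), ∀ φ ∈ S, φ.Realize v := by
  classical
  have hsat : ((L.lhomWithConstants α).onTheory T ∪ Formula.equivSentence '' S).IsSatisfiable := by
    rw [Theory.isSatisfiable_iff_isFinitelySatisfiable]
    intro T0 hT0
    -- Only the members of `T0` that come from `S` need a realization; those from `T` hold in any
    -- model supplied by `h`.
    obtain ⟨M, _, _, hM, v, hv⟩ := h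
      ((T0.image Formula.equivSentence.symm).filter (· ∈ S)) (by
        intro φ hφ
        simpa using (Finset.mem_filter.1 (Finset.mem_coe.1 hφ)).2)
    let _ : (constantsOn α).Structure M := constantsOn.structure v
    have hM' : M ⊨ (L.lhomWithConstants α).onTheory T := (LHom.onTheory_model _ T).2 hM
    have : M ⊨ (T0 : L[[α]].Theory) := by
      refine ⟨fun φ hφ => ?_⟩
      rcases hT0 hφ with h1 | ⟨ψ, hψ, rfl⟩
      · exact hM'.realize_of_mem _ h1
      · refine (Formula.realize_equivSentence M ψ).2 (hv ψ ?_)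
        rw [Finset.mem_filter]
        exact ⟨Finset.mem_image.2 ⟨_, hφ, by simp⟩, hψ⟩
    exact Theory.Model.isSatisfiable M
  obtain ⟨M⟩ := hsat
  have hsub : (L.lhomWithConstants α).onTheory T ⊆
      (L.lhomWithConstants α).onTheory T ∪ Formula.equivSentence '' S := Set.subset_union_left
  let _ : L.Structure M := (L.lhomWithConstants α).reduct M
  have : (L.lhomWithConstants α).IsExpansionOn M := LHom.isExpansionOn_reduct _ _
  have hMT : M ⊨ T := (LHom.onTheory_model (L.lhomWithConstants α) T).1
    (Theory.Model.mono M.is_model hsub)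
  refine ⟨Theory.ModelType.of T M, fun a => (L.con a : M), fun φ hφ => ?_⟩
  have h2 : M ⊨ Formula.equivSentence φ :=
    M.is_model.realize_of_mem _ (Set.mem_union_right _ ⟨φ, hφ, rfl⟩)
  have := (Formula.realize_equivSentence_symm_con M (Formula.equivSentence φ)).2 h2
  rw [Equiv.symm_apply_apply] at this
  exact this

/-- Every formula is equivalent to a formula in finitely many of its variables. -/
theorem exists_finset_formula {L : FirstOrder.Language.{u, v}} {α : Type w} (φ : L.Formula α) :
    ∃ (s : Finset α) (ψ : L.Formula s), ∀ (M : Type x) [L.Structure M] (a : α → M),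
      ψ.Realize (fun i : s => a i) ↔ φ.Realize a := by
  classical
  refine ⟨φ.freeVarFinset, BoundedFormula.restrictFreeVar φ id, fun M _ a => ?_⟩
  unfold Formula.Realize
  exact BoundedFormula.realize_restrictFreeVar a (fun _ => rfl)

/-- The formula `φ` in the variables `I ⊕ J`, with finitely many variables from either side. -/
theorem exists_fin_formula {L : FirstOrder.Language.{u, v}} {α : Type w} {β : Type w}
    (φ : L.Formula (α ⊕ β)) :
    ∃ (m n : ℕ) (f : Fin m → α) (g : Fin n → β) (ψ : L.Formula (Fin m ⊕ Fin n)),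
      ∀ (M : Type x) [L.Structure M] (a : α → M) (b : β → M),
        ψ.Realize (Sum.elim (a ∘ f) (b ∘ g)) ↔ φ.Realize (Sum.elim a b) := by
  classical
  obtain ⟨s, ψ, hψ⟩ := exists_finset_formula.{u, v, w, x} φ
  let s1 : Finset α := s.toLeft
  let s2 : Finset β := s.toRight
  let F : s → Fin s1.card ⊕ Fin s2.card := fun i => match i with
    | ⟨Sum.inl a, h⟩ => Sum.inl (s1.equivFin ⟨a, by simpa [s1] using h⟩)
    | ⟨Sum.inr a, h⟩ => Sum.inr (s2.equivFin ⟨a, by simpa [s2] using h⟩)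
  refine ⟨s1.card, s2.card, fun i => s1.equivFin.symm i, fun i => s2.equivFin.symm i,
    ψ.relabel F, fun M _ a b => ?_⟩
  rw [Formula.realize_relabel, ← hψ]
  have : (Sum.elim (a ∘ fun i => ((s1.equivFin.symm i : s1) : α))
      (b ∘ fun i => ((s2.equivFin.symm i : s2) : β)) ∘ F) = fun i : s => Sum.elim a b i := by
    funext i
    rcases i with ⟨i | i, h⟩ <;> simp [F]
  rw [this]

end General

/-! ### Patterns and types read off from jets -/

section PartA

/-- Patterns of a definable relation in a model of a theory. -/
def HasPattern {L : FirstOrder.Language.{u, v}} (T : L.Theory) {I J : Type} (R : I → J → Prop) :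
    Prop :=
  ∃ (m n : ℕ) (φ : L.Formula (Fin m ⊕ Fin n)) (M : T.ModelType.{u, v, max u v})
    (a : I → Fin m → M) (b : J → Fin n → M), ∀ i j, φ.Realize (Sum.elim (a i) (b j)) ↔ R i j

theorem isStable_iff {L : FirstOrder.Language.{u, v}} (T : L.Theory) :
    IsStable T ↔ ¬ HasPattern T (fun i j : ℕ => i < j) := by
  simp only [IsStable, HasPattern, not_exists]

theorem isNIP_iff {L : FirstOrder.Language.{u, v}} (T : L.Theory) :
    IsNIP T ↔ ¬ HasPattern T (fun (i : ℕ) (s : Set ℕ) => i ∈ s) := by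
  simp only [IsNIP, HasPattern, not_exists]

/-- Stability and NIP are tested in one universe of models only. Realizing by compactness the
complete type of the whole array of tuples moves a pattern there; the index sets live in `Type`, so
no larger universe is needed. -/
theorem hasPattern_of_model {L : FirstOrder.Language.{u, v}} {T : L.Theory} {I J : Type}
    {R : I → J → Prop} {m n : ℕ} (φ : L.Formula (Fin m ⊕ Fin n)) (M : Type w) [Nonempty M]
    [L.Structure M] (hM : M ⊨ T) (a : I → Fin m → M) (b : J → Fin n → M)
    (h : ∀ i j, φ.Realize (Sum.elim (a i) (b j)) ↔ R i j) : HasPattern T R := by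
  let v : I × Fin m ⊕ J × Fin n → M := Sum.elim (fun p => a p.1 p.2) (fun p => b p.1 p.2)
  obtain ⟨N, c, hc⟩ := exists_realize_of_finite (T := T) {φ | φ.Realize v}
    (fun s hs => ⟨M, inferInstance, inferInstance, hM, v, fun φ hφ => hs hφ⟩)
  refine ⟨m, n, φ, N, fun i k => c (Sum.inl (i, k)), fun j k => c (Sum.inr (j, k)), fun i j => ?_⟩
  let F : Fin m ⊕ Fin n → I × Fin m ⊕ J × Fin n := Sum.map (Prod.mk i) (Prod.mk j)
  have hF : v ∘ F = Sum.elim (a i) (b j) := by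
    funext k; rcases k with k | k <;> rfl
  have hF' : c ∘ F = Sum.elim (fun k => c (Sum.inl (i, k))) (fun k => c (Sum.inr (j, k))) := by
    funext k; rcases k with k | k <;> rfl
  rw [← h i j, ← hF, ← hF', ← Formula.realize_relabel, ← Formula.realize_relabel]
  constructor
  · intro h1
    by_contra h2
    have h3 := hc (Formula.not (φ.relabel F)) (by
      change Formula.Realize _ v
      rwa [Formula.realize_not])
    rw [Formula.realize_not] at h3
    exact h3 h1
  · exact fun h1 => hc _ h1

variable {L : FirstOrder.Language.{u, v}} {ι : Type w}

/-- Splits the structure of a bundled model into its `L`-reduct and its unary functions, so that the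
lemmas on jets apply. -/
theorem exists_sumStructure {L' : FirstOrder.Language} {M : Type*} (S : (L.sum L').Structure M) :
    ∃ (S1 : L.Structure M) (S2 : L'.Structure M), S = @sumStructure L L' M S1 S2 := by
  refine ⟨(LHom.sumInl : L →ᴸ L.sum L').reduct M, (LHom.sumInr : L' →ᴸ L.sum L').reduct M, ?_⟩
  ext n f y
  · rcases f with f | f <;> rfl
  · rcases f with f | f <;> rfl

theorem realize_wordTerm {M : Type*} [L.Structure M] [(derLang ι).Structure M] {α : Type*}
    (γ : List ι) (t : (withDer L ι).Term α) (a : α → M) :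
    (wordTerm γ t).realize a = applyWord (derMap (ι := ι) M) γ (t.realize a) := by
  induction γ with
  | nil => rfl
  | cons i γ ih =>
    change (Term.func (Sum.inr (derSymb i) : (withDer L ι).Functions 1)
      ![wordTerm γ t]).realize a = derMap M i (applyWord (derMap M) γ (t.realize a))
    rw [← ih]
    change Structure.funMap (derSymb i) _ = Structure.funMap (derSymb i) _
    congr 1
    funext j
    rw [Subsingleton.elim j 0]
    rfl

/-- `substJet` with arbitrary variables. -/
def substJetGen {I : Type x} (β : L.Formula (I × List ι)) : (withDer L ι).Formula I :=
  BoundedFormula.subst ((LHom.sumInl : L →ᴸ withDer L ι).onFormula β)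
    (fun p => wordTerm p.2 (Term.var p.1))

/-- The family `a^Γ` of all `γ aᵢ`. -/
def jetGen {I : Type x} {M : Type*} (d : ι → M → M) (a : I → M) : I × List ι → M :=
  fun p => applyWord d p.2 (a p.1)

theorem realize_substJetGen {I : Type x} {M : Type*} [L.Structure M] [(derLang ι).Structure M]
    (β : L.Formula (I × List ι)) (a : I → M) :
    (substJetGen β).Realize a ↔ β.Realize (jetGen (derMap (ι := ι) M) a) := by
  unfold substJetGen Formula.Realize
  rw [BoundedFormula.realize_subst, ← Formula.Realize, LHom.realize_onFormula]
  simp only [realize_wordTerm, Term.realize_var]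
  rfl

theorem realize_substJet {n : ℕ} {M : Type*} [L.Structure M] [(derLang ι).Structure M]
    (β : L.Formula (Fin n × List ι)) (a : Fin n → M) :
    (substJet β).Realize a ↔ β.Realize (jet (derMap (ι := ι) M) a) :=
  realize_substJetGen β a

theorem model_of_sumInl {U : L.Theory} {U' : (withDer L ι).Theory}
    (hU : ∀ σ ∈ U, U' ⊨ᵇ (LHom.sumInl : L →ᴸ withDer L ι).onSentence σ) {M : Type*} [Nonempty M]
    [L.Structure M] [(derLang ι).Structure M] (hM : M ⊨ U') : M ⊨ U :=
  ⟨fun σ hσ => (LHom.realize_onSentence M LHom.sumInl σ).1 ((hU σ hσ).realize_sentence M)⟩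

/-- The jet of a concatenated tuple is the concatenation of the jets, so the `L`-formula equivalent
to φ still separates into an x-side and a y-side. Cutting both sides down to the finitely many
coordinates that occur gives the pattern in the reduct. Order and independence patterns are treated
at once. -/
theorem HasPattern.of_reduction {U : L.Theory} {U' : (withDer L ι).Theory}
    (hU : ∀ σ ∈ U, U' ⊨ᵇ (LHom.sumInl : L →ᴸ withDer L ι).onSentence σ)
    (hred : ∀ (n : ℕ) (α : (withDer L ι).Formula (Fin n)),
      ∃ β : L.Formula (Fin n × List ι), U' ⊨ᵇ α.iff (substJet β))
    {I J : Type} {R : I → J → Prop} (h : HasPattern U' R) : HasPattern U R := by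
  obtain ⟨m, n, φ, M, a, b, hab⟩ := h
  obtain ⟨β, hβ⟩ := hred (m + n) (φ.relabel finSumFinEquiv)
  obtain @⟨M, S, hM, hne⟩ := M
  obtain ⟨S1, S2, rfl⟩ := exists_sumStructure S
  have key : ∀ c : Fin m ⊕ Fin n → M, φ.Realize c ↔
      β.Realize (jet (derMap (ι := ι) M) (c ∘ finSumFinEquiv.symm)) := by
    intro c
    have h1 := hβ.realize_formula M (v := c ∘ finSumFinEquiv.symm)
    rw [Formula.realize_iff, Formula.realize_relabel, realize_substJet] at h1
    rw [← h1]
    simp [Function.comp_assoc]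
  let E : Fin (m + n) × List ι → (Fin m × List ι) ⊕ (Fin n × List ι) := fun p =>
    Sum.map (fun i => (i, p.2)) (fun i => (i, p.2)) (finSumFinEquiv.symm p.1)
  obtain ⟨m', n', f, g, ψ, hψ⟩ := exists_fin_formula (β.relabel E)
  refine hasPattern_of_model ψ M (model_of_sumInl hU hM)
    (fun i => jet (derMap (ι := ι) M) (a i) ∘ f) (fun j => jet (derMap (ι := ι) M) (b j) ∘ g)
    (fun i j => ?_)
  rw [hψ, Formula.realize_relabel, ← hab, key]
  have : Sum.elim (jet (derMap (ι := ι) M) (a i)) (jet (derMap (ι := ι) M) (b j)) ∘ E =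
      jet (derMap (ι := ι) M) (Sum.elim (a i) (b j) ∘ finSumFinEquiv.symm) := by
    funext p
    simp only [E, jet, Function.comp]
    rcases finSumFinEquiv.symm p.1 with k | k <;> rfl
  rw [this]

theorem mem_typeOver_iff {L : FirstOrder.Language.{u, v}} {M : Type w} [L.Structure M] [Nonempty M]
    {B : Set M} {α : Type x} (a : α → M) (φ : L[[B]].Formula α) :
    Formula.equivSentence φ ∈ typeOver L B a ↔ φ.Realize a :=
  Theory.CompleteType.formula_mem_typeOf

theorem typeOver_eq_iff {L : FirstOrder.Language.{u, v}} {M : Type w} [L.Structure M] [Nonempty M]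
    {B : Set M} {α : Type x} (a a' : α → M) :
    typeOver L B a = typeOver L B a' ↔ ∀ φ : L.Formula (B ⊕ α),
      φ.Realize (Sum.elim (↑) a) ↔ φ.Realize (Sum.elim (↑) a') := by
  constructor
  · intro h φ
    have h1 : ∀ c : α → M, (BoundedFormula.constantsVarsEquiv.symm φ).Realize c (default : Fin 0 → M) ↔
        φ.Realize (Sum.elim (↑) c) := by
      intro c
      have := BoundedFormula.realize_constantsVarsEquiv (L := L) (M := M) (α := B)
        (φ := BoundedFormula.constantsVarsEquiv.symm φ) (v := c) (xs := (default : Fin 0 → M))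
      rw [Equiv.apply_symm_apply] at this
      exact this.symm
    rw [← h1, ← h1]
    have h2 := mem_typeOver_iff (B := B) a (BoundedFormula.constantsVarsEquiv.symm φ)
    have h3 := mem_typeOver_iff (B := B) a' (BoundedFormula.constantsVarsEquiv.symm φ)
    rw [h] at h2
    exact h2.symm.trans h3
  · intro h
    refine SetLike.ext fun σ => ?_
    obtain ⟨φ, rfl⟩ := Formula.equivSentence.surjective σ
    rw [mem_typeOver_iff, mem_typeOver_iff]
    have h1 : ∀ c : α → M, φ.Realize c ↔
        Formula.Realize (BoundedFormula.constantsVarsEquiv φ) (Sum.elim (fun b : B => (b : M)) c) := by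
      intro c
      exact (BoundedFormula.realize_constantsVarsEquiv (L := L) (M := M) (α := B)
        (φ := φ) (v := c) (xs := (default : Fin 0 → M))).symm
    rw [h1, h1]
    exact h _

/-- Parameters are treated as further variables: the reduction applies to the finitely many
variables that occur, and the jets of those from B land in B^Γ, hence are parameters of the
`L`-type. -/
theorem typeOver_eq_of_jet {U' : (withDer L ι).Theory}
    (hred : ∀ (n : ℕ) (α : (withDer L ι).Formula (Fin n)),
      ∃ β : L.Formula (Fin n × List ι), U' ⊨ᵇ α.iff (substJet β))
    (M : Type x) [Nonempty M] [L.Structure M] [(derLang ι).Structure M]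
    (hM : M ⊨ U') (n : ℕ) (a a' : Fin n → M) (B : Set M)
    (h : typeOver L (jetSet (derMap (ι := ι) M) B) (jet (derMap (ι := ι) M) a) =
      typeOver L (jetSet (derMap (ι := ι) M) B) (jet (derMap (ι := ι) M) a')) :
    typeOver (withDer L ι) B a = typeOver (withDer L ι) B a' := by
  rw [typeOver_eq_iff] at h ⊢
  intro φ
  obtain ⟨s, ψ, hψ⟩ := exists_finset_formula φ
  let e := s.equivFin
  obtain ⟨β, hβ⟩ := hred s.card (ψ.relabel e)
  let G : Fin s.card × List ι → jetSet (derMap (ι := ι) M) B ⊕ (Fin n × List ι) := fun p =>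
    match (e.symm p.1 : B ⊕ Fin n) with
    | Sum.inl b => Sum.inl ⟨applyWord (derMap M) p.2 b, b, b.2, p.2, rfl⟩
    | Sum.inr k => Sum.inr (k, p.2)
  have key : ∀ c : Fin n → M, φ.Realize (Sum.elim (fun b : B => (b : M)) c) ↔
      (β.relabel G).Realize
        (Sum.elim (fun b : jetSet (derMap (ι := ι) M) B => (b : M)) (jet (derMap (ι := ι) M) c)) := by
    intro c
    rw [← hψ]
    have h1 := hβ.realize_formula M
      (v := fun i => Sum.elim (fun b : B => (b : M)) c (e.symm i : B ⊕ Fin n))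
    rw [Formula.realize_iff, Formula.realize_relabel, realize_substJet] at h1
    rw [Formula.realize_relabel]
    have e1 : ((fun i => Sum.elim (fun b : B => (b : M)) c (e.symm i : B ⊕ Fin n)) ∘ e) =
      fun i : s => Sum.elim (fun b : B => (b : M)) c i := by
      funext i; simp
    rw [e1] at h1
    rw [h1]
    have e2 : jet (derMap (ι := ι) M)
        (fun i => Sum.elim (fun b : B => (b : M)) c (e.symm i : B ⊕ Fin n)) =
        Sum.elim (fun b : jetSet (derMap (ι := ι) M) B => (b : M)) (jet (derMap (ι := ι) M) c) ∘ G := by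
      funext p
      simp only [jet, G, Function.comp]
      rcases (e.symm p.1 : B ⊕ Fin n) with k | k <;> rfl
    rw [e2]
  rw [key, key]
  exact h _

end PartA

/-! ### Jet-definable relations and elimination of one quantifier -/

section JetDef

variable {L : FirstOrder.Language.{u, v}} {ι : Type}

/-- The family `S` of relations on the models of `U'` is definable by an `L`-formula in the
jets of its arguments. -/
def JetDef (U' : (withDer L ι).Theory) {I : Type}
    (S : ∀ (M : Type (max u v)) [L.Structure M] [(derLang ι).Structure M], (I → M) → Prop) : Prop :=
  ∃ β : L.Formula (I × List ι), ∀ (M : Type (max u v)) [Nonempty M] [L.Structure M]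
    [(derLang ι).Structure M], M ⊨ U' → ∀ a : I → M,
      S M a ↔ β.Realize (jetGen (derMap (ι := ι) M) a)

/-- The projection of a jet-definable family along one coordinate is jet-definable. -/
def JetExists (U' : (withDer L ι).Theory) : Prop :=
  ∀ (I : Type) [Finite I] (β : L.Formula (Option I × List ι)),
    JetDef U' (fun M _ _ a => ∃ c : M,
      β.Realize (jetGen (derMap (ι := ι) M) (fun o : Option I => o.elim c a)))

namespace JetDef

variable {U' : (withDer L ι).Theory} {I J : Type}
  {S S' : ∀ (M : Type (max u v)) [L.Structure M] [(derLang ι).Structure M], (I → M) → Prop}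

theorem congr (h : JetDef U' S) (hS : ∀ (M : Type (max u v)) [L.Structure M]
    [(derLang ι).Structure M], M ⊨ U' → ∀ a, S M a ↔ S' M a) : JetDef U' S' := by
  obtain ⟨β, hβ⟩ := h
  exact ⟨β, fun M _ _ _ hM a => (hS M hM a).symm.trans (hβ M hM a)⟩

theorem relabel (h : JetDef U' S) (f : I → J) : JetDef U' (fun M _ _ a => S M (a ∘ f)) := by
  obtain ⟨β, hβ⟩ := h
  refine ⟨β.relabel (fun p => (f p.1, p.2)), fun M _ _ _ hM a => ?_⟩
  beta_reduce
  rw [hβ M hM, Formula.realize_relabel]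
  rfl

theorem imp (h : JetDef U' S) (h' : JetDef U' S') : JetDef U' (fun M _ _ a => S M a → S' M a) := by
  obtain ⟨β, hβ⟩ := h
  obtain ⟨β', hβ'⟩ := h'
  refine ⟨β.imp β', fun M _ _ _ hM a => ?_⟩
  beta_reduce
  rw [hβ M hM, hβ' M hM, Formula.realize_imp]

theorem not (h : JetDef U' S) : JetDef U' (fun M _ _ a => ¬ S M a) := by
  obtain ⟨β, hβ⟩ := h
  refine ⟨β.not, fun M _ _ _ hM a => ?_⟩
  beta_reduce
  rw [hβ M hM, Formula.realize_not]

theorem and (h : JetDef U' S) (h' : JetDef U' S') : JetDef U' (fun M _ _ a => S M a ∧ S' M a) := by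
  obtain ⟨β, hβ⟩ := h
  obtain ⟨β', hβ'⟩ := h'
  refine ⟨β ⊓ β', fun M _ _ _ hM a => ?_⟩
  beta_reduce
  rw [hβ M hM, hβ' M hM, Formula.realize_inf]

theorem forallFinite {n : ℕ} {R : Fin n → ∀ (M : Type (max u v)) [L.Structure M]
    [(derLang ι).Structure M], (I → M) → Prop} (h : ∀ i, JetDef U' (R i)) :
    JetDef U' (fun M _ _ a => ∀ i, R i M a) := by
  choose β hβ using h
  refine ⟨BoundedFormula.iInf β, fun M _ _ _ hM a => ?_⟩
  rw [Formula.Realize, BoundedFormula.realize_iInf]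
  exact forall_congr' fun i => hβ i M hM a

theorem ofFormula (φ : L.Formula I) : JetDef U' (fun _ _ _ a => φ.Realize a) := by
  refine ⟨φ.relabel (fun i => (i, [])), fun M _ _ _ hM a => ?_⟩
  rw [Formula.realize_relabel]
  rfl

theorem ex [Finite I] (hU : JetExists U')
    {S : ∀ (M : Type (max u v)) [L.Structure M] [(derLang ι).Structure M], (Option I → M) → Prop}
    (h : JetDef U' S) : JetDef U' (fun M _ _ a => ∃ c : M, S M (fun o => o.elim c a)) := by
  obtain ⟨β, hβ⟩ := h
  obtain ⟨β', hβ'⟩ := hU I β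
  exact ⟨β', fun M _ _ _ hM a => by rw [← hβ' M hM]; exact exists_congr fun c => hβ M hM _⟩

theorem exFin (hU : JetExists U') (n : ℕ) : ∀ (I : Type) [Finite I]
    {S : ∀ (M : Type (max u v)) [L.Structure M] [(derLang ι).Structure M], (I ⊕ Fin n → M) → Prop}
    (_ : JetDef U' S), JetDef U' (fun M _ _ a => ∃ c : Fin n → M, S M (Sum.elim a c)) := by
  induction n with
  | zero =>
    intro I _ S h
    refine (h.relabel (Sum.elim id Fin.elim0)).congr fun M _ _ _ a => ?_
    have : ∀ c : Fin 0 → M, Sum.elim a c = a ∘ Sum.elim id Fin.elim0 := by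
      intro c; funext i; rcases i with i | i
      · rfl
      · exact i.elim0
    simp [this]
  | succ n ih =>
    intro I _ S h
    have h1 : JetDef U' _ := h.relabel (J := Option I ⊕ Fin n)
      (Sum.elim (fun i => Sum.inl (some i)) (Fin.cons (Sum.inl none) Sum.inr))
    refine ((ih (Option I) h1).ex hU).congr fun M _ _ _ a => ?_
    have key : ∀ (c : M) (d : Fin n → M),
        (Sum.elim (fun o : Option I => o.elim c a) d ∘
          (Sum.elim (fun i => Sum.inl (some i)) (Fin.cons (Sum.inl none) Sum.inr) :
            I ⊕ Fin (n + 1) → Option I ⊕ Fin n)) = Sum.elim a (Fin.cons c d) := by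
      intro c d
      funext i
      rcases i with i | i
      · rfl
      · refine Fin.cases ?_ (fun j => ?_) i <;> simp
    constructor
    · rintro ⟨c, d, h⟩
      exact ⟨_, key c d ▸ h⟩
    · rintro ⟨c, h⟩
      refine ⟨c 0, Fin.tail c, ?_⟩
      rw [key, Fin.cons_self_tail]
      exact h

/-- A term may nest symbols of `L` and derivations arbitrarily, and nothing is assumed on how
derivations act on functions of `L`. Each argument is therefore named by a new existentially
quantified variable, which leaves only unnested equations. -/
theorem termEq [Finite I] (hU : JetExists U') (t : (withDer L ι).Term I) :
    JetDef U' (fun M _ _ (a : Option I → M) => a none = t.realize (fun i => a (some i))) := by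
  induction t with
  | var i =>
    exact ofFormula (Term.equal (Term.var none) (Term.var (some i))) |>.congr
      fun M _ _ _ a => by rw [Formula.realize_equal]; rfl
  | @func n f ts ih =>
    have h1 : JetDef U' (fun M _ _ (a : Option I ⊕ Fin n → M) =>
        ∀ i, a (Sum.inr i) = (ts i).realize (fun j => a (Sum.inl (some j)))) :=
      forallFinite fun i => ((ih i).relabel
        (J := Option I ⊕ Fin n) (fun o => o.elim (Sum.inr i) (fun j => Sum.inl (some j))))
    have h2 : JetDef U' (fun M _ _ (a : Option I ⊕ Fin n → M) =>
        a (Sum.inl none) = (Structure.funMap (L := withDer L ι) f (fun i => a (Sum.inr i)))) := by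
      rcases f with f | f
      · exact (ofFormula (Term.equal (Term.var (Sum.inl none))
          (Term.func f fun i => Term.var (Sum.inr i)))).congr
          fun M _ _ _ a => by rw [Formula.realize_equal]; rfl
      · obtain ⟨i⟩ := f
        -- The equation x = δᵢ y is atomic in the jets: the coordinate of x at the empty word equals
        -- that of y at the word i.
        refine ⟨Term.equal (Term.var (Sum.inl none, [])) (Term.var (Sum.inr 0, [i])),
          fun M _ _ _ hM a => ?_⟩
        rw [Formula.realize_equal]
        change a (Sum.inl none) = Structure.funMap (derSymb i) (fun i => a (Sum.inr i)) ↔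
          a (Sum.inl none) = Structure.funMap (derSymb i) ![a (Sum.inr 0)]
        have : (fun i => a (Sum.inr i)) = ![a (Sum.inr 0)] := by
          funext j; rw [Subsingleton.elim j 0]; rfl
        rw [this]
    refine (exFin hU n (Option I) (h1.and h2)).congr fun M _ _ _ a => ?_
    constructor
    · rintro ⟨c, h3, h4⟩
      have : c = fun i => (ts i).realize (fun j => a (some j)) := funext h3
      subst this
      exact h4
    · intro h
      exact ⟨fun i => (ts i).realize (fun j => a (some j)), fun i => rfl, h⟩

theorem termsRel [Finite I] (hU : JetExists U') {n : ℕ} (ts : Fin n → (withDer L ι).Term I)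
    (φ : L.Formula (Fin n)) :
    JetDef U' (fun M _ _ (a : I → M) => φ.Realize (fun i => (ts i).realize a)) := by
  have h1 : JetDef U' (fun M _ _ (a : I ⊕ Fin n → M) =>
      ∀ i, a (Sum.inr i) = (ts i).realize (fun j => a (Sum.inl j))) :=
    forallFinite fun i => ((termEq hU (ts i)).relabel
      (J := I ⊕ Fin n) (fun o => o.elim (Sum.inr i) Sum.inl))
  have h2 : JetDef U' (fun M _ _ (a : I ⊕ Fin n → M) => φ.Realize (fun i => a (Sum.inr i))) :=
    (ofFormula φ).relabel Sum.inr
  refine (exFin hU n I (h1.and h2)).congr fun M _ _ _ a => ?_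
  constructor
  · rintro ⟨c, h3, h4⟩
    have : c = fun i => (ts i).realize a := funext h3
    subst this
    exact h4
  · intro h
    exact ⟨fun i => (ts i).realize a, fun i => rfl, h⟩

theorem boundedFormula {α : Type} [Finite α] (hU : JetExists U') {m : ℕ}
    (φ : (withDer L ι).BoundedFormula α m) :
    JetDef U' (fun M _ _ (a : α ⊕ Fin m → M) => φ.Realize (a ∘ Sum.inl) (a ∘ Sum.inr)) := by
  have hs : ∀ {m : ℕ} {M : Type (max u v)} (a : α ⊕ Fin m → M),
      Sum.elim (a ∘ Sum.inl) (a ∘ Sum.inr) = a := fun a => Sum.elim_comp_inl_inr a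
  induction φ with
  | falsum => exact (ofFormula ⊥).congr fun M _ _ _ a => Iff.rfl
  | equal t₁ t₂ =>
    refine (termsRel hU ![t₁, t₂] (Term.equal (Term.var 0) (Term.var 1))).congr
      fun M _ _ _ a => ?_
    rw [Formula.realize_equal]
    change _ ↔ t₁.realize (Sum.elim _ _) = t₂.realize (Sum.elim _ _)
    rw [hs]
    rfl
  | @rel n l R ts =>
    rcases R with R | R
    · refine (termsRel hU ts (Relations.formula R Term.var)).congr fun M _ _ _ a => ?_
      change _ ↔ Structure.RelMap (L := L) R (fun i => (ts i).realize (Sum.elim _ _))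
      rw [hs, Formula.realize_rel]
      rfl
    · exact R.elim
  | imp _ _ h1 h2 => exact h1.imp h2
  | @all m φ ih =>
    have h1 := (ih.not.relabel (J := Option (α ⊕ Fin m))
      (Sum.elim (fun i => some (Sum.inl i))
        (Fin.snoc (α := fun _ => Option (α ⊕ Fin m)) (fun i => some (Sum.inr i)) none)))
    refine (h1.ex hU).not.congr fun M _ _ _ a => ?_
    rw [BoundedFormula.realize_all, not_exists]
    refine forall_congr' fun c => ?_
    rw [not_not]
    have e1 : (((fun o : Option (α ⊕ Fin m) => o.elim c a) ∘ (Sum.elim (fun i => some (Sum.inl i))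
        (Fin.snoc (α := fun _ => Option (α ⊕ Fin m)) (fun i => some (Sum.inr i)) none))) ∘
          Sum.inr) = (Fin.snoc (α := fun _ => M) (a ∘ Sum.inr) c : Fin (m + 1) → M) := by
      funext i
      refine Fin.lastCases ?_ (fun j => ?_) i <;> simp
    rw [e1]
    rfl

/-- This is exactly the reduction hypothesis of part (A). -/
theorem models_iff {n : ℕ} (hU : JetExists U') (α : (withDer L ι).Formula (Fin n)) :
    ∃ β : L.Formula (Fin n × List ι), U' ⊨ᵇ α.iff (substJet β) := by
  obtain ⟨β, hβ⟩ := (boundedFormula hU α).relabel (J := Fin n) (Sum.elim id Fin.elim0)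
  refine ⟨β, ?_⟩
  rw [Theory.models_formula_iff]
  rintro @⟨M, S, hM, hne⟩ a
  obtain ⟨S1, S2, rfl⟩ := exists_sumStructure S
  have h := hβ M hM a
  refine Formula.realize_iff.2 (Iff.trans ?_ (realize_substJet (M := M) β a).symm)
  refine Iff.trans ?_ h
  unfold Formula.Realize
  rw [Subsingleton.elim (default : Fin 0 → M)
    ((a ∘ Sum.elim id Fin.elim0 : Fin n ⊕ Fin 0 → M) ∘ Sum.inr)]
  rfl

end JetDef

/-- A criterion for elimination of one existential quantifier: it suffices to find, for every
solution in a model, a jet formula satisfied there that implies solvability in all models. -/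
theorem jetExists_of_local {U' : (withDer L ι).Theory}
    (h : ∀ (I : Type) [Finite I] (β : L.Formula (Option I × List ι))
      (M : Type (max u v)) [Nonempty M] [L.Structure M] [(derLang ι).Structure M], M ⊨ U' →
      ∀ (a : I → M) (c : M),
        β.Realize (jetGen (derMap (ι := ι) M) (fun o : Option I => o.elim c a)) →
        ∃ χ : L.Formula (I × List ι), χ.Realize (jetGen (derMap (ι := ι) M) a) ∧
          ∀ (N : Type (max u v)) [Nonempty N] [L.Structure N] [(derLang ι).Structure N], N ⊨ U' →
            ∀ b : I → N, χ.Realize (jetGen (derMap (ι := ι) N) b) →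
              ∃ d : N, β.Realize
                (jetGen (derMap (ι := ι) N) (fun o : Option I => o.elim d b))) :
    JetExists U' := by
  classical
  intro I _ β
  let good : Set (L.Formula (I × List ι)) := {χ |
    ∀ (N : Type (max u v)) [Nonempty N] [L.Structure N] [(derLang ι).Structure N], N ⊨ U' →
      ∀ b : I → N, χ.Realize (jetGen (derMap (ι := ι) N) b) →
        ∃ d : N, β.Realize (jetGen (derMap (ι := ι) N) (fun o : Option I => o.elim d b))}
  let E : (withDer L ι).Formula I :=
    Formula.iExs Unit ((substJetGen β).relabel (fun o : Option I => o.elim (Sum.inr ()) Sum.inl))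
  have hE : ∀ (N : Type (max u v)) [L.Structure N] [(derLang ι).Structure N] (b : I → N),
      E.Realize b ↔
        ∃ d : N, β.Realize (jetGen (derMap (ι := ι) N) (fun o : Option I => o.elim d b)) := by
    intro N _ _ b
    rw [Formula.realize_iExs]
    have : ∀ d : Unit → N, (Sum.elim b d ∘ fun o : Option I => o.elim (Sum.inr ()) Sum.inl) =
        fun o : Option I => o.elim (d ()) b := by
      intro d; funext o; cases o <;> rfl
    simp only [Formula.realize_relabel, realize_substJetGen, this]
    exact ⟨fun ⟨d, hd⟩ => ⟨d (), hd⟩, fun ⟨d, hd⟩ => ⟨fun _ => d, hd⟩⟩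
  by_contra hcon
  have hfin : ∀ s : Finset (L.Formula (I × List ι)), (s : Set _) ⊆ good →
      ∃ (M : Type (max u v)) (_ : Nonempty M) (_ : L.Structure M) (_ : (derLang ι).Structure M)
        (_ : M ⊨ U') (a : I → M), E.Realize a ∧
          ∀ χ ∈ s, ¬ χ.Realize (jetGen (derMap (ι := ι) M) a) := by
    intro s hs
    by_contra hno
    -- If finitely many good formulas covered all solvable tuples, their disjunction would define
    -- solvability.
    refine hcon ⟨BoundedFormula.iSup (fun χ : s => χ.1), fun M _ _ _ hM a => ?_⟩
    beta_reduce
    rw [← hE, Formula.Realize.eq_def (BoundedFormula.iSup _), BoundedFormula.realize_iSup]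
    constructor
    · intro hEa
      by_contra h2
      refine hno ⟨M, inferInstance, inferInstance, inferInstance, hM, a, hEa, fun χ hχ h3 => h2 ?_⟩
      exact ⟨⟨χ, hχ⟩, h3⟩
    · rintro ⟨⟨χ, hχ⟩, h3⟩
      exact (hE M a).2 (hs hχ M hM a h3)
  -- Compactness yields a solvable tuple at which every good formula fails; the local hypothesis
  -- provides a good formula that holds there.
  obtain ⟨M, a, ha⟩ := exists_realize_of_finite (T := U')
    (insert E ((fun χ => (substJetGen χ).not) '' good)) (by
    intro s hs
    -- `g` recovers a good χ from the formula ¬χ; its value ⊥ on other formulas is never used.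
    let g : (withDer L ι).Formula I → L.Formula (I × List ι) := fun φ =>
      if h : ∃ χ ∈ good, (substJetGen χ).not = φ then h.choose else ⊥
    have hg : ∀ φ ∈ s, φ = E ∨ (g φ ∈ good ∧ (substJetGen (g φ)).not = φ) := by
      intro φ hφ
      rcases hs hφ with h1 | h1
      · exact Or.inl h1
      · have h2 : ∃ χ ∈ good, (substJetGen χ).not = φ := h1
        right
        simp only [g, dif_pos h2]
        exact h2.choose_spec
    obtain ⟨M, h1, h2, h3, h4, a, h5, h6⟩ := hfin ((s.image g).filter (· ∈ good)) (by
      intro χ hχ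
      exact (Finset.mem_filter.1 (Finset.mem_coe.1 hχ)).2)
    refine ⟨M, h1, inferInstance, h4, a, fun φ hφ => ?_⟩
    rcases hg φ hφ with rfl | ⟨h7, h8⟩
    · exact h5
    · rw [← h8, Formula.realize_not, realize_substJetGen]
      exact h6 _ (Finset.mem_filter.2 ⟨Finset.mem_image_of_mem _ hφ, h7⟩))
  obtain @⟨M, S, hM, hne⟩ := M
  obtain ⟨S1, S2, rfl⟩ := exists_sumStructure S
  obtain ⟨c, hc⟩ := (hE M a).1 (ha E (Set.mem_insert _ _))
  obtain ⟨χ, hχ, hχ'⟩ := h I β M hM a c hc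
  have h9 := ha _ (Set.mem_insert_of_mem _ ⟨χ, hχ', rfl⟩)
  exact (Formula.realize_not.1 h9) ((realize_substJetGen χ a).2 hχ)

end JetDef

/-! ### Transfer from K to the models of its theory -/

section Transfer

/-- A formula that holds everywhere in `K` holds everywhere in every model of `Th(K)`. -/
theorem transfer {L : FirstOrder.Language.{u, v}} {K : Type w} [L.Structure K] [Nonempty K]
    {M : Type x} [L.Structure M] [Nonempty M] (hM : M ⊨ L.completeTheory K) {I : Type y}
    (φ : L.Formula I) (h : ∀ a : I → K, φ.Realize a) (a : I → M) : φ.Realize a := by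
  classical
  let ψ : L.Formula φ.freeVarFinset := BoundedFormula.restrictFreeVar φ id
  have hψ : ∀ (N : Type w) [L.Structure N] (a : I → N),
      ψ.Realize (fun i : φ.freeVarFinset => a i) ↔ φ.Realize a := fun N _ a =>
    BoundedFormula.realize_restrictFreeVar a (fun _ => rfl)
  have hψ' : ∀ (N : Type x) [L.Structure N] (a : I → N),
      ψ.Realize (fun i : φ.freeVarFinset => a i) ↔ φ.Realize a := fun N _ a =>
    BoundedFormula.realize_restrictFreeVar a (fun _ => rfl)
  let σ : L.Sentence := Formula.iAlls φ.freeVarFinset (ψ.relabel Sum.inr : L.Formula (Empty ⊕ _))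
  have hσ : K ⊨ σ := by
    refine Formula.realize_iAlls.2 fun b => ?_
    rw [Formula.realize_relabel]
    -- Variables that do not occur in φ get an arbitrary value.
    have h1 := (hψ K (fun i => if hi : i ∈ φ.freeVarFinset then b ⟨i, hi⟩ else
      Classical.arbitrary K)).2 (h _)
    convert h1 using 1
    funext i
    simp
  have hσM : M ⊨ σ := hM.realize_of_mem σ hσ
  have h2 := Formula.realize_iAlls.1 hσM (fun i => a i)
  rw [Formula.realize_relabel] at h2
  exact (hψ' M a).1 h2

end Transfer

/-! ### The field F = dcl(∅) inside the models of Th(K) -/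

section DclHom

variable {L : FirstOrder.Language.{u, v}} (ρ : FirstOrder.Language.ring →ᴸ L) (K : Type w) [Field K]
    [FirstOrder.Ring.CompatibleRing K] [L.Structure K] [ρ.IsExpansionOn K]

/-- A formula that defines the given element of `dcl(∅)`. -/
noncomputable def defFormula (c : dclEmpty ρ K) : L.Formula Unit := c.2.choose

theorem definesPoint_defFormula (c : dclEmpty ρ K) : DefinesPoint (defFormula ρ K c) (c : K) :=
  c.2.choose_spec

variable {ρ K} {M : Type x} [L.Structure M] [Nonempty M]

omit [FirstOrder.Ring.CompatibleRing K] in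
theorem exists_definesPoint (hM : M ⊨ L.completeTheory K) {ψ : L.Formula Unit} {c : K}
    (hψ : DefinesPoint ψ c) : ∃ y : M, DefinesPoint ψ y := by
  have h1 := transfer hM (I := Empty)
    (Formula.iExs Unit (ψ.relabel Sum.inr)) (fun a => by
      rw [Formula.realize_iExs]
      refine ⟨fun _ => c, ?_⟩
      rw [Formula.realize_relabel]
      exact (hψ c).2 rfl) Empty.elim
  obtain ⟨y, hy⟩ := Formula.realize_iExs.1 h1
  rw [Formula.realize_relabel] at hy
  refine ⟨y (), fun z => ⟨fun hz => ?_, ?_⟩⟩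
  · have h2 := transfer hM (I := Fin 2)
      ((ψ.relabel (fun _ => 0)).imp ((ψ.relabel (fun _ => 1)).imp
        (Term.equal (Term.var 0) (Term.var 1)))) (fun a => by
      simp only [Formula.realize_imp, Formula.realize_relabel, Formula.realize_equal,
        Term.realize_var]
      intro h3 h4
      rw [(hψ (a 0)).1 h3, (hψ (a 1)).1 h4]) ![z, y ()]
    simp only [Formula.realize_imp, Formula.realize_relabel, Formula.realize_equal,
        Term.realize_var] at h2
    exact h2 hz hy
  · rintro rfl
    exact hy

/-- The realization in `M` of an element of `dcl(∅)`. -/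
noncomputable def dclMap (hM : M ⊨ L.completeTheory K) (c : dclEmpty ρ K) : M :=
  (exists_definesPoint hM (definesPoint_defFormula ρ K c)).choose

theorem realize_defFormula (hM : M ⊨ L.completeTheory K) (c : dclEmpty ρ K) :
    DefinesPoint (defFormula ρ K c) (dclMap hM c) :=
  (exists_definesPoint hM (definesPoint_defFormula ρ K c)).choose_spec

/-- Two definitions of the same point of K are equivalent in K, hence in M; so the image of an
element does not depend on the formula chosen to define it. -/
theorem definesPoint_dclMap (hM : M ⊨ L.completeTheory K) {c : dclEmpty ρ K} {ψ : L.Formula Unit}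
    (hψ : DefinesPoint ψ (c : K)) : DefinesPoint ψ (dclMap hM c) := by
  intro z
  rw [← realize_defFormula hM c z]
  have h := transfer hM (ψ.iff (defFormula ρ K c)) (fun a => by
    rw [Formula.realize_iff]
    exact (hψ (a ())).trans (definesPoint_defFormula ρ K c (a ())).symm) (fun _ => z)
  exact Formula.realize_iff.1 h

end DclHom

section DclRingHom

variable {L : FirstOrder.Language.{u, v}} {ρ : FirstOrder.Language.ring →ᴸ L} {K : Type w} [Field K]
    [FirstOrder.Ring.CompatibleRing K] [L.Structure K] [ρ.IsExpansionOn K]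
    {M : Type x} [Field M] [FirstOrder.Ring.CompatibleRing M] [L.Structure M] [ρ.IsExpansionOn M]

/-- An identity between an element of dcl(∅) and a ring term in others is a first-order statement
about their definitions. Applied to 0, 1, sums and products it gives all axioms of a ring
homomorphism. -/
theorem dclMap_term (hM : M ⊨ L.completeTheory K) {n : ℕ} (t : FirstOrder.Language.ring.Term (Fin n))
    (c : Fin n → dclEmpty ρ K) (c' : dclEmpty ρ K) (h : (c' : K) = t.realize (fun i => (c i : K))) :
    dclMap hM c' = t.realize (fun i => dclMap hM (c i)) := by
  have h1 := transfer hM (I := Option (Fin n))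
    ((BoundedFormula.iInf fun i => (defFormula ρ K (c i)).relabel (fun _ => some i)).imp
      (((defFormula ρ K c').relabel (fun _ => none)).imp
        (Term.equal (Term.var none) ((ρ.onTerm t).relabel some)))) (fun a => by
    simp only [Formula.realize_imp, Formula.realize_relabel, Formula.realize_equal,
      Term.realize_var, Term.realize_relabel, realize_ringTerm]
    intro h2 h3
    have h4 : ∀ i, a (some i) = c i := by
      intro i
      have h5 := (BoundedFormula.realize_iInf.1 h2) i
      exact (definesPoint_defFormula ρ K (c i) _).1 (Formula.realize_relabel.1 h5)
    rw [(definesPoint_defFormula ρ K c' (a none)).1 h3, h]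
    congr 1
    funext i
    exact (h4 i).symm) (fun o => o.elim (dclMap hM c') (fun i => dclMap hM (c i)))
  simp only [Formula.realize_imp, Formula.realize_relabel, Formula.realize_equal,
      Term.realize_var, Term.realize_relabel, realize_ringTerm] at h1
  refine h1 (BoundedFormula.realize_iInf.2 fun i => ?_) ((realize_defFormula hM c' _).2 rfl)
  exact Formula.realize_relabel.2 ((realize_defFormula hM (c i) _).2 rfl)

/-- The embedding of `dcl(∅)` in a model of `Th(K)`. -/
noncomputable def dclHom (hM : M ⊨ L.completeTheory K) : dclEmpty ρ K →+* M where
  toFun := dclMap hM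
  map_zero' := by
    rw [dclMap_term hM (0 : FirstOrder.Language.ring.Term (Fin 0)) ![] 0 (by simp)]
    simp
  map_one' := by
    rw [dclMap_term hM (1 : FirstOrder.Language.ring.Term (Fin 0)) ![] 1 (by simp)]
    simp
  map_add' := fun a b => by
    rw [dclMap_term hM (Term.var 0 + Term.var 1 : FirstOrder.Language.ring.Term (Fin 2)) ![a, b]
      (a + b) (by simp)]
    simp
  map_mul' := fun a b => by
    rw [dclMap_term hM (Term.var 0 * Term.var 1 : FirstOrder.Language.ring.Term (Fin 2)) ![a, b]
      (a * b) (by simp)]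
    simp

theorem definesPoint_dclHom (hM : M ⊨ L.completeTheory K) {c : dclEmpty ρ K} {ψ : L.Formula Unit}
    (hψ : DefinesPoint ψ (c : K)) : DefinesPoint ψ (dclHom hM c) :=
  definesPoint_dclMap hM hψ

theorem dclHom_self (c : dclEmpty ρ K) :
    dclHom (M := K) (inferInstance : K ⊨ L.completeTheory K) c = c :=
  ((definesPoint_dclHom (M := K) inferInstance (definesPoint_defFormula ρ K c) _).1
    ((definesPoint_defFormula ρ K c _).2 rfl)).symm

/-- Replace the constants from `dcl(∅)` in a formula by their definitions. -/
noncomputable def elimConst {J : Type y} (φ : L.Formula (J ⊕ dclEmpty ρ K)) : L.Formula J := by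
  classical
  exact Formula.iExs φ.freeVarFinset.toRight
    (BoundedFormula.iInf (fun c : φ.freeVarFinset.toRight =>
        (defFormula ρ K c.1).relabel (fun _ => Sum.inr c)) ⊓
      (BoundedFormula.restrictFreeVar φ (fun i => match i with
        | ⟨Sum.inl j, _⟩ => Sum.inl j
        | ⟨Sum.inr c, h⟩ => Sum.inr ⟨c, by simpa using h⟩) :
        L.Formula (J ⊕ φ.freeVarFinset.toRight)))

theorem realize_elimConst (hM : M ⊨ L.completeTheory K) {J : Type y}
    (φ : L.Formula (J ⊕ dclEmpty ρ K)) (a : J → M) :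
    (elimConst φ).Realize a ↔ φ.Realize (Sum.elim a (dclHom hM)) := by
  classical
  rw [elimConst, Formula.realize_iExs]
  have key : ∀ b : φ.freeVarFinset.toRight → M, (∀ c, b c = dclHom hM c.1) →
      (Formula.Realize (BoundedFormula.restrictFreeVar φ (fun i => match i with
        | ⟨Sum.inl j, _⟩ => Sum.inl j
        | ⟨Sum.inr c, h⟩ => Sum.inr ⟨c, by simpa using h⟩) :
        L.Formula (J ⊕ φ.freeVarFinset.toRight)) (Sum.elim a b) ↔
        φ.Realize (Sum.elim a (dclHom hM))) := by
    intro b hb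
    refine BoundedFormula.realize_restrictFreeVar (Sum.elim a (dclHom hM)) ?_
    rintro ⟨j | c, h⟩
    · rfl
    · exact hb _
  constructor
  · rintro ⟨b, hb⟩
    obtain ⟨h1, h2⟩ := Formula.realize_inf.1 hb
    refine (key b fun c => ?_).1 h2
    have := Formula.realize_relabel.1 (BoundedFormula.realize_iInf.1 h1 c)
    exact (definesPoint_dclHom hM (definesPoint_defFormula ρ K c.1) _).1 this
  · intro h
    refine ⟨fun c => dclHom hM c.1, Formula.realize_inf.2 ⟨BoundedFormula.realize_iInf.2 fun c => ?_,
      (key _ fun _ => rfl).2 h⟩⟩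
    exact Formula.realize_relabel.2
      ((definesPoint_dclHom hM (definesPoint_defFormula ρ K c.1) _).2 rfl)

/-- Coefficients are treated as further variables, so that polynomials become ring terms with
constants. -/
theorem exists_freeCommRing {J : Type y} {F : Type w} [CommRing F] (Q : MvPolynomial J F) :
    ∃ p : FreeCommRing (J ⊕ F),
      FreeCommRing.lift (Sum.elim MvPolynomial.X (fun c => MvPolynomial.C c)) p = Q := by
  induction Q using MvPolynomial.induction_on with
  | C c => exact ⟨FreeCommRing.of (Sum.inr c), by simp⟩
  | add p q hp hq =>
    obtain ⟨p', rfl⟩ := hp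
    obtain ⟨q', rfl⟩ := hq
    exact ⟨p' + q', map_add _ _ _⟩
  | mul_X p j hp =>
    obtain ⟨p', rfl⟩ := hp
    exact ⟨p' * FreeCommRing.of (Sum.inl j), by simp⟩

/-- A polynomial over `dcl(∅)`, as a term with constants from `dcl(∅)`. -/
noncomputable def polyTerm {J : Type y} (Q : MvPolynomial J (dclEmpty ρ K)) :
    L.Term (J ⊕ dclEmpty ρ K) :=
  ρ.onTerm (FirstOrder.Ring.termOfFreeCommRing (exists_freeCommRing Q).choose)

theorem realize_polyTerm (hM : M ⊨ L.completeTheory K) {J : Type y}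
    (Q : MvPolynomial J (dclEmpty ρ K)) (a : J → M) :
    (polyTerm Q).realize (Sum.elim a (dclHom hM)) = Q.eval₂ (dclHom hM) a := by
  rw [polyTerm, realize_ringTerm, FirstOrder.Ring.realize_termOfFreeCommRing]
  conv_rhs => rw [← (exists_freeCommRing Q).choose_spec]
  generalize (exists_freeCommRing Q).choose = p
  change _ = (MvPolynomial.eval₂Hom (dclHom hM) a) _
  rw [← RingHom.comp_apply]
  congr 1
  ext z
  rcases z with z | z <;> simp

/-- Substitute polynomials over `dcl(∅)` for the variables of a formula. -/
noncomputable def substPoly {J : Type y} {I : Type*} (φ : L.Formula I)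
    (Q : I → MvPolynomial J (dclEmpty ρ K)) : L.Formula J :=
  elimConst (BoundedFormula.subst φ fun i => polyTerm (Q i))

theorem realize_substPoly (hM : M ⊨ L.completeTheory K) {J : Type y} {I : Type*} (φ : L.Formula I)
    (Q : I → MvPolynomial J (dclEmpty ρ K)) (a : J → M) :
    (substPoly φ Q).Realize a ↔ φ.Realize (fun i => (Q i).eval₂ (dclHom hM) a) := by
  rw [substPoly, realize_elimConst hM, Formula.Realize, BoundedFormula.realize_subst]
  simp only [realize_polyTerm]
  rfl

/-- The formula `Q = 0`. -/
noncomputable def polyZero {J : Type y} (Q : MvPolynomial J (dclEmpty ρ K)) : L.Formula J :=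
  substPoly (I := Fin 2) (Term.equal (Term.var 0) (Term.var 1)) ![Q, 0]

theorem realize_polyZero (hM : M ⊨ L.completeTheory K) {J : Type y}
    (Q : MvPolynomial J (dclEmpty ρ K)) (a : J → M) :
    (polyZero Q).Realize a ↔ Q.eval₂ (dclHom hM) a = 0 := by
  rw [polyZero, realize_substPoly hM, Formula.realize_equal]
  simp

end DclRingHom

/-! ### Counting solutions; algebraic boundedness in all models -/

section Counting

variable {L : FirstOrder.Language.{u, v}}

/-- The formula saying that there are more than `D` elements satisfying `φ`. -/
noncomputable def existsMany {J : Type y} (D : ℕ) (φ : L.Formula (J ⊕ Unit)) : L.Formula J :=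
  Formula.iExs (Fin (D + 1))
    (BoundedFormula.iInf (fun p : Fin (D + 1) × Fin (D + 1) =>
      if p.1 = p.2 then ⊤ else
        (Term.equal (Term.var (Sum.inr p.1)) (Term.var (Sum.inr p.2)) :
          L.Formula (J ⊕ Fin (D + 1))).not) ⊓
      BoundedFormula.iInf (fun i : Fin (D + 1) => φ.relabel (Sum.map id (fun _ => i))))

theorem realize_existsMany {J : Type y} {M : Type x} [L.Structure M] (D : ℕ)
    (φ : L.Formula (J ⊕ Unit)) (a : J → M) :
    (existsMany D φ).Realize a ↔ ∃ z : Fin (D + 1) → M, Function.Injective z ∧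
      ∀ i, φ.Realize (Sum.elim a (fun _ => z i)) := by
  rw [existsMany, Formula.realize_iExs]
  refine exists_congr fun z => ?_
  rw [Formula.realize_inf]
  refine and_congr ?_ ?_
  · rw [Formula.Realize, BoundedFormula.realize_iInf]
    constructor
    · intro h i j hij
      by_contra hne
      have := h (i, j)
      rw [if_neg hne] at this
      exact (Formula.realize_not.1 this) (Formula.realize_equal.2 hij)
    · rintro h ⟨i, j⟩
      split_ifs with hij
      · exact Formula.realize_top.2 trivial
      · exact Formula.realize_not.2 fun h' => hij (h (Formula.realize_equal.1 h'))
  · rw [Formula.Realize, BoundedFormula.realize_iInf]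
    refine forall_congr' fun i => ?_
    rw [← Formula.Realize, Formula.realize_relabel]
    have : Sum.elim a z ∘ Sum.map id (fun _ : Unit => i) = Sum.elim a (fun _ => z i) := by
      funext k; rcases k with k | k <;> rfl
    rw [this]

end Counting

section Bounded

theorem exists_injective_of_infinite {M : Type x} {S : Set M} (h : S.Infinite) (D : ℕ) :
    ∃ z : Fin (D + 1) → M, Function.Injective z ∧ ∀ i, z i ∈ S := by
  have := h.to_subtype
  exact ⟨fun i => (Infinite.natEmbedding S i : M), fun i j hij =>
    Fin.ext ((Infinite.natEmbedding S).injective (Subtype.coe_injective hij)), fun i => Subtype.coe_prop _⟩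

theorem infinite_of_forall_existsMany {L : FirstOrder.Language.{u, v}} {J : Type y} {M : Type x}
    [L.Structure M] {φ : L.Formula (J ⊕ Unit)} {a : J → M}
    (h : ∀ D, (existsMany D φ).Realize a) :
    {y | φ.Realize (Sum.elim a fun _ => y)}.Infinite := by
  intro hfin
  obtain ⟨z, hz, hz'⟩ := (realize_existsMany _ φ a).1 (h hfin.toFinset.card)
  have := Finset.card_le_card_of_injOn (s := Finset.univ) (t := hfin.toFinset) z
    (fun i _ => by simpa using hz' i) hz.injOn
  simp at this

theorem existsMany_of_infinite {L : FirstOrder.Language.{u, v}} {J : Type y} {M : Type x}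
    [L.Structure M] {φ : L.Formula (J ⊕ Unit)} {a : J → M}
    (h : {y | φ.Realize (Sum.elim a fun _ => y)}.Infinite) (D : ℕ) :
    (existsMany D φ).Realize a :=
  (realize_existsMany _ φ a).2 (exists_injective_of_infinite h D)

/-- A polynomial in one more variable, as a multivariate polynomial. -/
noncomputable def joinVar {J : Type y} {F : Type w} [CommRing F]
    (p : Polynomial (MvPolynomial J F)) : MvPolynomial (J ⊕ Unit) F :=
  p.eval₂ (MvPolynomial.rename Sum.inl : MvPolynomial J F →ₐ[F] _).toRingHom
    (MvPolynomial.X (Sum.inr ()))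

theorem eval_joinVar {J : Type y} {F : Type w} [CommRing F] {M : Type x} [CommRing M] (f : F →+* M)
    (p : Polynomial (MvPolynomial J F)) (a : J → M) (z : M) :
    (joinVar p).eval₂ f (Sum.elim a fun _ => z) =
      (p.map (MvPolynomial.eval₂Hom f a)).eval z := by
  rw [joinVar, Polynomial.eval_map]
  change MvPolynomial.eval₂Hom f _ _ = _
  rw [Polynomial.hom_eval₂]
  congr 1
  · ext j <;> simp
  · simp

variable {L : FirstOrder.Language.{u, v}} {ρ : FirstOrder.Language.ring →ᴸ L} {K : Type w} [Field K]
    [FirstOrder.Ring.CompatibleRing K] [L.Structure K] [ρ.IsExpansionOn K]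

/-- The formula saying that `p(a, y)` is not the zero polynomial and vanishes on `φ(a, y)`. -/
noncomputable def vanishesOn {J : Type y} (φ : L.Formula (J ⊕ Unit))
    (p : Polynomial (MvPolynomial J (dclEmpty ρ K))) : L.Formula J :=
  (Formula.iExs Unit (polyZero (joinVar p)).not) ⊓
    (Formula.iAlls Unit (φ.imp (polyZero (joinVar p))))

theorem realize_vanishesOn {M : Type x} [Field M] [FirstOrder.Ring.CompatibleRing M] [L.Structure M]
    [ρ.IsExpansionOn M] (hM : M ⊨ L.completeTheory K) {J : Type y} (φ : L.Formula (J ⊕ Unit))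
    (p : Polynomial (MvPolynomial J (dclEmpty ρ K))) (a : J → M) :
    (vanishesOn φ p).Realize a ↔
      (∃ z, (p.map (MvPolynomial.eval₂Hom (dclHom hM) a)).eval z ≠ 0) ∧
        ∀ z, φ.Realize (Sum.elim a fun _ => z) →
          (p.map (MvPolynomial.eval₂Hom (dclHom hM) a)).eval z = 0 := by
  rw [vanishesOn, Formula.realize_inf, Formula.realize_iExs, Formula.realize_iAlls]
  simp only [Formula.realize_not, Formula.realize_imp, realize_polyZero hM]
  have : ∀ z : Unit → M, z = fun _ => z () := fun z => rfl
  refine and_congr ⟨?_, ?_⟩ ⟨?_, ?_⟩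
  · rintro ⟨z, hz⟩
    rw [this z, eval_joinVar] at hz
    exact ⟨_, hz⟩
  · rintro ⟨z, hz⟩
    exact ⟨fun _ => z, by rwa [eval_joinVar]⟩
  · intro h z hz
    rw [← eval_joinVar]
    exact h (fun _ => z) hz
  · intro h z hz
    rw [this z, eval_joinVar]
    exact h _ hz

/-- In an algebraically bounded theory, the finite fibers of a formula are uniformly bounded and
contained in the zero sets of finitely many polynomials. -/
theorem AlgBounded.model_fin [CharZero K] (hK : AlgBounded L (dclEmpty ρ K)) {n : ℕ}
    (φ : L.Formula (Fin n ⊕ Unit)) :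
    ∃ D : ℕ, ∀ (M : Type x) [Field M] [FirstOrder.Ring.CompatibleRing M] [L.Structure M]
      [ρ.IsExpansionOn M] (hM : M ⊨ L.completeTheory K) (a : Fin n → M),
      ((existsMany D φ).Realize a → {y | φ.Realize (Sum.elim a fun _ => y)}.Infinite) ∧
      ({y | φ.Realize (Sum.elim a fun _ => y)}.Finite →
        ∃ p : Polynomial (MvPolynomial (Fin n) (dclEmpty ρ K)),
          p.map (MvPolynomial.eval₂Hom (dclHom hM) a) ≠ 0 ∧
          ∀ z, φ.Realize (Sum.elim a fun _ => z) →
            (p.map (MvPolynomial.eval₂Hom (dclHom hM) a)).eval z = 0) := by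
  classical
  obtain ⟨ps, hps⟩ := hK n φ
  -- A nonzero p(a, y) with p in `ps` has at most D roots, so in K a fibre with more than D points
  -- is infinite.
  let D := ps.sup Polynomial.natDegree
  have hKK : K ⊨ L.completeTheory K := inferInstance
  have hhom : ∀ a : Fin n → K, (MvPolynomial.aeval a : MvPolynomial (Fin n) (dclEmpty ρ K) →ₐ[_] K).toRingHom
      = MvPolynomial.eval₂Hom (dclHom hKK) a := by
    intro a
    ext c
    · simp only [AlgHom.toRingHom_eq_coe, RingHom.coe_comp, RingHom.coe_coe, Function.comp_apply,
        MvPolynomial.coe_eval₂Hom, MvPolynomial.eval₂_C, MvPolynomial.aeval_C, dclHom_self]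
      rfl
    · simp
  have h1 : ∀ a : Fin n → K, (existsMany D φ).Realize a →
      {y | φ.Realize (Sum.elim a fun _ => y)}.Infinite := by
    intro a ha hfin
    obtain ⟨p, hp, hp0, hpz⟩ := hps a hfin
    obtain ⟨z, hz, hz'⟩ := (realize_existsMany _ φ a).1 ha
    have h2 := Polynomial.card_le_degree_of_subset_roots (p := p.map
      (MvPolynomial.aeval a : MvPolynomial (Fin n) (dclEmpty ρ K) →ₐ[_] K).toRingHom)
      (Z := Finset.univ.image z) (by
        intro y hy
        rw [Finset.mem_val, Finset.mem_image] at hy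
        obtain ⟨i, -, rfl⟩ := hy
        exact (Polynomial.mem_roots hp0).2 (hpz _ (hz' i)))
    rw [Finset.card_image_of_injective _ hz, Finset.card_univ, Fintype.card_fin] at h2
    have h3 : p.natDegree ≤ D := Finset.le_sup hp
    have h4 := Polynomial.natDegree_map_le (f := (MvPolynomial.aeval a :
      MvPolynomial (Fin n) (dclEmpty ρ K) →ₐ[_] K).toRingHom) (p := p)
    omega
  refine ⟨D, fun M _ _ _ _ hM a => ⟨fun ha => ?_, fun hfin => ?_⟩⟩
  -- "More than D implies more than m" is first-order and true in K for each m, hence true in M; all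
  -- m together give infinity.
  · refine infinite_of_forall_existsMany fun m => ?_
    exact (Formula.realize_imp.1 (transfer hM ((existsMany D φ).imp (existsMany m φ)) (fun b =>
      Formula.realize_imp.2 fun hb => existsMany_of_infinite (h1 b hb) m) a)) ha
  · have h2 := transfer hM ((existsMany D φ).not.imp
      (BoundedFormula.iSup (fun p : ps => vanishesOn (ρ := ρ) φ p.1))) (fun b => by
        refine Formula.realize_imp.2 fun hb => BoundedFormula.realize_iSup.2 ?_
        have hfin : {y | φ.Realize (Sum.elim b fun _ => y)}.Finite := by
          by_contra hinf
          exact (Formula.realize_not.1 hb) (existsMany_of_infinite hinf D)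
        obtain ⟨p, hp, hp0, hpz⟩ := hps b hfin
        rw [hhom] at hp0 hpz
        refine ⟨⟨p, hp⟩, (realize_vanishesOn hKK φ p b).2 ⟨?_, hpz⟩⟩
        -- A nonzero polynomial over the infinite field K takes a nonzero value, which is how
        -- `vanishesOn` expresses that p(a, y) is not zero.
        by_contra hno
        push Not at hno
        exact hp0 (Polynomial.funext (by simpa using hno))) a
    by_cases h3 : (existsMany D φ).Realize a
    · exfalso
      have h4 : {y | φ.Realize (Sum.elim a fun _ => y)}.Infinite :=
        infinite_of_forall_existsMany fun m => by
          exact (Formula.realize_imp.1 (transfer hM ((existsMany D φ).imp (existsMany m φ))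
            (fun b => Formula.realize_imp.2 fun hb => existsMany_of_infinite (h1 b hb) m) a)) h3
      exact h4 hfin
    · obtain ⟨p, hp⟩ := BoundedFormula.realize_iSup.1
        ((Formula.realize_imp.1 h2) (Formula.realize_not.2 h3))
      obtain ⟨⟨z, hz⟩, h5⟩ := (realize_vanishesOn hM φ p.1 a).1 hp
      refine ⟨p.1, fun h0 => hz ?_, h5⟩
      rw [h0, Polynomial.eval_zero]

/-- Only finitely many variables of φ occur, so the finite case applies after restricting to them;
the resulting polynomial is renamed back into the variables J. -/
theorem AlgBounded.model [CharZero K] (hK : AlgBounded L (dclEmpty ρ K)) {J : Type y}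
    (φ : L.Formula (J ⊕ Unit)) :
    ∃ D : ℕ, ∀ (M : Type x) [Field M] [FirstOrder.Ring.CompatibleRing M] [L.Structure M]
      [ρ.IsExpansionOn M] (hM : M ⊨ L.completeTheory K) (a : J → M),
      ((existsMany D φ).Realize a → {y | φ.Realize (Sum.elim a fun _ => y)}.Infinite) ∧
      ({y | φ.Realize (Sum.elim a fun _ => y)}.Finite →
        ∃ p : Polynomial (MvPolynomial J (dclEmpty ρ K)),
          p.map (MvPolynomial.eval₂Hom (dclHom hM) a) ≠ 0 ∧
          ∀ z, φ.Realize (Sum.elim a fun _ => z) →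
            (p.map (MvPolynomial.eval₂Hom (dclHom hM) a)).eval z = 0) := by
  obtain ⟨m, n, f, g, ψ, hψ⟩ := exists_fin_formula.{u, v, y, x}
    (φ.relabel (Sum.map id (fun _ => PUnit.unit.{y + 1})))
  let ψ' : L.Formula (Fin m ⊕ Unit) := ψ.relabel (Sum.map id (fun _ => ()))
  have h1 : ∀ (M : Type x) [L.Structure M] (a : J → M) (z : M),
      ψ'.Realize (Sum.elim (a ∘ f) (fun _ => z)) ↔ φ.Realize (Sum.elim a fun _ => z) := by
    intro M _ a z
    have := hψ M a (fun _ => z)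
    rw [Formula.realize_relabel] at this
    simp only [ψ', Formula.realize_relabel]
    convert this using 2
    · funext i; rcases i with i | i <;> rfl
    · funext i; rcases i with i | i <;> rfl
  obtain ⟨D, hD⟩ := hK.model_fin (ρ := ρ) ψ'
  refine ⟨D, fun M _ _ _ _ hM a => ?_⟩
  have h2 := hD M hM (a ∘ f)
  rw [realize_existsMany] at h2 ⊢
  simp only [h1] at h2
  refine ⟨h2.1, fun hfin => ?_⟩
  obtain ⟨p, hp, hp'⟩ := h2.2 hfin
  have h3 : (p.map (MvPolynomial.rename f : MvPolynomial (Fin m) (dclEmpty ρ K) →ₐ[_] _).toRingHom).map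
      (MvPolynomial.eval₂Hom (dclHom hM) a) = p.map (MvPolynomial.eval₂Hom (dclHom hM) (a ∘ f)) := by
    rw [Polynomial.map_map]
    congr 1
    ext j <;> simp
  exact ⟨p.map (MvPolynomial.rename f : MvPolynomial (Fin m) (dclEmpty ρ K) →ₐ[_] _).toRingHom, by
    rw [h3]; exact ⟨hp, hp'⟩⟩

end Bounded

/-! ### Largeness of a projection is definable -/

section Large

/-- All coefficients of p(a, y) lie in B, so p(a, y) is itself a nonzero polynomial over B. -/
theorem isAlgebraic_of_mvPolynomial {F : Type*} [CommRing F] {J : Type*} {M : Type*} [Field M]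
    (f : F →+* M) (a : J → M) (B : Subring M) (hf : ∀ c, f c ∈ B) (ha : ∀ j, a j ∈ B)
    (p : Polynomial (MvPolynomial J F)) (hp : p.map (MvPolynomial.eval₂Hom f a) ≠ 0) {z : M}
    (hz : (p.map (MvPolynomial.eval₂Hom f a)).eval z = 0) : IsAlgebraic B z := by
  let h : MvPolynomial J F →+* B := MvPolynomial.eval₂Hom (f.codRestrict B hf) (fun j => ⟨a j, ha j⟩)
  have hh : B.subtype.comp h = MvPolynomial.eval₂Hom f a := by
    ext j <;> simp [h]
  have h1 : (p.map h).map B.subtype = p.map (MvPolynomial.eval₂Hom f a) := by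
    rw [Polynomial.map_map, hh]
  refine ⟨p.map h, fun h0 => hp ?_, ?_⟩
  · rw [← h1, h0, Polynomial.map_zero]
  · rw [← h1] at hz
    rw [Polynomial.aeval_def, ← Polynomial.eval_map]
    exact hz

theorem isAlgebraic_of_subfield_le {M : Type*} [Field M] {B C : Subfield M} (h : B ≤ C) {z : M}
    (hz : IsAlgebraic B z) : IsAlgebraic C z := by
  obtain ⟨p, hp, hp'⟩ := hz
  refine ⟨p.map (Subfield.inclusion h), ?_, ?_⟩
  · rwa [Ne, Polynomial.map_eq_zero]
  · rw [Polynomial.aeval_def, Polynomial.eval₂_map]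
    exact hp'

variable {L : FirstOrder.Language.{u, v}} {ρ : FirstOrder.Language.ring →ᴸ L} {K : Type w} [Field K]
    [FirstOrder.Ring.CompatibleRing K] [L.Structure K] [ρ.IsExpansionOn K]

/-- The subfield generated by `dcl(∅)` and a set. -/
noncomputable def genField {M : Type x} [Field M] [FirstOrder.Ring.CompatibleRing M] [L.Structure M]
    [ρ.IsExpansionOn M] (hM : M ⊨ L.completeTheory K) (A : Set M) : Subfield M :=
  Subfield.closure (Set.range (dclHom (ρ := ρ) hM) ∪ A)

theorem dclHom_mem_genField {M : Type x} [Field M] [FirstOrder.Ring.CompatibleRing M] [L.Structure M]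
    [ρ.IsExpansionOn M] (hM : M ⊨ L.completeTheory K) (A : Set M) (c : dclEmpty ρ K) :
    dclHom hM c ∈ genField (ρ := ρ) hM A :=
  Subfield.subset_closure (Or.inl ⟨c, rfl⟩)

theorem mem_genField {M : Type x} [Field M] [FirstOrder.Ring.CompatibleRing M] [L.Structure M]
    [ρ.IsExpansionOn M] (hM : M ⊨ L.completeTheory K) {A : Set M} {z : M} (hz : z ∈ A) :
    z ∈ genField (ρ := ρ) hM A :=
  Subfield.subset_closure (Or.inr hz)

theorem genField_mono {M : Type x} [Field M] [FirstOrder.Ring.CompatibleRing M] [L.Structure M]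
    [ρ.IsExpansionOn M] (hM : M ⊨ L.completeTheory K) {A B : Set M} (h : A ⊆ B) :
    genField (ρ := ρ) hM A ≤ genField (ρ := ρ) hM B :=
  Subfield.closure_mono (Set.union_subset_union_right _ h)

/-- χ asserts that for infinitely many values of the last coordinate there are infinitely many
values of the one before, and so on down to coordinate 0, with "infinitely many" replaced by "more
than D" at each stage. A point whose coordinates are successively transcendental forces every fibre
to be infinite. Conversely, infinite fibres allow the coordinates to be chosen one at a time off the
zeros of a given polynomial. The conclusion quantifies over polynomials g instead of generic points,
so that no extension of M is needed here. -/
theorem exists_large_fin [CharZero K] (hK : AlgBounded L (dclEmpty ρ K)) {Y : Type y} (n : ℕ) :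
    ∀ φ : L.Formula (Y ⊕ Fin n), ∃ χ : L.Formula Y,
      (∀ (M : Type x) [Field M] [FirstOrder.Ring.CompatibleRing M] [L.Structure M]
        [ρ.IsExpansionOn M] (hM : M ⊨ L.completeTheory K) (a : Y → M) (z : Fin n → M),
        φ.Realize (Sum.elim a z) →
        (∀ i, ¬ IsAlgebraic (genField (ρ := ρ) hM (Set.range a ∪ z '' {j | i < j})) (z i)) →
        χ.Realize a) ∧
      (∀ (M : Type x) [Field M] [FirstOrder.Ring.CompatibleRing M] [L.Structure M]
        [ρ.IsExpansionOn M] (_ : M ⊨ L.completeTheory K) (a : Y → M), χ.Realize a →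
        ∀ g : MvPolynomial (Fin n) M, g ≠ 0 →
          ∃ z : Fin n → M, φ.Realize (Sum.elim a z) ∧ MvPolynomial.eval z g ≠ 0) := by
  induction n with
  | zero =>
    intro φ
    have h0 : ∀ (M : Type x) (a : Y → M) (z : Fin 0 → M),
        a ∘ (Sum.elim id Fin.elim0 : Y ⊕ Fin 0 → Y) = Sum.elim a z := by
      intro M a z
      funext i; rcases i with i | i
      · rfl
      · exact i.elim0
    refine ⟨φ.relabel (Sum.elim id Fin.elim0), fun M _ _ _ _ hM a z h _ => ?_,
      fun M _ _ _ _ hM a h g hg => ⟨Fin.elim0, ?_, fun h1 => hg ?_⟩⟩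
    · rw [Formula.realize_relabel, h0 M a z]
      exact h
    · rw [Formula.realize_relabel, h0 M a Fin.elim0] at h
      exact h
    · rw [MvPolynomial.eq_C_of_isEmpty g] at h1 ⊢
      rw [MvPolynomial.eval_C] at h1
      rw [h1, map_zero]
  | succ n ih =>
    intro φ
    -- Coordinate 0 is quantified first, hence lies over all the others; this is why independence is
    -- required over later indices.
    let φ' : L.Formula ((Y ⊕ Fin n) ⊕ Unit) := φ.relabel
      (Sum.elim (fun i => Sum.inl (Sum.inl i)) (Fin.cons (Sum.inr ()) (fun j => Sum.inl (Sum.inr j))))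
    have hφ' : ∀ (M : Type x) [L.Structure M] (a : Y → M) (z : Fin n → M) (t : M),
        φ'.Realize (Sum.elim (Sum.elim a z) fun _ => t) ↔
          φ.Realize (Sum.elim a (Fin.cons t z)) := by
      intro M _ a z t
      rw [Formula.realize_relabel]
      have : (Sum.elim (Sum.elim a z) (fun _ => t) ∘ (Sum.elim (fun i => Sum.inl (Sum.inl i))
          (Fin.cons (Sum.inr ()) (fun j => Sum.inl (Sum.inr j))) :
            Y ⊕ Fin (n + 1) → (Y ⊕ Fin n) ⊕ Unit)) =
          Sum.elim a (Fin.cons t z : Fin (n + 1) → M) := by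
        funext i
        rcases i with i | i
        · rfl
        · refine Fin.cases ?_ (fun j => ?_) i <;> simp
      rw [this]
    obtain ⟨D, hD⟩ := hK.model (ρ := ρ) φ'
    obtain ⟨χ, h1, h2⟩ := ih (existsMany D φ')
    refine ⟨χ, fun M _ _ _ _ hM a z hz hind => ?_, fun M _ _ _ _ hM a ha g hg => ?_⟩
    · refine h1 M hM a (Fin.tail z) ?_ fun i => ?_
      · refine existsMany_of_infinite (fun hfin => ?_) D
        obtain ⟨p, hp, hp'⟩ := (hD M hM _).2 hfin
        refine hind 0 (isAlgebraic_of_mvPolynomial (dclHom hM) (Sum.elim a (Fin.tail z))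
          (genField (ρ := ρ) hM (Set.range a ∪ z '' {j | 0 < j})).toSubring
          (fun c => dclHom_mem_genField hM _ c) (fun j => mem_genField hM ?_) p hp (hp' (z 0) ?_))
        · rcases j with j | j
          · exact Or.inl ⟨j, rfl⟩
          · exact Or.inr ⟨j.succ, Fin.succ_pos j, rfl⟩
        · rw [hφ', Fin.cons_self_tail]
          exact hz
      · have h3 := hind i.succ
        have h4 : z '' {j | i.succ < j} = Fin.tail z '' {j | i < j} := by
          ext t
          constructor
          · rintro ⟨j, hj, rfl⟩
            obtain ⟨j', rfl⟩ := Fin.eq_succ_of_ne_zero (Fin.ne_zero_of_lt hj)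
            exact ⟨j', Fin.succ_lt_succ_iff.1 hj, rfl⟩
          · rintro ⟨j, hj, rfl⟩
            exact ⟨j.succ, Fin.succ_lt_succ_iff.2 hj, rfl⟩
        rw [h4] at h3
        exact h3
    · classical
      -- View g as a polynomial in coordinate 0: first choose the other coordinates so that its
      -- leading coefficient survives, then coordinate 0 in the infinite fibre outside the finitely
      -- many roots.
      let q := MvPolynomial.finSuccEquiv M n g
      have hq : q ≠ 0 := by
        intro h0
        exact hg ((MvPolynomial.finSuccEquiv M n).injective (by rw [map_zero]; exact h0))
      obtain ⟨z, hz, hz'⟩ := h2 M hM a ha q.leadingCoeff (Polynomial.leadingCoeff_ne_zero.2 hq)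
      have hinf := (hD M hM _).1 hz
      have hq' : q.map (MvPolynomial.eval z) ≠ 0 := by
        intro h0
        apply hz'
        have := congrArg (fun r => Polynomial.coeff r q.natDegree) h0
        simpa [Polynomial.coeff_map] using this
      obtain ⟨t, ht, ht'⟩ := hinf.exists_notMem_finset (q.map (MvPolynomial.eval z)).roots.toFinset
      refine ⟨Fin.cons t z, (hφ' M a z t).1 ht, ?_⟩
      rw [MvPolynomial.eval_eq_eval_mv_eval']
      intro h0
      exact ht' (Multiset.mem_toFinset.2 ((Polynomial.mem_roots hq').2 h0))

theorem dclHom_injective {M : Type x} [Field M] [FirstOrder.Ring.CompatibleRing M]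
    [L.Structure M] [ρ.IsExpansionOn M] (hM : M ⊨ L.completeTheory K) :
    Function.Injective (dclHom (ρ := ρ) hM) := by
  intro c d hcd
  by_contra hne
  have h := transfer hM ((defFormula ρ K c).imp (defFormula ρ K d).not) (fun a => by
    rw [Formula.realize_imp, Formula.realize_not]
    intro h1 h2
    refine hne (Subtype.ext ?_)
    rw [← (definesPoint_defFormula ρ K c (a ())).1 h1, ← (definesPoint_defFormula ρ K d (a ())).1 h2])
    (fun _ => dclHom hM c)
  rw [Formula.realize_imp, Formula.realize_not] at h
  exact h ((realize_defFormula hM c _).2 rfl) ((realize_defFormula hM d _).2 hcd)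

theorem charZero_model [CharZero K] {M : Type x} [Field M] [FirstOrder.Ring.CompatibleRing M]
    [L.Structure M] [ρ.IsExpansionOn M] (hM : M ⊨ L.completeTheory K) : CharZero M := by
  have : CharZero (dclEmpty ρ K) :=
    charZero_of_inj_zero fun n hn => by
      have := congrArg (Subtype.val) hn
      simpa using this
  exact charZero_of_injective_ringHom (dclHom_injective (ρ := ρ) hM)

-- V may be infinite, but Φ uses finitely many variables. Those in J are listed and handled by
-- `exists_large_fin`; the others are quantified existentially.
open Classical in
theorem exists_large_formula [CharZero K] (hK : AlgBounded L (dclEmpty ρ K)) {Y V : Type y}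
    (Φ : L.Formula (Y ⊕ V)) (J : Set V) (lt : V → V → Prop) [IsStrictTotalOrder V lt] :
    ∃ χ : L.Formula Y,
      (∀ (M : Type x) [Field M] [FirstOrder.Ring.CompatibleRing M] [L.Structure M]
        [ρ.IsExpansionOn M] (hM : M ⊨ L.completeTheory K) (a : Y → M) (z : V → M),
        Φ.Realize (Sum.elim a z) →
        (∀ μ ∈ J, ¬ IsAlgebraic
          (genField (ρ := ρ) hM (Set.range a ∪ z '' {ν | ν ∈ J ∧ lt ν μ})) (z μ)) →
        χ.Realize a) ∧
      (∀ (M : Type x) [Field M] [FirstOrder.Ring.CompatibleRing M] [L.Structure M]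
        [ρ.IsExpansionOn M] (_ : M ⊨ L.completeTheory K) (a : Y → M), χ.Realize a →
        ∀ g : MvPolynomial J M, g ≠ 0 →
          ∃ z : V → M, Φ.Realize (Sum.elim a z) ∧
            MvPolynomial.eval (fun μ : J => z μ) g ≠ 0) := by
  obtain ⟨s, ψ, hψ⟩ := exists_finset_formula.{u, v, y, x} Φ
  let sJ : Finset V := s.toRight.filter (· ∈ J)
  -- The enumeration is decreasing, to match "over later indices" with "over smaller elements".
  obtain ⟨n, e, he, he'⟩ : ∃ (n : ℕ) (e : Fin n → V), Set.range e = sJ ∧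
      ∀ i j, i < j → lt (e j) (e i) := by
    let _ : LinearOrder V := linearOrderOfSTO lt
    refine ⟨sJ.card, fun i => sJ.orderEmbOfFin rfl i.rev, ?_, fun i j hij => ?_⟩
    · rw [← Finset.range_orderEmbOfFin sJ rfl]
      exact (Fin.rev_surjective).range_comp (sJ.orderEmbOfFin rfl)
    · exact (sJ.orderEmbOfFin rfl).strictMono (Fin.rev_lt_rev.2 hij)
  have hinj : Function.Injective e := by
    intro i j hij
    rcases lt_trichotomy i j with h | h | h
    · have := he' i j h
      rw [hij] at this
      exact absurd this (irrefl_of lt _)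
    · exact h
    · have := he' j i h
      rw [hij] at this
      exact absurd this (irrefl_of lt _)
  let f : s → (Y ⊕ Fin n) ⊕ s := fun i => match i.1 with
    | Sum.inl k => Sum.inl (Sum.inl k)
    | Sum.inr v => if h : ∃ k, e k = v then Sum.inl (Sum.inr h.choose) else Sum.inr i
  let Φ' : L.Formula (Y ⊕ Fin n) := Formula.iExs s (ψ.relabel f)
  obtain ⟨χ, h1, h2⟩ := exists_large_fin (ρ := ρ) hK n Φ'
  refine ⟨χ, fun M _ _ _ _ hM a z hz hind => ?_, fun M _ _ _ _ hM a ha g hg => ?_⟩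
  · refine h1 M hM a (z ∘ e) ?_ fun i hi => ?_
    · refine Formula.realize_iExs.2 ⟨fun i => Sum.elim a z i, ?_⟩
      rw [Formula.realize_relabel]
      rw [← hψ] at hz
      convert hz using 1
      funext i
      obtain ⟨i | v, hi⟩ := i
      · rfl
      · simp only [Function.comp, f]
        split_ifs with h
        · simp [h.choose_spec]
        · rfl
    · have hiJ : e i ∈ J := by
        have : e i ∈ (sJ : Set V) := he ▸ ⟨i, rfl⟩
        exact (Finset.mem_filter.1 (Finset.mem_coe.1 this)).2
      refine hind (e i) hiJ ?_
      have hsub : genField (ρ := ρ) hM (Set.range a ∪ (z ∘ e) '' {j | i < j}) ≤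
          genField (ρ := ρ) hM (Set.range a ∪ z '' {ν | ν ∈ J ∧ lt ν (e i)}) := by
        refine genField_mono hM (Set.union_subset_union_right _ ?_)
        rintro _ ⟨j, hj, rfl⟩
        refine ⟨e j, ⟨?_, he' i j hj⟩, rfl⟩
        have : e j ∈ (sJ : Set V) := he ▸ ⟨j, rfl⟩
        exact (Finset.mem_filter.1 (Finset.mem_coe.1 this)).2
      exact isAlgebraic_of_subfield_le hsub hi
  · have := charZero_model (ρ := ρ) hM
    -- The variables of g that do not occur in Φ are unconstrained. They are fixed at the
    -- coordinates of a point where g is nonzero, which leaves a nonzero polynomial `g'` in the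
    -- variables that occur.
    obtain ⟨x0, hx0⟩ : ∃ x0 : J → M, MvPolynomial.eval x0 g ≠ 0 := by
      by_contra hno
      push Not at hno
      exact hg (MvPolynomial.funext fun x => by simpa using hno x)
    let g' : MvPolynomial (Fin n) M := MvPolynomial.eval₂ MvPolynomial.C (fun v : J =>
      if h : ∃ k, e k = v then MvPolynomial.X h.choose else MvPolynomial.C (x0 v)) g
    have hg' : ∀ z : Fin n → M, MvPolynomial.eval z g' = MvPolynomial.eval
        (fun v : J => if h : ∃ k, e k = v then z h.choose else x0 v) g := by
      intro z
      change (MvPolynomial.eval z) ((MvPolynomial.eval₂Hom _ _) g) = _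
      rw [← RingHom.comp_apply]
      congr 1
      ext v
      · simp
      · by_cases h : ∃ k, e k = v <;> simp [h]
    have hg0 : g' ≠ 0 := by
      intro h0
      have hx : ∀ k, e k ∈ J := by
        intro k
        have : e k ∈ (sJ : Set V) := he ▸ ⟨k, rfl⟩
        exact (Finset.mem_filter.1 (Finset.mem_coe.1 this)).2
      have h3 := hg' (fun k => x0 ⟨e k, hx k⟩)
      rw [h0, map_zero] at h3
      refine hx0 (h3.trans ?_).symm |>.elim
      congr 2
      funext v
      split_ifs with h
      · congr 1
        exact Subtype.ext h.choose_spec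
      · rfl
    obtain ⟨z, hz, hz'⟩ := h2 M hM a ha g' hg0
    obtain ⟨t, ht⟩ := Formula.realize_iExs.1 hz
    rw [Formula.realize_relabel] at ht
    let y : V → M := fun v => if h : ∃ k, e k = v then z h.choose else
      if h : v ∈ J then x0 ⟨v, h⟩ else if h : Sum.inr v ∈ s then t ⟨_, h⟩ else 0
    refine ⟨y, ?_, ?_⟩
    · rw [← hψ]
      convert ht using 1
      funext i
      obtain ⟨i | v, hi⟩ := i
      · rfl
      · simp only [Function.comp, f, y, Sum.elim_inr]
        split_ifs with h3 h4
        · rfl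
        · exfalso
          apply h3
          have : v ∈ Set.range e := by
            rw [he]
            exact Finset.mem_coe.2 (Finset.mem_filter.2 ⟨by simpa using hi, h4⟩)
          exact this
        · rfl
    · rw [hg'] at hz'
      convert hz' using 3
      simp [y]

end Large

/-! ### Generic points in elementary extensions -/

section Generic

variable {L : FirstOrder.Language.{u, v}} {ρ : FirstOrder.Language.ring →ᴸ L} {K : Type w} [Field K]
    [FirstOrder.Ring.CompatibleRing K] [L.Structure K] [ρ.IsExpansionOn K]

/-- The field axioms are part of Th(K) through ρ, so the ring reduct of any model is a field. -/
theorem exists_field_structure {M : Type x} [L.Structure M] (hM : M ⊨ L.completeTheory K) :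
    ∃ (_ : Field M) (_ : FirstOrder.Ring.CompatibleRing M), ρ.IsExpansionOn M := by
  let _ : FirstOrder.Language.ring.Structure M := ρ.reduct M
  have h1 : ρ.IsExpansionOn M := LHom.isExpansionOn_reduct _ _
  have h2 : M ⊨ Theory.field := by
    refine ⟨fun σ hσ => ?_⟩
    rw [← LHom.realize_onSentence M ρ σ]
    refine hM.realize_of_mem _ ?_
    change K ⊨ ρ.onSentence σ
    rw [LHom.realize_onSentence]
    exact Theory.realize_sentence_of_mem Theory.field hσ
  exact ⟨FirstOrder.Field.fieldOfModelField M, FirstOrder.Field.compatibleRingOfModelField M, h1⟩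

theorem map_ringTerm {M : Type x} [Field M] [FirstOrder.Ring.CompatibleRing M] [L.Structure M]
    [ρ.IsExpansionOn M] {N : Type y} [Field N] [FirstOrder.Ring.CompatibleRing N] [L.Structure N]
    [ρ.IsExpansionOn N] (j : M ↪ₑ[L] N) {α : Type*} (t : FirstOrder.Language.ring.Term α)
    (a : α → M) : j (t.realize a) = t.realize (j ∘ a) := by
  rw [← realize_ringTerm ρ, ← realize_ringTerm ρ, HomClass.realize_term]

variable (ρ) in
/-- An elementary embedding of expansions of fields is a ring homomorphism. -/
def elementaryRingHom {M : Type x} [Field M] [FirstOrder.Ring.CompatibleRing M] [L.Structure M]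
    [ρ.IsExpansionOn M] {N : Type y} [Field N] [FirstOrder.Ring.CompatibleRing N] [L.Structure N]
    [ρ.IsExpansionOn N] (j : M ↪ₑ[L] N) : M →+* N where
  toFun := j
  map_zero' := by
    have := map_ringTerm (ρ := ρ) j (0 : FirstOrder.Language.ring.Term (Fin 0)) ![]
    simpa using this
  map_one' := by
    have := map_ringTerm (ρ := ρ) j (1 : FirstOrder.Language.ring.Term (Fin 0)) ![]
    simpa using this
  map_add' := fun a b => by
    have := map_ringTerm (ρ := ρ) j
      (Term.var 0 + Term.var 1 : FirstOrder.Language.ring.Term (Fin 2)) ![a, b]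
    simpa using this
  map_mul' := fun a b => by
    have := map_ringTerm (ρ := ρ) j
      (Term.var 0 * Term.var 1 : FirstOrder.Language.ring.Term (Fin 2)) ![a, b]
    simpa using this

/-- A polynomial with coefficients in `N`, as a term with parameters. -/
noncomputable def paramTerm {V : Type*} {N : Type x} [CommRing N] {J : Set V}
    (ρ : FirstOrder.Language.ring →ᴸ L) (g : MvPolynomial J N) : L.Term (V ⊕ N) :=
  ρ.onTerm ((FirstOrder.Ring.termOfFreeCommRing (exists_freeCommRing g).choose).relabel
    (Sum.map (↑) id))

theorem realize_paramTerm {V : Type*} {N : Type x} [CommRing N] {J : Set V}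
    {N' : Type y} [Field N'] [FirstOrder.Ring.CompatibleRing N'] [L.Structure N']
    [ρ.IsExpansionOn N'] (r : N →+* N') (g : MvPolynomial J N) (a : V → N') :
    (paramTerm ρ g).realize (Sum.elim a r) = g.eval₂ r (fun μ : J => a μ) := by
  rw [paramTerm, realize_ringTerm, Term.realize_relabel,
    FirstOrder.Ring.realize_termOfFreeCommRing]
  conv_rhs => rw [← (exists_freeCommRing g).choose_spec]
  generalize (exists_freeCommRing g).choose = p
  change _ = (MvPolynomial.eval₂Hom r (fun μ : J => a μ)) _
  rw [← RingHom.comp_apply]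
  congr 1
  ext z
  rcases z with z | z <;> simp

/-- Compactness applied to the elementary diagram of N, the formula φ and all inequations g ≠ 0.
Finitely many inequations amount to the single one for their product, which is nonzero since N is a
field. -/
theorem exists_generic_extension {N : Type (max u v)} [Field N] [FirstOrder.Ring.CompatibleRing N]
    [L.Structure N] [ρ.IsExpansionOn N] (hN : N ⊨ L.completeTheory K) {V : Type}
    (φ : L.Formula (V ⊕ N)) (J : Set V)
    (H : ∀ g : MvPolynomial J N, g ≠ 0 → ∃ z : V → N, φ.Realize (Sum.elim z id) ∧
      MvPolynomial.eval (fun μ : J => z μ) g ≠ 0) :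
    ∃ (N' : Type (max u v)) (_ : Field N') (_ : FirstOrder.Ring.CompatibleRing N')
      (_ : L.Structure N') (_ : ρ.IsExpansionOn N') (_ : N' ⊨ L.completeTheory K)
      (j : N ↪ₑ[L] N') (a : V → N'), φ.Realize (Sum.elim a j) ∧
        ∀ g : MvPolynomial J N, g ≠ 0 →
          g.eval₂ (elementaryRingHom ρ j) (fun μ : J => a μ) ≠ 0 := by
  classical
  let nz : MvPolynomial J N → L.Formula (V ⊕ N) := fun g =>
    (Term.equal (paramTerm ρ g) (ρ.onTerm (0 : FirstOrder.Language.ring.Term (V ⊕ N)))).not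
  obtain ⟨N', c, hc⟩ := exists_realize_of_finite (T := L.completeTheory K)
    (insert φ ((fun σ : L.Formula N => σ.relabel Sum.inr) '' {σ | σ.Realize (id : N → N)} ∪
      nz '' {g | g ≠ 0})) (by
    intro s hs
    -- Formulas that are not inequations contribute the harmless factor 1.
    let pg : L.Formula (V ⊕ N) → MvPolynomial J N := fun θ =>
      if h : ∃ g, g ≠ 0 ∧ nz g = θ then h.choose else 1
    have hpg : ∀ θ, pg θ ≠ 0 := by
      intro θ
      by_cases h : ∃ g, g ≠ 0 ∧ nz g = θ
      · simp only [pg, dif_pos h]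
        exact h.choose_spec.1
      · simp [pg, dif_neg h]
    obtain ⟨z, hz, hz'⟩ := H (∏ θ ∈ s, pg θ) (Finset.prod_ne_zero_iff.2 fun θ _ => hpg θ)
    refine ⟨N, inferInstance, inferInstance, hN, Sum.elim z id, fun θ hθ => ?_⟩
    rcases hs hθ with rfl | ⟨σ, hσ, rfl⟩ | ⟨g, hg, rfl⟩
    · exact hz
    · rw [Formula.realize_relabel]
      exact hσ
    · rw [map_prod, Finset.prod_ne_zero_iff] at hz'
      have h1 := hz' _ hθ
      have h2 : ∃ g', g' ≠ 0 ∧ nz g' = nz g := ⟨g, hg, rfl⟩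
      rw [show pg (nz g) = h2.choose from dif_pos h2] at h1
      rw [← h2.choose_spec.2]
      rw [Formula.realize_not, Formula.realize_equal, realize_ringTerm,
        FirstOrder.Ring.realize_zero]
      have h3 := realize_paramTerm (ρ := ρ) (RingHom.id N) h2.choose z
      rw [show (Sum.elim z id : V ⊕ N → N) = Sum.elim z (RingHom.id N) from rfl, h3]
      exact h1)
  obtain ⟨hf, hr, he⟩ := exists_field_structure (ρ := ρ) N'.is_model
  have hel : ∀ σ : L.Formula N, σ.Realize (id : N → N) ↔ σ.Realize (c ∘ Sum.inr) := by
    have h1 : ∀ σ : L.Formula N, σ.Realize (id : N → N) → σ.Realize (c ∘ Sum.inr) := by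
      intro σ hσ
      rw [← Formula.realize_relabel]
      exact hc _ (Or.inr (Or.inl ⟨σ, hσ, rfl⟩))
    intro σ
    refine ⟨h1 σ, fun h => ?_⟩
    by_contra hno
    exact (Formula.realize_not.1 (h1 σ.not (Formula.realize_not.2 hno))) h
  let j : N ↪ₑ[L] N' :=
    { toFun := c ∘ Sum.inr
      map_formula' := fun n σ z => by
        have h := hel (σ.relabel z)
        rw [Formula.realize_relabel, Formula.realize_relabel] at h
        exact h.symm }
  have hcj : c = Sum.elim (c ∘ Sum.inl) j := (Sum.elim_comp_inl_inr c).symm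
  refine ⟨N', hf, hr, inferInstance, he, N'.is_model, j, c ∘ Sum.inl, ?_, fun g hg => ?_⟩
  · rw [← hcj]
    exact hc _ (Or.inl rfl)
  · have h1 := hc _ (Or.inr (Or.inr ⟨g, hg, rfl⟩))
    rw [Formula.realize_not, Formula.realize_equal, realize_ringTerm,
        FirstOrder.Ring.realize_zero, hcj] at h1
    rw [← realize_paramTerm (ρ := ρ)]
    exact h1

theorem dclHom_elementary {M : Type x} [Field M] [FirstOrder.Ring.CompatibleRing M] [L.Structure M]
    [ρ.IsExpansionOn M] {N : Type y} [Field N] [FirstOrder.Ring.CompatibleRing N] [L.Structure N]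
    [ρ.IsExpansionOn N] (hM : M ⊨ L.completeTheory K) (hN : N ⊨ L.completeTheory K)
    (j : M ↪ₑ[L] N) (c : dclEmpty ρ K) : dclHom hN c = j (dclHom hM c) := by
  refine ((realize_defFormula hN c _).1 ?_).symm
  exact (j.map_formula (defFormula ρ K c) (fun _ => dclHom hM c)).2
    ((realize_defFormula hM c _).2 rfl)

/-- Algebraic boundedness places any element of acl(A) among the roots of a nonzero polynomial over
the ring generated by F and A. Since F lies in N, model-theoretic dependence over N would contradict
algebraic independence over N. -/
theorem aclIndep_of_algebraicIndependent [CharZero K] (hK : AlgBounded L (dclEmpty ρ K))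
    {N : Type x} [Field N] [FirstOrder.Ring.CompatibleRing N]
    [L.Structure N] [ρ.IsExpansionOn N] (hN : N ⊨ L.completeTheory K)
    {N' : Type x} [Field N'] [FirstOrder.Ring.CompatibleRing N'] [L.Structure N']
    [ρ.IsExpansionOn N'] (hN' : N' ⊨ L.completeTheory K) (j : N ↪ₑ[L] N') {I : Type}
    (a : I → N')
    (h : ∀ g : MvPolynomial I N, g ≠ 0 → g.eval₂ (elementaryRingHom ρ j) a ≠ 0) :
    AclIndep L (Set.range j) a := by
  intro i hi
  obtain ⟨D, ⟨φ, hφ⟩, hfin, hiD⟩ := hi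
  let A : Set N' := Set.range j ∪ a '' {i}ᶜ
  let ψ : L.Formula (A ⊕ Unit) := Formula.relabel (Sum.map id (fun _ => ()))
    (BoundedFormula.constantsVarsEquiv φ : L.Formula (A ⊕ Fin 1))
  have hψ : ∀ z : N', ψ.Realize (Sum.elim (fun b : A => (b : N')) fun _ => z) ↔ z ∈ D := by
    intro z
    have h1 : z ∈ D ↔ φ.Realize (fun _ : Fin 1 => z) := by
      have : (fun _ : Fin 1 => z) ∈ {x : Fin 1 → N' | x 0 ∈ D} ↔
          (fun _ : Fin 1 => z) ∈ Set.ofPred φ.Realize := by rw [hφ]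
      exact this
    rw [h1]
    have h2 := BoundedFormula.realize_constantsVarsEquiv (L := L) (M := N') (α := A)
        (φ := φ) (v := fun _ : Fin 1 => z) (xs := (default : Fin 0 → N'))
    rw [Formula.realize_relabel]
    refine Iff.trans ?_ h2
    have h3 : (Sum.elim (fun b : A => (b : N')) (fun _ : Unit => z) ∘ Sum.map id (fun _ => ()))
        = Sum.elim (fun b : A => (b : N')) (fun _ : Fin 1 => z) := by
      funext k; rcases k with k | k <;> rfl
    rw [h3]
    rfl
  obtain ⟨D', hD'⟩ := hK.model (ρ := ρ) ψ
  obtain ⟨p, hp, hp'⟩ := (hD' N' hN' (fun b : A => (b : N'))).2 (by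
    simp only [hψ]
    exact hfin)
  let _ : Algebra N N' := (elementaryRingHom ρ j).toAlgebra
  have hind : AlgebraicIndependent N a := by
    rw [algebraicIndependent_iff]
    intro g hg
    by_contra hne
    exact h g hne hg
  refine (hind.transcendental_adjoin (s := {i}ᶜ) (i := i) (by simp)) ?_
  refine isAlgebraic_of_mvPolynomial (dclHom hN') (fun b : A => (b : N'))
    (Algebra.adjoin N (a '' {i}ᶜ)).toSubring (fun c => ?_) (fun b => ?_) p hp
    (hp' _ ((hψ _).2 hiD))
  · rw [dclHom_elementary hN hN' j c]
    exact Subalgebra.algebraMap_mem _ _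
  · rcases b.2 with ⟨m, hm⟩ | hb
    · rw [← hm]
      exact Subalgebra.algebraMap_mem _ m
    · exact Algebra.subset_adjoin hb

end Generic

/-! ### Derivations of polynomial rings and the chain rule -/

section PolyDerivation

variable {σ : Type*} {F : Type*} [CommRing F]

theorem coeff_sum_monomial (d : F → F) (hd : d 0 = 0) (p : MvPolynomial σ F) (m : σ →₀ ℕ) :
    (∑ n ∈ p.support, MvPolynomial.monomial n (d (p.coeff n))).coeff m = d (p.coeff m) := by
  classical
  rw [MvPolynomial.coeff_sum]
  simp only [MvPolynomial.coeff_monomial]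
  rw [Finset.sum_ite_eq']
  split_ifs with h
  · rfl
  · rw [MvPolynomial.notMem_support_iff.1 h, hd]

/-- The action of a derivation on the coefficients of a polynomial, as an additive map. -/
noncomputable def coeffAddHom (σ : Type*) (d : Derivation ℤ F F) :
    MvPolynomial σ F →+ MvPolynomial σ F :=
  AddMonoidHom.mk' (fun p => ∑ n ∈ p.support, MvPolynomial.monomial n (d (p.coeff n)))
    (fun p q => by
      ext m
      rw [MvPolynomial.coeff_add, coeff_sum_monomial d d.map_zero, coeff_sum_monomial d d.map_zero,
        coeff_sum_monomial d d.map_zero, MvPolynomial.coeff_add, map_add])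

theorem coeffAddHom_monomial (d : Derivation ℤ F F) (m : σ →₀ ℕ) (a : F) :
    coeffAddHom σ d (MvPolynomial.monomial m a) = MvPolynomial.monomial m (d a) := by
  classical
  ext n
  refine (coeff_sum_monomial d d.map_zero _ n).trans ?_
  rw [MvPolynomial.coeff_monomial, MvPolynomial.coeff_monomial]
  split_ifs <;> simp

/-- The action of a derivation on the coefficients of a polynomial. -/
noncomputable def coeffDerivation (σ : Type*) (d : Derivation ℤ F F) :
    Derivation ℤ (MvPolynomial σ F) (MvPolynomial σ F) :=
  Derivation.mk' (coeffAddHom σ d).toIntLinearMap (by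
    intro p q
    change coeffAddHom σ d (p * q) = p * coeffAddHom σ d q + q * coeffAddHom σ d p
    induction p using MvPolynomial.induction_on' with
    | monomial m a =>
      induction q using MvPolynomial.induction_on' with
      | monomial n b =>
        rw [MvPolynomial.monomial_mul, coeffAddHom_monomial, coeffAddHom_monomial,
          coeffAddHom_monomial, MvPolynomial.monomial_mul,
          MvPolynomial.monomial_mul, add_comm n m, ← map_add, Derivation.leibniz]
        rfl
      | add q q' h h' => rw [mul_add, map_add, h, h', map_add]; ring
    | add p p' h h' => rw [add_mul, map_add, h, h', map_add]; ring)

@[simp]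
theorem coeffDerivation_monomial (d : Derivation ℤ F F) (m : σ →₀ ℕ) (a : F) :
    coeffDerivation σ d (MvPolynomial.monomial m a) = MvPolynomial.monomial m (d a) :=
  coeffAddHom_monomial d m a

@[simp]
theorem coeffDerivation_C (d : Derivation ℤ F F) (a : F) :
    coeffDerivation σ d (MvPolynomial.C a) = MvPolynomial.C (d a) :=
  coeffDerivation_monomial d 0 a

@[simp]
theorem coeffDerivation_X (d : Derivation ℤ F F) (i : σ) :
    coeffDerivation σ d (MvPolynomial.X i) = 0 := by
  rw [MvPolynomial.X, coeffDerivation_monomial, Derivation.map_one_eq_zero, map_zero]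

/-- The derivation of a polynomial ring with given values on coefficients and variables. -/
noncomputable def derOf (d : Derivation ℤ F F) (g : σ → MvPolynomial σ F) :
    Derivation ℤ (MvPolynomial σ F) (MvPolynomial σ F) :=
  coeffDerivation σ d + (MvPolynomial.mkDerivation F g).restrictScalars ℤ

@[simp]
theorem derOf_C (d : Derivation ℤ F F) (g : σ → MvPolynomial σ F) (a : F) :
    derOf d g (MvPolynomial.C a) = MvPolynomial.C (d a) := by
  simp [derOf]

@[simp]
theorem derOf_X (d : Derivation ℤ F F) (g : σ → MvPolynomial σ F) (i : σ) :
    derOf d g (MvPolynomial.X i) = g i := by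
  simp [derOf]

/-- Two additive maps satisfying the Leibniz rule agree if they agree on generators. -/
theorem leibniz_ext {N : Type*} [CommRing N] (ev : MvPolynomial σ F →+* N)
    (d₁ d₂ : MvPolynomial σ F →+ N)
    (h₁ : ∀ p q, d₁ (p * q) = ev p * d₁ q + ev q * d₁ p)
    (h₂ : ∀ p q, d₂ (p * q) = ev p * d₂ q + ev q * d₂ p)
    (hC : ∀ c, d₁ (MvPolynomial.C c) = d₂ (MvPolynomial.C c)) {S : Set σ}
    (hX : ∀ i ∈ S, d₁ (MvPolynomial.X i) = d₂ (MvPolynomial.X i)) {p : MvPolynomial σ F}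
    (hp : p ∈ MvPolynomial.supported F S) : d₁ p = d₂ p := by
  rw [MvPolynomial.supported] at hp
  induction hp using Algebra.adjoin_induction with
  | mem p hp =>
    obtain ⟨i, hi, rfl⟩ := hp
    exact hX i hi
  | algebraMap c => exact hC c
  | add p q _ _ h h' => rw [map_add, map_add, h, h']
  | mul p q _ _ h h' => rw [h₁, h₂, h, h']

/-- Only the values on occurring variables matter; this is what later makes truncated recursive data
sufficient. -/
theorem derOf_congr (d : Derivation ℤ F F) {g g' : σ → MvPolynomial σ F} {S : Set σ}
    (h : ∀ i ∈ S, g i = g' i) {p : MvPolynomial σ F} (hp : p ∈ MvPolynomial.supported F S) :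
    derOf d g p = derOf d g' p :=
  leibniz_ext (RingHom.id _) (derOf d g).toLinearMap.toAddMonoidHom (derOf d g').toLinearMap.toAddMonoidHom
    (fun p q => (derOf d g).leibniz p q) (fun p q => (derOf d g').leibniz p q)
    (fun c => (derOf_C d g c).trans (derOf_C d g' c).symm)
    (fun i hi => (derOf_X d g i).trans ((h i hi).trans (derOf_X d g' i).symm)) hp

theorem derOf_mem_supported (d : Derivation ℤ F F) {g : σ → MvPolynomial σ F} {S S' : Set σ}
    (hS : S ⊆ S') (h : ∀ i ∈ S, g i ∈ MvPolynomial.supported F S') {p : MvPolynomial σ F}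
    (hp : p ∈ MvPolynomial.supported F S) : derOf d g p ∈ MvPolynomial.supported F S' := by
  -- The Leibniz rule also involves the undifferentiated factors, so their membership is carried
  -- along in the induction.
  have key : p ∈ MvPolynomial.supported F S' ∧ derOf d g p ∈ MvPolynomial.supported F S' := by
    rw [MvPolynomial.supported] at hp
    induction hp using Algebra.adjoin_induction with
    | mem p hp =>
      obtain ⟨i, hi, rfl⟩ := hp
      exact ⟨Algebra.subset_adjoin ⟨i, hS hi, rfl⟩, by rw [derOf_X]; exact h i hi⟩
    | algebraMap c =>
      exact ⟨Subalgebra.algebraMap_mem _ c, by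
        rw [MvPolynomial.algebraMap_eq, derOf_C]
        exact Subalgebra.algebraMap_mem _ (d c)⟩
    | add p q _ _ h h' => exact ⟨add_mem h.1 h'.1, by rw [map_add]; exact add_mem h.2 h'.2⟩
    | mul p q _ _ h h' =>
      refine ⟨mul_mem h.1 h'.1, ?_⟩
      rw [Derivation.leibniz, smul_eq_mul, smul_eq_mul]
      exact add_mem (mul_mem h.1 h'.2) (mul_mem h'.1 h.2)
  exact key.2

/-- A derivation of the target of an evaluation is computed by a derivation of polynomials, once
this holds on the relevant variables. -/
theorem der_eval {N : Type*} [CommRing N] (ev : MvPolynomial σ F →+* N) (D : Derivation ℤ N N)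
    (d : Derivation ℤ F F) (g : σ → MvPolynomial σ F)
    (hC : ∀ c, D (ev (MvPolynomial.C c)) = ev (MvPolynomial.C (d c))) {S : Set σ}
    (hX : ∀ i ∈ S, D (ev (MvPolynomial.X i)) = ev (g i)) {p : MvPolynomial σ F}
    (hp : p ∈ MvPolynomial.supported F S) : D (ev p) = ev (derOf d g p) :=
  leibniz_ext ev (D.toLinearMap.toAddMonoidHom.comp (ev : _ →+ N))
    ((ev : _ →+ N).comp (derOf d g).toLinearMap.toAddMonoidHom)
    (fun p q => by
      change D (ev (p * q)) = ev p * D (ev q) + ev q * D (ev p)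
      rw [map_mul, D.leibniz]; rfl)
    (fun p q => by
      change ev (derOf d g (p * q)) = ev p * ev (derOf d g q) + ev q * ev (derOf d g p)
      rw [Derivation.leibniz, map_add, smul_eq_mul, smul_eq_mul, map_mul, map_mul])
    (fun c => (hC c).trans (by
      change _ = ev (derOf d g (MvPolynomial.C c)); rw [derOf_C]))
    (fun i hi => (hX i hi).trans (by
      change _ = ev (derOf d g (MvPolynomial.X i)); rw [derOf_X])) hp

/-- As `der_eval`, with one variable on which the polynomial derivation vanishes. -/
theorem der_eval_pderiv {N : Type*} [CommRing N] (ev : MvPolynomial σ F →+* N)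
    (D : Derivation ℤ N N)
    (d : Derivation ℤ F F) (g : σ → MvPolynomial σ F)
    (hC : ∀ c, D (ev (MvPolynomial.C c)) = ev (MvPolynomial.C (d c))) {S : Set σ} (i₀ : σ)
    (hg : g i₀ = 0)
    (hX : ∀ i ∈ S, i ≠ i₀ → D (ev (MvPolynomial.X i)) = ev (g i)) {p : MvPolynomial σ F}
    (hp : p ∈ MvPolynomial.supported F S) :
    D (ev p) = ev (derOf d g p) + ev (MvPolynomial.pderiv i₀ p) * D (ev (MvPolynomial.X i₀)) := by
  classical
  let e₂ : MvPolynomial σ F →+ N := (ev : _ →+ N).comp (derOf d g).toLinearMap.toAddMonoidHom +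
    ((AddMonoidHom.mulRight (D (ev (MvPolynomial.X i₀)))).comp (ev : _ →+ N)).comp
      (MvPolynomial.pderiv i₀ : Derivation F (MvPolynomial σ F) _).toLinearMap.toAddMonoidHom
  have he₂ : ∀ p, e₂ p = ev (derOf d g p) +
    ev (MvPolynomial.pderiv i₀ p) * D (ev (MvPolynomial.X i₀)) := fun p => rfl
  refine (leibniz_ext ev (D.toLinearMap.toAddMonoidHom.comp (ev : _ →+ N)) e₂ ?_ ?_ ?_ ?_ hp).trans (he₂ p)
  · intro p q
    change D (ev (p * q)) = ev p * D (ev q) + ev q * D (ev p)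
    rw [map_mul, D.leibniz]; rfl
  · intro p q
    rw [he₂, he₂, he₂, Derivation.leibniz, Derivation.leibniz]
    simp only [smul_eq_mul, map_add, map_mul]
    ring
  · intro c
    rw [he₂, derOf_C, MvPolynomial.pderiv_C, map_zero, zero_mul, add_zero]
    exact hC c
  · intro i hi
    rw [he₂, derOf_X]
    by_cases h : i = i₀
    · subst h
      rw [hg, MvPolynomial.pderiv_X_self, map_zero, map_one, one_mul, zero_add]
      rfl
    · rw [MvPolynomial.pderiv_X_of_ne (fun h' => h h'), map_zero, zero_mul, add_zero]
      exact hX i hi h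

end PolyDerivation

/-! ### Leaders and the universal differential polynomial ring -/

/-- A well-ordered set with strictly increasing, strictly inflationary maps `s i`. -/
structure Frame (ι Θ : Type) where
  lt : Θ → Θ → Prop
  wo : IsWellOrder Θ lt
  s : ι → Θ → Θ
  s_mono : ∀ i μ ν, lt μ ν → lt (s i μ) (s i ν)
  lt_s : ∀ i μ, lt μ (s i μ)

/-- A set of leaders in a frame, and a finite subset `P` from which all leaders are obtained by the
maps `s i`. -/
structure Leaders {ι Θ : Type} (fr : Frame ι Θ) where
  Lead : Θ → Prop
  P : Finset Θ
  P_lead : ∀ π ∈ P, Lead π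
  lead_cases : ∀ α, Lead α → α ∈ P ∨ ∃ i α', Lead α' ∧ α = fr.s i α'

namespace Leaders

variable {ι Θ : Type} {fr : Frame ι Θ} (ld : Leaders fr)

/-- The free elements together with the elements of `P`. -/
abbrev Vars : Type := {μ : Θ // ¬ ld.Lead μ ∨ μ ∈ ld.P}

/-- An element of `P`, as a variable. -/
def ofP (π : ld.P) : ld.Vars := ⟨π, Or.inr π.2⟩

/-- The variables of the universal differential polynomial ring: jets of parameters, the
variables `x_μ`, and inverses of separants. -/
abbrev Idx (I : Type) : Type := ((I × List ι) ⊕ ld.Vars) ⊕ ld.P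

/-- The jet variable. -/
abbrev ij (I : Type) (p : I × List ι) : ld.Idx I := Sum.inl (Sum.inl p)
/-- The variable `x_μ`. -/
abbrev ix (I : Type) (μ : ld.Vars) : ld.Idx I := Sum.inl (Sum.inr μ)
/-- The variable for the inverse of a separant. -/
abbrev it (I : Type) (π : ld.P) : ld.Idx I := Sum.inr π

/-- The variables allowed in the polynomial for `π`. -/
def allowed (I : Type) (π : ld.P) : Set ((I × List ι) ⊕ ld.Vars) :=
  {z | ∀ μ, z = Sum.inr μ → μ = ld.ofP π ∨ (¬ ld.Lead μ ∧ fr.lt μ π)}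

end Leaders

/-- Polynomials `p π` defining the elements of `P` over the free ones. -/
structure Eqns {ι Θ : Type} {fr : Frame ι Θ} (ld : Leaders fr) (F : Type w) [CommRing F]
    (I : Type) where
  d : ι → Derivation ℤ F F
  p : ld.P → MvPolynomial ((I × List ι) ⊕ ld.Vars) F
  p_mem : ∀ π, p π ∈ MvPolynomial.supported F (ld.allowed I π)

namespace Eqns

open MvPolynomial

variable {ι Θ : Type} {fr : Frame ι Θ} {ld : Leaders fr} {F : Type w} [CommRing F] {I : Type}
  (E : Eqns ld F I)

/-- The universal polynomial ring. -/
abbrev U (_ : Eqns ld F I) : Type w := MvPolynomial (ld.Idx I) F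

/-- The polynomial `p π` in the universal ring. -/
noncomputable def pU (π : ld.P) : E.U := rename Sum.inl (E.p π)

/-- The separant of `p π`. -/
noncomputable def sep (π : ld.P) : MvPolynomial ((I × List ι) ⊕ ld.Vars) F :=
  pderiv (Sum.inr (ld.ofP π)) (E.p π)

/-- The separant in the universal ring. -/
noncomputable def sU (π : ld.P) : E.U := rename Sum.inl (E.sep π)

/-- The variables allowed in `pU π`. -/
def allowedU (_ : Eqns ld F I) (π : ld.P) : Set (ld.Idx I) := Sum.inl '' (ld.allowed I π)

theorem rename_mem_supported {σ τ : Type*} (f : σ → τ) {S : Set σ} {p : MvPolynomial σ F}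
    (hp : p ∈ supported F S) : rename f p ∈ supported F (f '' S) := by
  rw [supported] at hp
  induction hp using Algebra.adjoin_induction with
  | mem p hp =>
    obtain ⟨i, hi, rfl⟩ := hp
    rw [rename_X]
    exact Algebra.subset_adjoin ⟨f i, ⟨i, hi, rfl⟩, rfl⟩
  | algebraMap c =>
    rw [algebraMap_eq, rename_C]
    exact Subalgebra.algebraMap_mem _ c
  | add p q _ _ h h' => rw [map_add]; exact add_mem h h'
  | mul p q _ _ h h' => rw [map_mul]; exact mul_mem h h'

theorem pderiv_mem_supported {σ : Type*} (i : σ) {S : Set σ} {p : MvPolynomial σ F}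
    (hp : p ∈ supported F S) : pderiv i p ∈ supported F S := by
  classical
  have key : p ∈ supported F S ∧ pderiv i p ∈ supported F S := by
    rw [supported] at hp
    induction hp using Algebra.adjoin_induction with
    | mem p hp =>
      obtain ⟨j, hj, rfl⟩ := hp
      refine ⟨Algebra.subset_adjoin ⟨j, hj, rfl⟩, ?_⟩
      rw [pderiv_X]
      by_cases h : j = i
      · subst h; rw [Pi.single_eq_same]; exact one_mem _
      · rw [Pi.single_eq_of_ne h]; exact zero_mem _
    | algebraMap c =>
      refine ⟨Subalgebra.algebraMap_mem _ c, ?_⟩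
      rw [algebraMap_eq, pderiv_C]; exact zero_mem _
    | add p q _ _ h h' => exact ⟨add_mem h.1 h'.1, by rw [map_add]; exact add_mem h.2 h'.2⟩
    | mul p q _ _ h h' =>
      refine ⟨mul_mem h.1 h'.1, ?_⟩
      rw [Derivation.leibniz, smul_eq_mul, smul_eq_mul]
      exact add_mem (mul_mem h.1 h'.2) (mul_mem h'.1 h.2)
  exact key.2

theorem pU_mem (π : ld.P) : E.pU π ∈ supported F (E.allowedU π) :=
  rename_mem_supported _ (E.p_mem π)

theorem sU_mem (π : ld.P) : E.sU π ∈ supported F (E.allowedU π) :=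
  rename_mem_supported _ (pderiv_mem_supported _ (E.p_mem π))

theorem pderiv_pU (π : ld.P) : pderiv (ld.ix I (ld.ofP π)) (E.pU π) = E.sU π :=
  pderiv_rename Sum.inl_injective _ _

open Classical in
/-- First approximation to the values of the derivation `i` on the variables: the leaders and the
inverses of separants are treated as constants. -/
noncomputable def g1 (G : Θ → E.U) (i : ι) : ld.Idx I → E.U
  | Sum.inl (Sum.inl (z, γ)) => X (ld.ij I (z, i :: γ))
  | Sum.inl (Sum.inr μ) => if ld.Lead μ then 0 else G (fr.s i μ)
  | Sum.inr _ => 0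

/-- The part of the derivative of `p π` not involving the derivative of `x_π`. -/
noncomputable def A (G : Θ → E.U) (i : ι) (π : ld.P) : E.U := derOf (E.d i) (E.g1 G i) (E.pU π)

open Classical in
/-- Second approximation: the inverses of separants are treated as constants. -/
noncomputable def g2 (G : Θ → E.U) (i : ι) : ld.Idx I → E.U
  | Sum.inl (Sum.inl (z, γ)) => X (ld.ij I (z, i :: γ))
  | Sum.inl (Sum.inr μ) =>
    if h : (μ : Θ) ∈ ld.P then -(X (ld.it I ⟨μ, h⟩) * E.A G i ⟨μ, h⟩) else G (fr.s i μ)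
  | Sum.inr _ => 0

/-- The values of the derivation `i` on the variables. -/
noncomputable def g3 (G : Θ → E.U) (i : ι) : ld.Idx I → E.U
  | Sum.inl z => E.g2 G i (Sum.inl z)
  | Sum.inr π => -(X (ld.it I π) * X (ld.it I π) * derOf (E.d i) (E.g2 G i) (E.sU π))

/-- The derivation `i` of the universal ring, given the values `G`. -/
noncomputable def R (G : Θ → E.U) (i : ι) : Derivation ℤ E.U E.U := derOf (E.d i) (E.g3 G i)

/-- The elements `α` such that `G α` is used in computing the derivation `i` on polynomials in
the variables from `S`. -/
def Reach (i : ι) (S : Set (ld.Idx I)) : Set Θ :=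
  {α | ∃ μ : ld.Vars, ¬ ld.Lead μ ∧ α = fr.s i μ ∧
    (ld.ix I μ ∈ S ∨ ∃ π : ld.P, fr.lt μ π ∧ (ld.ix I (ld.ofP π) ∈ S ∨ ld.it I π ∈ S))}

theorem mem_allowedU {π : ld.P} {z : ld.Idx I} (hz : z ∈ E.allowedU π) :
    (∃ p, z = ld.ij I p) ∨ z = ld.ix I (ld.ofP π) ∨
      ∃ μ : ld.Vars, ¬ ld.Lead μ ∧ fr.lt μ π ∧ z = ld.ix I μ := by
  obtain ⟨z, hz, rfl⟩ := hz
  rcases z with p | μ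
  · exact Or.inl ⟨p, rfl⟩
  · rcases hz μ rfl with rfl | ⟨h1, h2⟩
    · exact Or.inr (Or.inl rfl)
    · exact Or.inr (Or.inr ⟨μ, h1, h2, rfl⟩)

theorem lead_ofP (π : ld.P) : ld.Lead (ld.ofP π) := ld.P_lead _ π.2

theorem g1_congr {G G' : Θ → E.U} {i : ι} {π : ld.P}
    (h : ∀ μ : ld.Vars, ¬ ld.Lead μ → fr.lt μ π → G (fr.s i μ) = G' (fr.s i μ)) :
    ∀ z ∈ E.allowedU π, E.g1 G i z = E.g1 G' i z := by
  intro z hz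
  rcases E.mem_allowedU hz with ⟨p, rfl⟩ | rfl | ⟨μ, h1, h2, rfl⟩
  · rfl
  · simp only [g1, if_pos (lead_ofP π)]
  · simp only [g1, if_neg h1]
    exact h μ h1 h2

theorem g2_ofP (G : Θ → E.U) (i : ι) (π : ld.P) :
    E.g2 G i (ld.ix I (ld.ofP π)) = -(X (ld.it I π) * E.A G i π) :=
  dif_pos π.2

theorem g2_free (G : Θ → E.U) (i : ι) {μ : ld.Vars} (hμ : ¬ ld.Lead μ) :
    E.g2 G i (ld.ix I μ) = G (fr.s i μ) :=
  dif_neg (fun h => hμ (ld.P_lead _ h))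

theorem A_congr {G G' : Θ → E.U} {i : ι} {π : ld.P}
    (h : ∀ μ : ld.Vars, ¬ ld.Lead μ → fr.lt μ π → G (fr.s i μ) = G' (fr.s i μ)) :
    E.A G i π = E.A G' i π :=
  derOf_congr _ (E.g1_congr h) (E.pU_mem π)

theorem g2_congr {G G' : Θ → E.U} {i : ι} {π : ld.P}
    (h : ∀ μ : ld.Vars, ¬ ld.Lead μ → fr.lt μ π → G (fr.s i μ) = G' (fr.s i μ)) :
    ∀ z ∈ E.allowedU π, E.g2 G i z = E.g2 G' i z := by
  intro z hz
  rcases E.mem_allowedU hz with ⟨p, rfl⟩ | rfl | ⟨μ, h1, h2, rfl⟩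
  · rfl
  · rw [g2_ofP, g2_ofP, E.A_congr h]
  · rw [g2_free _ _ _ h1, g2_free _ _ _ h1]
    exact h μ h1 h2

/-- The variables: a jet, a free variable, an element of `P`, or an inverse of a separant. -/
theorem idx_cases (z : ld.Idx I) : (∃ p, z = ld.ij I p) ∨
    (∃ μ : ld.Vars, ¬ ld.Lead μ ∧ z = ld.ix I μ) ∨ (∃ π, z = ld.ix I (ld.ofP π)) ∨
      ∃ π, z = ld.it I π := by
  rcases z with (p | ⟨μ, h | h⟩) | π
  · exact Or.inl ⟨p, rfl⟩
  · exact Or.inr (Or.inl ⟨⟨μ, Or.inl h⟩, h, rfl⟩)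
  · exact Or.inr (Or.inr (Or.inl ⟨⟨μ, h⟩, rfl⟩))
  · exact Or.inr (Or.inr (Or.inr ⟨π, rfl⟩))

/-- The data G enters the derivation only through the images of free elements that occur directly or
inside some p_π. This locality allows G to be defined by recursion through the derivation that it
determines. -/
theorem R_congr {G G' : Θ → E.U} {i : ι} {S : Set (ld.Idx I)}
    (h : ∀ α ∈ Reach i S, G α = G' α) {u : E.U} (hu : u ∈ supported F S) :
    E.R G i u = E.R G' i u := by
  refine derOf_congr _ (fun z hz => ?_) hu
  rcases idx_cases z with ⟨p, rfl⟩ | ⟨μ, h1, rfl⟩ | ⟨π, rfl⟩ | ⟨π, rfl⟩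
  · rfl
  · change E.g2 G i (ld.ix I μ) = E.g2 G' i (ld.ix I μ)
    rw [g2_free _ _ _ h1, g2_free _ _ _ h1]
    exact h _ ⟨μ, h1, rfl, Or.inl hz⟩
  · change E.g2 G i (ld.ix I (ld.ofP π)) = E.g2 G' i (ld.ix I (ld.ofP π))
    rw [g2_ofP, g2_ofP, E.A_congr]
    exact fun μ h1 h2 => h _ ⟨μ, h1, rfl, Or.inr ⟨π, h2, Or.inl hz⟩⟩
  · change -(_ * derOf _ _ _) = -(_ * derOf _ _ _)
    rw [derOf_congr _ (E.g2_congr (G := G) (G' := G') ?_) (E.sU_mem π)]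
    exact fun μ h1 h2 => h _ ⟨μ, h1, rfl, Or.inr ⟨π, h2, Or.inr hz⟩⟩

/-- `S'` is large enough to contain the derivative of polynomials in the variables of `S`. -/
theorem R_mem_supported {G : Θ → E.U} {i : ι} {S S' : Set (ld.Idx I)} (hS : S ⊆ S')
    (hj : ∀ p, ld.ij I p ∈ S')
    (hP : ∀ π, ld.ix I (ld.ofP π) ∈ S ∨ ld.it I π ∈ S → E.allowedU π ⊆ S' ∧ ld.it I π ∈ S')
    (h : ∀ α ∈ Reach i S, G α ∈ supported F S') {u : E.U} (hu : u ∈ supported F S) :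
    E.R G i u ∈ supported F S' := by
  have hX : ∀ z ∈ S', (X z : E.U) ∈ supported F S' := fun z hz =>
    Algebra.subset_adjoin ⟨z, hz, rfl⟩
  have hA : ∀ π, ld.ix I (ld.ofP π) ∈ S ∨ ld.it I π ∈ S → E.A G i π ∈ supported F S' := by
    intro π hπ
    refine derOf_mem_supported _ (hP π hπ).1 (fun z hz => ?_) (E.pU_mem π)
    rcases E.mem_allowedU hz with ⟨p, rfl⟩ | rfl | ⟨μ, h1, h2, rfl⟩
    · exact hX _ (hj _)
    · simp only [g1, if_pos (lead_ofP π)]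
      exact zero_mem _
    · simp only [g1, if_neg h1]
      exact h _ ⟨μ, h1, rfl, Or.inr ⟨π, h2, hπ⟩⟩
  refine derOf_mem_supported _ hS (fun z hz => ?_) hu
  rcases idx_cases z with ⟨p, rfl⟩ | ⟨μ, h1, rfl⟩ | ⟨π, rfl⟩ | ⟨π, rfl⟩
  · exact hX _ (hj _)
  · change E.g2 G i (ld.ix I μ) ∈ _
    rw [g2_free _ _ _ h1]
    exact h _ ⟨μ, h1, rfl, Or.inl hz⟩
  · change E.g2 G i (ld.ix I (ld.ofP π)) ∈ _
    rw [g2_ofP]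
    exact neg_mem (mul_mem (hX _ (hP π (Or.inl hz)).2) (hA π (Or.inl hz)))
  · change -(_ * derOf _ _ _) ∈ _
    have ht := hX _ (hP π (Or.inr hz)).2
    refine neg_mem (mul_mem (mul_mem ht ht) ?_)
    refine derOf_mem_supported _ (hP π (Or.inr hz)).1 (fun z hz' => ?_) (E.sU_mem π)
    rcases E.mem_allowedU hz' with ⟨p, rfl⟩ | rfl | ⟨μ, h1, h2, rfl⟩
    · exact hX _ (hj _)
    · rw [g2_ofP]
      exact neg_mem (mul_mem ht (hA π (Or.inr hz)))
    · rw [g2_free _ _ _ h1]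
      exact h _ ⟨μ, h1, rfl, Or.inr ⟨π, h2, Or.inr hz⟩⟩

/-- Values of a derivation `D` in an evaluation of the universal ring. -/
theorem der_ev {N : Type*} [Field N] (ev : E.U →+* N) {i : ι} (D : Derivation ℤ N N) {G : Θ → E.U}
    {S : Set (ld.Idx I)}
    (hC : ∀ c, D (ev (C c)) = ev (C (E.d i c)))
    (hj : ∀ z γ, D (ev (X (ld.ij I (z, γ)))) = ev (X (ld.ij I (z, i :: γ))))
    (hx : ∀ α ∈ Reach i S, ∀ μ : ld.Vars, ¬ ld.Lead μ → α = fr.s i μ →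
      D (ev (X (ld.ix I μ))) = ev (G α))
    (hp : ∀ π, ev (E.pU π) = 0) (hs : ∀ π, ev (E.sU π) * ev (X (ld.it I π)) = 1)
    {u : E.U} (hu : u ∈ supported F S) : D (ev u) = ev (E.R G i u) := by
  have hxP : ∀ π, ld.ix I (ld.ofP π) ∈ S ∨ ld.it I π ∈ S →
      D (ev (X (ld.ix I (ld.ofP π)))) = ev (E.g2 G i (ld.ix I (ld.ofP π))) := by
    intro π hπ
    have h1 := der_eval_pderiv ev D (E.d i) (E.g1 G i) hC (S := E.allowedU π)
      (ld.ix I (ld.ofP π)) (if_pos (lead_ofP π)) (fun z hz hne => by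
        rcases E.mem_allowedU hz with ⟨p, rfl⟩ | rfl | ⟨μ, h1, h2, rfl⟩
        · exact hj _ _
        · exact absurd rfl hne
        · simp only [g1, if_neg h1]
          exact hx _ ⟨μ, h1, rfl, Or.inr ⟨π, h2, hπ⟩⟩ μ h1 rfl) (E.pU_mem π)
    rw [hp, map_zero, pderiv_pU] at h1
    rw [g2_ofP, map_neg, map_mul, A]
    -- Here `h1` reads 0 = A + s · D x_π; multiplying by the inverse t of the separant s gives D x_π
    -- = −tA.
    linear_combination (-ev (X (ld.it I π))) * h1 -
      D (ev (X (ld.ix I (ld.ofP π)))) * hs π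
  refine der_eval ev D (E.d i) (E.g3 G i) hC (fun z hz => ?_) hu
  rcases idx_cases z with ⟨p, rfl⟩ | ⟨μ, h1, rfl⟩ | ⟨π, rfl⟩ | ⟨π, rfl⟩
  · exact hj _ _
  · change _ = ev (E.g2 G i (ld.ix I μ))
    rw [g2_free _ _ _ h1]
    exact hx _ ⟨μ, h1, rfl, Or.inl hz⟩ μ h1 rfl
  · exact hxP π (Or.inl hz)
  · have h2 : D (ev (E.sU π)) = ev (derOf (E.d i) (E.g2 G i) (E.sU π)) :=
      der_eval ev D (E.d i) (E.g2 G i) hC (S := E.allowedU π) (fun z hz' => by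
        rcases E.mem_allowedU hz' with ⟨p, rfl⟩ | rfl | ⟨μ, h1, h2, rfl⟩
        · exact hj _ _
        · exact hxP π (Or.inr hz)
        · rw [g2_free _ _ _ h1]
          exact hx _ ⟨μ, h1, rfl, Or.inr ⟨π, h2, Or.inr hz⟩⟩ μ h1 rfl) (E.sU_mem π)
    -- Differentiating st = 1 gives D t = −t² · D s.
    have h3 := congrArg D (hs π)
    rw [D.leibniz, Derivation.map_one_eq_zero, h2, smul_eq_mul, smul_eq_mul] at h3
    change D (ev (X (ld.it I π))) = ev (-(X (ld.it I π) * X (ld.it I π) *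
      derOf (E.d i) (E.g2 G i) (E.sU π)))
    rw [map_neg, map_mul, map_mul]
    linear_combination (ev (X (ld.it I π))) * h3 - D (ev (X (ld.it I π))) * hs π

end Eqns

namespace Eqns

open MvPolynomial

variable {ι Θ : Type} {fr : Frame ι Θ} {ld : Leaders fr} {F : Type w} [CommRing F] {I : Type}
  (E : Eqns ld F I)

open Classical in
/-- The polynomial that represents the element `α` of the frame. -/
noncomputable def G (α : Θ) : E.U :=
  fr.wo.toIsWellFounded.wf.fix (C := fun _ => E.U) (fun α rec =>
    if h : ¬ ld.Lead α ∨ α ∈ ld.P then X (ld.ix I ⟨α, h⟩) else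
      have h' := (ld.lead_cases α (by_contra fun h1 => h (Or.inl h1))).resolve_left
        (fun h1 => h (Or.inr h1))
      let α' := h'.choose_spec.choose
      -- The derivation is formed from the values already constructed below α, with 0 elsewhere;
      -- `reach_upTo` shows that the zeros are never consulted.
      E.R (fun β => if hβ : fr.lt β α then rec β hβ else 0) h'.choose
        (if hβ : fr.lt α' α then rec α' hβ else 0)) α

theorem G_var (μ : ld.Vars) : E.G μ = X (ld.ix I μ) := by
  rw [G, WellFounded.fix_eq, dif_pos μ.2]

-- Unfolds the well-founded recursion one step, with the cut-off still in place.
open Classical in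
theorem G_trunc (α : Θ) (h : ¬ (¬ ld.Lead α ∨ α ∈ ld.P)) : ∃ i α', ld.Lead α' ∧ α = fr.s i α' ∧
    E.G α = E.R (fun β => if fr.lt β α then E.G β else 0) i (E.G α') := by
  have h' := (ld.lead_cases α (by_contra fun h1 => h (Or.inl h1))).resolve_left
        (fun h1 => h (Or.inr h1))
  have h2 := h'.choose_spec.choose_spec
  refine ⟨h'.choose, h'.choose_spec.choose, h2.1, h2.2, ?_⟩
  have hlt : fr.lt h'.choose_spec.choose α := by
    conv_rhs => rw [h2.2]
    exact fr.lt_s _ _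
  rw [G, WellFounded.fix_eq, dif_neg h]
  simp only [dite_eq_ite]
  rw [if_pos hlt]
  rfl

/-- The variables up to `α`. -/
def upTo (_ : Eqns ld F I) (α : Θ) : Set (ld.Idx I) :=
  {z | (∀ μ, z = ld.ix I μ → fr.lt μ α ∨ (μ : Θ) = α) ∧
    ∀ π : ld.P, z = ld.it I π → fr.lt π α ∨ (π : Θ) = α}

theorem lt_trans' {a b c : Θ} (h : fr.lt a b) (h' : fr.lt b c) : fr.lt a c := by
  have := fr.wo
  exact _root_.trans h h'

theorem lt_of_le_of_lt' {a b c : Θ} (h : fr.lt a b ∨ a = b) (h' : fr.lt b c) : fr.lt a c := by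
  rcases h with h | rfl
  · exact lt_trans' h h'
  · exact h'

theorem le_of_le_of_le {a b c : Θ} (h : fr.lt a b ∨ a = b) (h' : fr.lt b c ∨ b = c) :
    fr.lt a c ∨ a = c := by
  rcases h' with h' | rfl
  · exact Or.inl (lt_of_le_of_lt' h h')
  · exact h

theorem ij_mem_upTo (α : Θ) (p : I × List ι) : ld.ij I p ∈ E.upTo α :=
  ⟨fun _ h => by simp at h, fun _ h => by simp at h⟩

theorem ix_mem_upTo {α : Θ} {μ : ld.Vars} : ld.ix I μ ∈ E.upTo α ↔ fr.lt μ α ∨ (μ : Θ) = α :=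
  ⟨fun h => h.1 μ rfl, fun h => ⟨fun ν hν => by
    have : μ = ν := by simpa using hν
    rwa [← this], fun _ h => by simp at h⟩⟩

theorem it_mem_upTo {α : Θ} {π : ld.P} : ld.it I π ∈ E.upTo α ↔ fr.lt π α ∨ (π : Θ) = α :=
  ⟨fun h => h.2 π rfl, fun h => ⟨fun _ h => by simp at h, fun ν hν => by
    have : π = ν := by simpa using hν
    rwa [← this]⟩⟩

theorem upTo_mono {α β : Θ} (h : fr.lt α β ∨ α = β) : E.upTo α ⊆ E.upTo β :=
  fun _ hz => ⟨fun μ hμ => le_of_le_of_le (hz.1 μ hμ) h, fun π hπ => le_of_le_of_le (hz.2 π hπ) h⟩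

/-- The derivation raises free elements μ < α' only: μ = α' is excluded because α' is a leader, and
the free elements inside p_π lie below π. Monotonicity of `s i` then keeps all values used strictly
below s i α'. This makes the recursion for G well-founded. -/
theorem reach_upTo {i : ι} {α' : Θ} (h : ld.Lead α') {β : Θ} (hβ : β ∈ Reach i (E.upTo α')) :
    fr.lt β (fr.s i α') := by
  obtain ⟨μ, h1, rfl, h2 | ⟨π, h2, h3⟩⟩ := hβ
  · rcases E.ix_mem_upTo.1 h2 with h3 | h3
    · exact fr.s_mono i _ _ h3
    · exact absurd (h3 ▸ h) h1
  · refine fr.s_mono i _ _ ?_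
    rcases h3 with h3 | h3
    · rcases E.ix_mem_upTo.1 h3 with h4 | h4
      · exact lt_trans' h2 h4
      · rw [← h4]; exact h2
    · rcases E.it_mem_upTo.1 h3 with h4 | h4
      · exact lt_trans' h2 h4
      · rw [← h4]; exact h2

/-- Representing α needs no variable beyond α. This removes the cut-off in the recursion and, for
words, bounds the length of the derivatives used. -/
theorem G_mem (α : Θ) : E.G α ∈ supported F (E.upTo α) := by
  classical
  induction α using fr.wo.toIsWellFounded.wf.induction with
  | _ α ih =>
    by_cases h : ¬ ld.Lead α ∨ α ∈ ld.P
    · rw [E.G_var ⟨α, h⟩]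
      exact Algebra.subset_adjoin ⟨_, E.ix_mem_upTo.2 (Or.inr rfl), rfl⟩
    · obtain ⟨i, α', h1, h2, h3⟩ := E.G_trunc α h
      have hlt : fr.lt α' α := h2 ▸ fr.lt_s i α'
      rw [h3]
      refine E.R_mem_supported (E.upTo_mono (Or.inl hlt)) (E.ij_mem_upTo α)
        (fun π hπ => ?_) (fun β hβ => ?_) (ih α' hlt)
      · have hπ' : fr.lt π α := by
          rcases hπ with hπ | hπ
          · exact lt_of_le_of_lt' (E.ix_mem_upTo.1 hπ) hlt
          · exact lt_of_le_of_lt' (E.it_mem_upTo.1 hπ) hlt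
        refine ⟨fun z hz => ?_, E.it_mem_upTo.2 (Or.inl hπ')⟩
        rcases E.mem_allowedU hz with ⟨p, rfl⟩ | rfl | ⟨μ, h1, h2, rfl⟩
        · exact E.ij_mem_upTo α p
        · exact E.ix_mem_upTo.2 (Or.inl hπ')
        · exact E.ix_mem_upTo.2 (Or.inl (lt_trans' h2 hπ'))
      · have hβ' := h2 ▸ E.reach_upTo h1 hβ
        rw [if_pos hβ']
        exact supported_mono (E.upTo_mono (Or.inl hβ')) (ih β hβ')

theorem G_lead (α : Θ) (h : ¬ (¬ ld.Lead α ∨ α ∈ ld.P)) : ∃ i α', ld.Lead α' ∧ α = fr.s i α' ∧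
    E.G α = E.R E.G i (E.G α') := by
  classical
  obtain ⟨i, α', h1, h2, h3⟩ := E.G_trunc α h
  refine ⟨i, α', h1, h2, h3.trans (E.R_congr (fun β hβ => ?_) (E.G_mem α'))⟩
  rw [if_pos (h2 ▸ E.reach_upTo h1 hβ)]

/-- Unwinding the recursion exhibits G α as an iterated derivative of one x_π, as the clause
`f_leader` of a prolongation requires. -/
theorem exists_word (α : Θ) (h : ld.Lead α) : ∃ (v : List ι) (π : ld.P),
    v.foldr fr.s π = α ∧ E.G α = applyWord (fun i => E.R E.G i) v (X (ld.ix I (ld.ofP π))) := by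
  induction α using fr.wo.toIsWellFounded.wf.induction with
  | _ α ih =>
    by_cases hα : ¬ ld.Lead α ∨ α ∈ ld.P
    · refine ⟨[], ⟨α, hα.resolve_left (not_not.2 h)⟩, rfl, E.G_var ⟨α, hα⟩⟩
    · obtain ⟨i, α', h1, h2, h3⟩ := E.G_lead α hα
      obtain ⟨v, π, h4, h5⟩ := ih α' (h2 ▸ fr.lt_s i α') h1
      refine ⟨i :: v, π, ?_, ?_⟩
      · rw [List.foldr_cons, h4, h2]
      · rw [h3, h5]; rfl

/-- Evaluations of the universal ring that are compatible with derivations. -/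
structure IsDerEval {N : Type*} [Field N] (ev : E.U →+* N) (D : ι → Derivation ℤ N N)
    (e : Θ → N) : Prop where
  hC : ∀ i c, D i (ev (C c)) = ev (C (E.d i c))
  hj : ∀ i z γ, D i (ev (X (ld.ij I (z, γ)))) = ev (X (ld.ij I (z, i :: γ)))
  hx : ∀ μ : ld.Vars, ev (X (ld.ix I μ)) = e μ
  he : ∀ i μ, D i (e μ) = e (fr.s i μ)
  hp : ∀ π, ev (E.pU π) = 0
  hs : ∀ π, ev (E.sU π) * ev (X (ld.it I π)) = 1

variable {E} {N : Type*} [Field N] {ev : E.U →+* N} {D : ι → Derivation ℤ N N} {e : Θ → N}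

/-- Induction along the recursion for G: D is applied to the value at the previous leader, and every
value that the derivation of the universal ring consults lies below α, where the claim is already
known. -/
theorem IsDerEval.ev_G (h : E.IsDerEval ev D e) (α : Θ) : ev (E.G α) = e α := by
  induction α using fr.wo.toIsWellFounded.wf.induction with
  | _ α ih =>
    by_cases hα : ¬ ld.Lead α ∨ α ∈ ld.P
    · rw [E.G_var ⟨α, hα⟩, h.hx]
    · obtain ⟨i, α', h1, h2, h3⟩ := E.G_lead α hα
      rw [h3, ← E.der_ev ev (D i) (S := E.upTo α') (h.hC i) (h.hj i) ?_ h.hp h.hs (E.G_mem α'),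
        ih α' (h2 ▸ fr.lt_s i α'), h.he, ← h2]
      rintro β hβ μ - rfl
      rw [h.hx, h.he, ih _ (h2 ▸ E.reach_upTo h1 hβ)]

theorem IsDerEval.ev_R (h : E.IsDerEval ev D e) (i : ι) (u : E.U) :
    D i (ev u) = ev (E.R E.G i u) := by
  refine E.der_ev ev (D i) (S := Set.univ) (h.hC i) (h.hj i) ?_ h.hp h.hs
    (by rw [supported_univ]; exact Algebra.mem_top)
  rintro β - μ - rfl
  rw [h.hx, h.he, h.ev_G]

/-- At a differential solution the value of an iterated derivative depends only on the element
reached, not on the word leading there; this is the source of the commutation equations. -/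
theorem IsDerEval.ev_word (h : E.IsDerEval ev D e) (v : List ι) (μ : ld.Vars) :
    ev (applyWord (fun i => E.R E.G i) v (X (ld.ix I μ))) = e (v.foldr fr.s μ) := by
  induction v with
  | nil => exact h.hx μ
  | cons i v ih =>
    change ev (E.R E.G i (applyWord (fun i => E.R E.G i) v (X (ld.ix I μ)))) = _
    rw [← h.ev_R, ih, h.he]
    rfl

variable (E) in
/-- Denominators can be cleared in the universal ring. -/
theorem exists_clear (u : E.U) : ∃ (n : ℕ) (q : MvPolynomial ((I × List ι) ⊕ ld.Vars) F),
    ∀ (N : Type x) [Field N] (ev : E.U →+* N),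
      (∀ π, ev (E.sU π) * ev (X (ld.it I π)) = 1) →
      ev u * (∏ π, ev (E.sU π)) ^ n = ev (rename Sum.inl q) := by
  classical
  induction u using MvPolynomial.induction_on with
  | C c => exact ⟨0, C c, fun N _ ev _ => by simp⟩
  | add p q hp hq =>
    obtain ⟨n, p', hp⟩ := hp
    obtain ⟨m, q', hq⟩ := hq
    refine ⟨n + m, p' * (∏ π, E.sep π) ^ m + q' * (∏ π, E.sep π) ^ n, fun N _ ev h => ?_⟩
    have hs : ev (rename Sum.inl (∏ π, E.sep π)) = ∏ π, ev (E.sU π) := by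
      rw [map_prod, map_prod]; rfl
    rw [map_add, map_add, map_add, map_mul, map_mul, map_mul, map_mul, map_pow, map_pow, map_pow,
      map_pow, hs, ← hp N ev h, ← hq N ev h]
    ring
  | mul_X p z hp =>
    obtain ⟨n, p', hp⟩ := hp
    rcases z with z | π
    · refine ⟨n, p' * X z, fun N _ ev h => ?_⟩
      rw [map_mul, map_mul, map_mul, ← hp N ev h, rename_X]
      ring
    -- One further factor ∏ s_π turns the inverse of s_π into the product of the other separants.
    · refine ⟨n + 1, p' * ∏ π' ∈ Finset.univ.erase π, E.sep π', fun N _ ev h => ?_⟩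
      rw [map_mul, map_mul, map_mul, ← hp N ev h, map_prod, map_prod,
        ← Finset.mul_prod_erase _ _ (Finset.mem_univ π)]
      change _ = _ * ∏ π' ∈ Finset.univ.erase π, ev (E.sU π')
      rw [pow_succ]
      linear_combination (ev p * (ev (E.sU π) * ∏ π' ∈ Finset.univ.erase π, ev (E.sU π')) ^ n *
        ∏ π' ∈ Finset.univ.erase π, ev (E.sU π')) * h π

end Eqns

/-! ### Algebraic elements, derivations and stability of leaders -/

section FieldFacts

/-- Elements of the generated field are quotients of elements of B, so this field is algebraic over
B, and algebraicity is transitive. -/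
theorem isAlgebraic_subring_of_subfield {M : Type*} [Field M] {S : Set M} {B : Subring M}
    (hS : S ⊆ B) (hB : B ≤ (Subfield.closure S).toSubring) {z : M}
    (hz : IsAlgebraic (Subfield.closure S) z) : IsAlgebraic B z := by
  let _ : Algebra B (Subfield.closure S) := (Subring.inclusion hB).toAlgebra
  have : IsScalarTower B (Subfield.closure S) M := IsScalarTower.of_algebraMap_eq fun _ => rfl
  have hBE : ∀ y (hy : y ∈ B), IsAlgebraic B (⟨y, hB hy⟩ : Subfield.closure S) := fun y hy =>
    isAlgebraic_algebraMap (⟨y, hy⟩ : B)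
  have : Algebra.IsAlgebraic B (Subfield.closure S) := by
    refine ⟨fun t => ?_⟩
    obtain ⟨y, hy, z, hz, h⟩ := Subfield.mem_closure_iff.1 t.2
    have hy' := Subring.closure_le.2 hS hy
    have hz' := Subring.closure_le.2 hS hz
    have : t = (⟨y, hB hy'⟩ : Subfield.closure S) * (⟨z, hB hz'⟩ : Subfield.closure S)⁻¹ := by
      refine Subtype.ext ?_
      rw [← h, div_eq_mul_inv]
      rfl
    rw [this]
    exact (hBE y hy').mul (hBE z hz').inv
  exact hz.restrictScalars B

theorem isAlgebraic_closure_trans {M : Type*} [Field M] {E : Subfield M} {S : Set M}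
    (hS : ∀ s ∈ S, IsAlgebraic E s) {z : M} (hz : IsAlgebraic (Subfield.closure S) z) :
    IsAlgebraic E z := by
  have h1 : Subfield.closure S ≤ (algebraicClosure E M).toSubfield :=
    Subfield.closure_le.2 fun s hs => mem_algebraicClosure_iff.2 (hS s hs)
  have h2 : IsAlgebraic (algebraicClosure E M) z := isAlgebraic_of_subfield_le h1 hz
  exact h2.restrictScalars E

/-- Differentiating f(z) = 0, for the minimal polynomial f of z, expresses f'(z) · D z through z and
the derivatives of the coefficients; f'(z) ≠ 0 by separability in characteristic 0. -/
theorem derivation_mem_of_isAlgebraic {M : Type*} [Field M] [CharZero M] (D : Derivation ℤ M M)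
    {E E' : Subfield M} (hE : E ≤ E') (hD : ∀ y ∈ E, D y ∈ E') {z : M} (hz : IsAlgebraic E z)
    (hz' : z ∈ E') : D z ∈ E' := by
  -- The difference D(p(z)) − p'(z) · D z is p^D(z), with D applied to the coefficients.
  have key : ∀ p : Polynomial E, Polynomial.aeval z p ∈ E' ∧
      D (Polynomial.aeval z p) - Polynomial.aeval z (Polynomial.derivative p) * D z ∈ E' := by
    intro p
    induction p using Polynomial.induction_on' with
    | add p q hp hq =>
      refine ⟨by rw [map_add]; exact add_mem hp.1 hq.1, ?_⟩
      rw [map_add, map_add, map_add, map_add]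
      have := add_mem hp.2 hq.2
      convert this using 1
      ring
    | monomial n c =>
      have hc : (c : M) ∈ E' := hE c.2
      refine ⟨?_, ?_⟩
      · rw [Polynomial.aeval_monomial]
        exact mul_mem hc (pow_mem hz' n)
      · rw [Polynomial.aeval_monomial, Polynomial.derivative_monomial, Polynomial.aeval_monomial]
        have h1 : D (algebraMap E M c * z ^ n) -
            algebraMap E M (c * n) * z ^ (n - 1) * D z = D c * z ^ n := by
          rw [D.leibniz, D.leibniz_pow, map_mul, map_natCast, smul_eq_mul, smul_eq_mul, smul_eq_mul,
            nsmul_eq_mul]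
          change (c : M) * _ + z ^ n * D c - (c : M) * _ * _ * _ = _
          ring
        rw [h1]
        exact mul_mem (hD c c.2) (pow_mem hz' n)
  have hint := hz.isIntegral
  have h0 := key (minpoly E z)
  have h1 := key (Polynomial.derivative (minpoly E z))
  rw [minpoly.aeval, map_zero, zero_sub, neg_mem_iff] at h0
  have hne : Polynomial.aeval z (Polynomial.derivative (minpoly E z)) ≠ 0 :=
    (minpoly.irreducible hint).separable.aeval_derivative_ne_zero (minpoly.aeval E z)
  have h2 := mul_mem (inv_mem h1.1) h0.2
  rwa [← mul_assoc, inv_mul_cancel₀ hne, one_mul] at h2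

end FieldFacts

section AlgLead

variable {L : FirstOrder.Language.{u, v}} {ρ : FirstOrder.Language.ring →ᴸ L} {K : Type w} [Field K]
    [FirstOrder.Ring.CompatibleRing K] [L.Structure K] [ρ.IsExpansionOn K]
    {M : Type x} [Field M] [FirstOrder.Ring.CompatibleRing M] [L.Structure M] [ρ.IsExpansionOn M]
    (hM : M ⊨ L.completeTheory K)

/-- The derivations `D` extend the derivations `η` of `dcl(∅)`. -/
def ExtendsDer {ι : Type} (η : ι → Derivation ℤ (dclEmpty ρ K) (dclEmpty ρ K))
    (D : ι → Derivation ℤ M M) : Prop :=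
  ∀ i c, D i (dclHom hM c) = dclHom hM (η i c)

/-- The element `e α` is algebraic over `A` and the preceding elements. -/
def AlgLead (ρ : FirstOrder.Language.ring →ᴸ L) [ρ.IsExpansionOn K] [ρ.IsExpansionOn M] {ι Θ : Type}
    (fr : Frame ι Θ) (A : Set M) (e : Θ → M) (α : Θ) : Prop :=
  IsAlgebraic (genField (ρ := ρ) hM (A ∪ e '' {ν | fr.lt ν α})) (e α)

variable {hM} {ι Θ : Type} {fr : Frame ι Θ} {A : Set M} {e : Θ → M}
  {η : ι → Derivation ℤ (dclEmpty ρ K) (dclEmpty ρ K)} {D : ι → Derivation ℤ M M}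

/-- The derivation sends the field generated by A and the elements before α into the field generated
by A and the elements before s i α. That larger field also contains e α, so the derivative of e α
lies in it, and is in particular algebraic over it. -/
theorem AlgLead.s_lead [CharZero M] (hD : ExtendsDer hM η D) (hA : ∀ i, ∀ y ∈ A, D i y ∈ A)
    (he : ∀ i μ, D i (e μ) = e (fr.s i μ)) (i : ι) {α : Θ} (h : AlgLead hM ρ fr A e α) :
    AlgLead hM ρ fr A e (fr.s i α) := by
  let E' := genField (ρ := ρ) hM (A ∪ e '' {ν | fr.lt ν (fr.s i α)})
  have hle : genField (ρ := ρ) hM (A ∪ e '' {ν | fr.lt ν α}) ≤ E' :=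
    genField_mono hM (Set.union_subset_union_right _
      (Set.image_mono fun ν hν => Eqns.lt_trans' hν (fr.lt_s i α)))
  have hder : ∀ y ∈ genField (ρ := ρ) hM (A ∪ e '' {ν | fr.lt ν α}), D i y ∈ E' := by
    intro y hy
    have key : y ∈ E' ∧ D i y ∈ E' := by
      rw [genField] at hy
      induction hy using Subfield.closure_induction with
      | mem y hy =>
        refine ⟨hle (Subfield.subset_closure hy), ?_⟩
        rcases hy with ⟨c, rfl⟩ | hy | ⟨ν, hν, rfl⟩
        · rw [hD]
          exact dclHom_mem_genField hM _ _
        · exact mem_genField hM (Or.inl (hA i y hy))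
        · rw [he]
          exact mem_genField hM (Or.inr ⟨_, fr.s_mono i _ _ hν, rfl⟩)
      | one => exact ⟨one_mem _, by rw [Derivation.map_one_eq_zero]; exact zero_mem _⟩
      | add y z _ _ hy hz => exact ⟨add_mem hy.1 hz.1, by rw [map_add]; exact add_mem hy.2 hz.2⟩
      | neg y _ hy => exact ⟨neg_mem hy.1, by rw [map_neg]; exact neg_mem hy.2⟩
      | inv y _ hy =>
        refine ⟨inv_mem hy.1, ?_⟩
        rw [Derivation.leibniz_inv]
        exact mul_mem (neg_mem (pow_mem (inv_mem hy.1) 2)) hy.2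
      | mul y z _ _ hy hz =>
        refine ⟨mul_mem hy.1 hz.1, ?_⟩
        rw [Derivation.leibniz, smul_eq_mul, smul_eq_mul]
        exact add_mem (mul_mem hy.1 hz.2) (mul_mem hz.1 hy.2)
    exact key.2
  have h1 : D i (e α) ∈ E' := derivation_mem_of_isAlgebraic (D i) hle hder h
    (mem_genField hM (Or.inr ⟨α, fr.lt_s i α, rfl⟩))
  rw [he] at h1
  exact isAlgebraic_algebraMap (⟨_, h1⟩ : E')

/-- Leaders are algebraic over the preceding free elements. -/
theorem isAlgebraic_over_free {Lead : Θ → Prop} (hL : ∀ α, Lead α → AlgLead hM ρ fr A e α) (α : Θ)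
    (h : Lead α) :
    IsAlgebraic (genField (ρ := ρ) hM (A ∪ e '' {ν | ¬ Lead ν ∧ fr.lt ν α})) (e α) := by
  induction α using fr.wo.toIsWellFounded.wf.induction with
  | _ α ih =>
    -- Preceding leaders are themselves algebraic over smaller free elements by induction, and can
    -- be dropped by transitivity.
    refine isAlgebraic_closure_trans ?_ (hL α h)
    have hmem : ∀ y (_ : y ∈ genField (ρ := ρ) hM (A ∪ e '' {ν | ¬ Lead ν ∧ fr.lt ν α})),
        IsAlgebraic (genField (ρ := ρ) hM (A ∪ e '' {ν | ¬ Lead ν ∧ fr.lt ν α})) y :=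
      fun y hy => isAlgebraic_algebraMap
        (⟨y, hy⟩ : genField (ρ := ρ) hM (A ∪ e '' {ν | ¬ Lead ν ∧ fr.lt ν α}))
    rintro s (⟨c, rfl⟩ | hs | ⟨ν, hν, rfl⟩)
    · exact hmem _ (dclHom_mem_genField hM _ c)
    · exact hmem _ (mem_genField hM (Or.inl hs))
    · by_cases hν' : Lead ν
      · refine isAlgebraic_of_subfield_le (genField_mono hM (Set.union_subset_union_right _
          (Set.image_mono ?_))) (ih ν hν hν')
        exact fun μ hμ => ⟨hμ.1, Eqns.lt_trans' hμ.2 hν⟩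
      · exact hmem _ (mem_genField hM (Or.inr ⟨ν, ⟨hν', hν⟩, rfl⟩))

end AlgLead

/-! ### Simple roots of polynomials with parameters -/

section Separable

open MvPolynomial

variable {F : Type v} [CommRing F] {M : Type x} [Field M] (f : F →+* M) {Z : Type}
  (val : Z → M) (z₀ : Z)

open Classical in
/-- Evaluation of all variables except `z₀`. -/
noncomputable def specHom : MvPolynomial Z F →+* Polynomial M :=
  eval₂Hom (Polynomial.C.comp f) (fun z => if z = z₀ then Polynomial.X else Polynomial.C (val z))

theorem specHom_C (c : F) : specHom f val z₀ (C c) = Polynomial.C (f c) := by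
  simp [specHom]

theorem specHom_X_self : specHom f val z₀ (X z₀) = Polynomial.X := by
  simp [specHom]

theorem specHom_X_ne {z : Z} (h : z ≠ z₀) : specHom f val z₀ (X z) = Polynomial.C (val z) := by
  simp [specHom, h]

theorem eval_specHom (p : MvPolynomial Z F) :
    (specHom f val z₀ p).eval (val z₀) = p.eval₂ f val := by
  have h : (Polynomial.evalRingHom (val z₀)).comp (specHom f val z₀) = eval₂Hom f val := by
    refine MvPolynomial.ringHom_ext (fun c => ?_) (fun z => ?_)
    · rw [RingHom.comp_apply, specHom_C]; simp
    · by_cases hz : z = z₀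
      · subst hz; rw [RingHom.comp_apply, specHom_X_self]; simp
      · rw [RingHom.comp_apply, specHom_X_ne _ _ _ hz]; simp
  exact RingHom.congr_fun h p

theorem derivative_specHom (p : MvPolynomial Z F) :
    Polynomial.derivative (specHom f val z₀ p) = specHom f val z₀ (pderiv z₀ p) := by
  induction p using MvPolynomial.induction_on with
  | C c => rw [specHom_C, pderiv_C, Polynomial.derivative_C, map_zero]
  | add p q hp hq => rw [map_add, map_add, map_add, map_add, hp, hq]
  | mul_X p z hp =>
    rw [map_mul, Polynomial.derivative_mul, hp, Derivation.leibniz, map_add, smul_eq_mul,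
      smul_eq_mul, map_mul, map_mul]
    have h : Polynomial.derivative (specHom f val z₀ (X z)) =
        specHom f val z₀ (pderiv z₀ (X z)) := by
      by_cases hz : z = z₀
      · subst hz
        rw [specHom_X_self, pderiv_X_self, Polynomial.derivative_X, map_one]
      · rw [specHom_X_ne _ _ _ hz, pderiv_X_of_ne hz, Polynomial.derivative_C, map_zero]
    rw [h]
    ring

/-- First replace the field by the ring of polynomial values, then lift the coefficients of the
equation from values to polynomials. -/
theorem exists_specHom_ne_zero (S : Set Z) (hz₀ : z₀ ∉ S)
    (h : IsAlgebraic (Subfield.closure (Set.range f ∪ val '' S)) (val z₀)) :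
    ∃ p ∈ supported F (insert z₀ S),
      specHom f val z₀ p ≠ 0 ∧ (specHom f val z₀ p).eval (val z₀) = 0 := by
  obtain ⟨H, hH⟩ : ∃ H : MvPolynomial S F →+* M, H = eval₂Hom f (fun s : S => val s) := ⟨_, rfl⟩
  have hHC : ∀ c, H (C c) = f c := fun c => by simp [hH]
  have hHX : ∀ s, H (X s) = val s := fun s => by simp [hH]
  have hS : Set.range f ∪ val '' S ⊆ (H.range : Set M) := by
    rintro _ (⟨c, rfl⟩ | ⟨s, hs, rfl⟩)
    · exact ⟨C c, hHC c⟩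
    · exact ⟨X ⟨s, hs⟩, hHX _⟩
  have hle : H.range ≤ (Subfield.closure (Set.range f ∪ val '' S)).toSubring := by
    rintro _ ⟨p, rfl⟩
    induction p using MvPolynomial.induction_on with
    | C c => rw [hHC]; exact Subfield.subset_closure (Or.inl ⟨c, rfl⟩)
    | add p q hp hq => rw [map_add]; exact add_mem hp hq
    | mul_X p s hp =>
      rw [map_mul, hHX]
      exact mul_mem hp (Subfield.subset_closure (Or.inr ⟨s, s.2, rfl⟩))
  obtain ⟨q, hq, hq'⟩ := isAlgebraic_subring_of_subfield hS hle h
  obtain ⟨q, rfl⟩ := Polynomial.map_surjective _ H.rangeRestrict_surjective q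
  have hqH : (q.map H.rangeRestrict).map (algebraMap H.range M) = q.map H := by
    rw [Polynomial.map_map]; rfl
  have hq0 : q.map H ≠ 0 := by
    rw [← hqH]
    intro h0
    exact hq ((Polynomial.map_eq_zero_iff Subtype.coe_injective).1 h0)
  have hqz : (q.map H).eval (val z₀) = 0 := by
    rw [← hqH, Polynomial.eval_map]
    exact hq'
  have key : ∀ q : Polynomial (MvPolynomial S F), ∃ p ∈ supported F (insert z₀ S),
      specHom f val z₀ p = q.map H := by
    intro q
    induction q using Polynomial.induction_on' with
    | add q q' h h' =>
      obtain ⟨p, hp, h⟩ := h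
      obtain ⟨p', hp', h'⟩ := h'
      exact ⟨p + p', add_mem hp hp', by rw [map_add, h, h', Polynomial.map_add]⟩
    | monomial n c =>
      have hc : ∃ p ∈ supported F (insert z₀ S), specHom f val z₀ p = Polynomial.C (H c) := by
        induction c using MvPolynomial.induction_on with
        | C c => exact ⟨C c, Subalgebra.algebraMap_mem _ c, by rw [specHom_C, hHC]⟩
        | add c c' h h' =>
          obtain ⟨p, hp, h⟩ := h
          obtain ⟨p', hp', h'⟩ := h'
          exact ⟨p + p', add_mem hp hp', by rw [map_add, h, h', map_add, map_add]⟩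
        | mul_X c s h =>
          obtain ⟨p, hp, h⟩ := h
          refine ⟨p * X (s : Z), mul_mem hp (Algebra.subset_adjoin ⟨s, Or.inr s.2, rfl⟩), ?_⟩
          rw [map_mul, h, specHom_X_ne _ _ _ (fun h => hz₀ (by rw [← h]; exact s.2)), map_mul, hHX, map_mul]
      obtain ⟨p, hp, h⟩ := hc
      have hX : (X z₀ : MvPolynomial Z F) ∈ supported F (insert z₀ S) :=
        Algebra.subset_adjoin ⟨z₀, Or.inl rfl, rfl⟩
      refine ⟨p * X z₀ ^ n, mul_mem hp (pow_mem hX n), ?_⟩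
      rw [map_mul, map_pow, h, specHom_X_self, Polynomial.map_monomial,
        Polynomial.C_mul_X_pow_eq_monomial]
  obtain ⟨p, hp, h⟩ := key q
  exact ⟨p, hp, by rwa [h], by rwa [h]⟩

/-- An element algebraic over others is a simple root of a polynomial over them. -/
theorem exists_separable_polynomial [CharZero M] (S : Set Z) (hz₀ : z₀ ∉ S)
    (h : IsAlgebraic (Subfield.closure (Set.range f ∪ val '' S)) (val z₀)) :
    ∃ p ∈ supported F (insert z₀ S), p.eval₂ f val = 0 ∧ (pderiv z₀ p).eval₂ f val ≠ 0 := by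
  classical
  -- Take minimal degree in z₀ after specialization. If the root were multiple, the derivative would
  -- be a nonzero equation of smaller degree.
  have hex : ∃ n, ∃ p ∈ supported F (insert z₀ S), specHom f val z₀ p ≠ 0 ∧
      (specHom f val z₀ p).eval (val z₀) = 0 ∧ (specHom f val z₀ p).natDegree = n := by
    obtain ⟨p, h1, h2, h3⟩ := exists_specHom_ne_zero f val z₀ S hz₀ h
    exact ⟨_, p, h1, h2, h3, rfl⟩
  obtain ⟨p, hp, hp0, hpz, hpn⟩ := Nat.find_spec hex
  refine ⟨p, hp, by rw [← eval_specHom f val z₀]; exact hpz, fun hd => ?_⟩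
  rw [← eval_specHom f val z₀, ← derivative_specHom] at hd
  by_cases hdz : Polynomial.derivative (specHom f val z₀ p) = 0
  · have h1 := Polynomial.derivative_eq_zero.1 hdz
    rw [Polynomial.eq_C_of_natDegree_eq_zero h1, Polynomial.eval_C] at hpz
    apply hp0
    rw [Polynomial.eq_C_of_natDegree_eq_zero h1, hpz, map_zero]
  · have h1 : (specHom f val z₀ p).natDegree ≠ 0 := fun h0 => hdz (by
      rw [Polynomial.eq_C_of_natDegree_eq_zero h0, Polynomial.derivative_C])
    have h2 := Polynomial.natDegree_derivative_lt h1
    rw [hpn] at h2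
    refine Nat.find_min hex h2 ⟨pderiv z₀ p, Eqns.pderiv_mem_supported _ hp, ?_, ?_, ?_⟩
    · rw [← derivative_specHom]; exact hdz
    · rw [← derivative_specHom]; exact hd
    · rw [← derivative_specHom]

end Separable

/-! ### Evaluating the universal ring; the jet formula -/

namespace Eqns

open MvPolynomial

section Evaluation

variable {ι Θ : Type} {fr : Frame ι Θ} {ld : Leaders fr} {F : Type w} [CommRing F] {I : Type}
  (E : Eqns ld F I) {N : Type x} [Field N] (f : F →+* N) (val : (I × List ι) ⊕ ld.Vars → N)

/-- Evaluation of the universal ring, inverting the separants. -/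
noncomputable def evU : E.U →+* N :=
  eval₂Hom f (Sum.elim val (fun π => ((E.sep π).eval₂ f val)⁻¹))

theorem evU_C (c : F) : E.evU f val (C c) = f c := by simp [evU]

theorem evU_inl (z : (I × List ι) ⊕ ld.Vars) : E.evU f val (X (Sum.inl z)) = val z := by
  simp [evU]

theorem evU_inr (π : ld.P) : E.evU f val (X (Sum.inr π)) = ((E.sep π).eval₂ f val)⁻¹ := by
  simp [evU]

theorem evU_rename (q : MvPolynomial ((I × List ι) ⊕ ld.Vars) F) :
    E.evU f val (rename Sum.inl q) = q.eval₂ f val := by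
  rw [evU, coe_eval₂Hom, eval₂_rename, Sum.elim_comp_inl]

theorem isDerEval_evU {b : I × List ι → N} {e : Θ → N} {D : ι → Derivation ℤ N N}
    (hC : ∀ i c, D i (f c) = f (E.d i c)) (hb : ∀ i z γ, D i (b (z, γ)) = b (z, i :: γ))
    (he : ∀ i μ, D i (e μ) = e (fr.s i μ))
    (hp : ∀ π, (E.p π).eval₂ f (Sum.elim b (fun μ : ld.Vars => e μ)) = 0)
    (hs : ∀ π, (E.sep π).eval₂ f (Sum.elim b (fun μ : ld.Vars => e μ)) ≠ 0) :
    E.IsDerEval (E.evU f (Sum.elim b (fun μ : ld.Vars => e μ))) D e where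
  hC i c := by rw [evU_C, evU_C, hC]
  hj i z γ := by rw [evU_inl, evU_inl]; exact hb i z γ
  hx μ := by rw [evU_inl]; rfl
  he := he
  hp π := by rw [pU, evU_rename, hp]
  hs π := by rw [sU, evU_rename, evU_inr, mul_inv_cancel₀ (hs π)]

end Evaluation

section JetFormula

theorem realize_formula_iInf {L : FirstOrder.Language.{u, v}} {M : Type x} [L.Structure M]
    {κ : Type w} {σ : Type y} [Finite κ] (ψ : κ → L.Formula σ) (a : σ → M) :
    Formula.Realize (BoundedFormula.iInf ψ) a ↔ ∀ i, (ψ i).Realize a := by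
  rw [Formula.Realize, BoundedFormula.realize_iInf]
  rfl

variable {L : FirstOrder.Language.{u, v}} {ρ : FirstOrder.Language.ring →ᴸ L} {K : Type w} [Field K]
    [FirstOrder.Ring.CompatibleRing K] [L.Structure K] [ρ.IsExpansionOn K]
    {ι Θ : Type} {fr : Frame ι Θ} {ld : Leaders fr} {I : Type} (E : Eqns ld (dclEmpty ρ K) I)

/-- The formula saying that the equations `p π = 0`, `∂p π ≠ 0` and `q = 0` hold and that
the values of `Q` satisfy `β`. -/
noncomputable def jetFormula (qs : Finset (MvPolynomial ((I × List ι) ⊕ ld.Vars) (dclEmpty ρ K)))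
    {Y : Type} (β : L.Formula Y) (Q : Y → E.U) : L.Formula ((I × List ι) ⊕ ld.Vars) :=
  (BoundedFormula.iInf (fun π : ld.P => polyZero (E.p π)) ⊓
    BoundedFormula.iInf (fun π : ld.P => (polyZero (E.sep π)).not)) ⊓
  (BoundedFormula.iInf (fun q : qs => polyZero q.1) ⊓
    Formula.iExs ld.P
      (BoundedFormula.iInf (fun π : ld.P => polyZero (E.sU π * X (ld.it I π) - 1)) ⊓
        substPoly β Q))

theorem realize_jetFormula {M : Type x} [Field M] [FirstOrder.Ring.CompatibleRing M]
    [L.Structure M] [ρ.IsExpansionOn M] (hM : M ⊨ L.completeTheory K)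
    (qs : Finset (MvPolynomial ((I × List ι) ⊕ ld.Vars) (dclEmpty ρ K)))
    {Y : Type} (β : L.Formula Y) (Q : Y → E.U) (val : (I × List ι) ⊕ ld.Vars → M) :
    (E.jetFormula qs β Q).Realize val ↔
      (∀ π, (E.p π).eval₂ (dclHom hM) val = 0 ∧ (E.sep π).eval₂ (dclHom hM) val ≠ 0) ∧
      (∀ q ∈ qs, q.eval₂ (dclHom hM) val = 0) ∧
      β.Realize (fun y => E.evU (dclHom hM) val (Q y)) := by
  rw [jetFormula, Formula.realize_inf, Formula.realize_inf, Formula.realize_inf,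
    Formula.realize_iExs]
  simp only [Formula.realize_inf]
  simp only [Formula.realize_not, realize_polyZero hM, realize_formula_iInf, realize_substPoly hM,
    Subtype.forall (p := (· ∈ qs))]
  constructor
  · rintro ⟨⟨h1, h2⟩, h3, t, h4, h5⟩
    refine ⟨fun π => ⟨h1 π, h2 π⟩, h3, ?_⟩
    have ht : t = fun π => ((E.sep π).eval₂ (dclHom hM) val)⁻¹ := by
      funext π
      have h6 := h4 π
      rw [← coe_eval₂Hom, map_sub, map_mul, map_one, coe_eval₂Hom, sU, eval₂_rename,
        Sum.elim_comp_inl, eval₂_X, Sum.elim_inr, sub_eq_zero] at h6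
      exact eq_inv_of_mul_eq_one_right h6
    rw [ht] at h5
    exact h5
  · rintro ⟨h1, h3, h5⟩
    refine ⟨⟨fun π => (h1 π).1, fun π => (h1 π).2⟩, h3,
      fun π => ((E.sep π).eval₂ (dclHom hM) val)⁻¹, fun π => ?_, h5⟩
    rw [← coe_eval₂Hom, map_sub, map_mul, map_one, coe_eval₂Hom, sU, eval₂_rename,
        Sum.elim_comp_inl, eval₂_X, Sum.elim_inr, mul_inv_cancel₀ (h1 π).2, sub_self]

end JetFormula

end Eqns

/-! ### Equations for the leaders and conditions for generic solutions -/

section Large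

open MvPolynomial

variable {L : FirstOrder.Language.{u, v}} {ρ : FirstOrder.Language.ring →ᴸ L} {K : Type w} [Field K]
    [FirstOrder.Ring.CompatibleRing K] [L.Structure K] [ρ.IsExpansionOn K]
    {ι Θ : Type} {fr : Frame ι Θ} (ld : Leaders fr) {I : Type}

/-- Leaders algebraic over the preceding elements are given by equations. -/
theorem exists_eqns {M : Type x} [Field M] [CharZero M] [FirstOrder.Ring.CompatibleRing M]
    [L.Structure M] [ρ.IsExpansionOn M] (hM : M ⊨ L.completeTheory K)
    (η : ι → Derivation ℤ (dclEmpty ρ K) (dclEmpty ρ K)) (b : I × List ι → M) (e : Θ → M)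
    (hL : ∀ α, ld.Lead α → AlgLead hM ρ fr (Set.range b) e α) :
    ∃ E : Eqns ld (dclEmpty ρ K) I, E.d = η ∧
      ∀ π, (E.p π).eval₂ (dclHom hM) (Sum.elim b (fun μ : ld.Vars => e μ)) = 0 ∧
        (E.sep π).eval₂ (dclHom hM) (Sum.elim b (fun μ : ld.Vars => e μ)) ≠ 0 := by
  have := fr.wo
  have h : ∀ π : ld.P, ∃ p ∈ supported (dclEmpty ρ K) (ld.allowed I π),
      p.eval₂ (dclHom hM) (Sum.elim b (fun μ : ld.Vars => e μ)) = 0 ∧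
        (pderiv (Sum.inr (ld.ofP π)) p).eval₂ (dclHom hM)
          (Sum.elim b (fun μ : ld.Vars => e μ)) ≠ 0 := by
    intro π
    obtain ⟨p, h1, h2⟩ := exists_separable_polynomial (dclHom (ρ := ρ) hM)
      (Sum.elim b (fun μ : ld.Vars => e μ)) (Sum.inr (ld.ofP π))
      {z | ∀ μ, z = Sum.inr μ → ¬ ld.Lead μ ∧ fr.lt μ π}
      (fun h => (h _ rfl).1 (ld.P_lead _ π.2)) (by
        refine isAlgebraic_of_subfield_le (Subfield.closure_mono (Set.union_subset_union_right _ ?_))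
          (isAlgebraic_over_free hL π (ld.P_lead _ π.2))
        rintro _ (⟨z, rfl⟩ | ⟨ν, hν, rfl⟩)
        · exact ⟨Sum.inl z, fun μ hμ => by simp at hμ, rfl⟩
        · refine ⟨Sum.inr ⟨ν, Or.inl hν.1⟩, fun μ hμ => ?_, rfl⟩
          rw [← Sum.inr.inj hμ]
          exact hν)
    refine ⟨p, supported_mono ?_ h1, h2⟩
    rintro z (rfl | hz) μ hμ
    · exact Or.inl (Sum.inr.inj hμ).symm
    · exact Or.inr (hz μ hμ)
  choose p hp hp' using h
  exact ⟨⟨η, p, hp⟩, rfl, hp'⟩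

/-- A condition on the jets of the parameters under which the jet formula has generic solutions. -/
theorem exists_large_jetFormula [CharZero K] (hK : AlgBounded L (dclEmpty ρ K)) {M : Type x}
    [Field M] [FirstOrder.Ring.CompatibleRing M] [L.Structure M] [ρ.IsExpansionOn M]
    (hM : M ⊨ L.completeTheory K) (b : I × List ι → M) (e : Θ → M) (J : Set ld.Vars)
    (hJ : ∀ μ ∈ J, ¬ AlgLead hM ρ fr (Set.range b) e μ) (Φ : L.Formula ((I × List ι) ⊕ ld.Vars))
    (hΦ : Φ.Realize (Sum.elim b (fun μ : ld.Vars => e μ))) :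
    ∃ χ : L.Formula (I × List ι), χ.Realize b ∧
      ∀ (N : Type x) [Field N] [FirstOrder.Ring.CompatibleRing N] [L.Structure N]
        [ρ.IsExpansionOn N] (_ : N ⊨ L.completeTheory K) (b' : I × List ι → N), χ.Realize b' →
        ∀ g : MvPolynomial J N, g ≠ 0 →
          ∃ z : ld.Vars → N, Φ.Realize (Sum.elim b' z) ∧ eval (fun μ : J => z μ) g ≠ 0 := by
  have := fr.wo
  have hto : IsStrictTotalOrder ld.Vars (fun μ ν => fr.lt μ ν) :=
    inferInstanceAs (IsStrictTotalOrder _ (Subrel fr.lt _))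
  obtain ⟨χ, h1, h2⟩ := exists_large_formula.{u, v, w, x, 0} (ρ := ρ) hK Φ J
    (fun μ ν : ld.Vars => fr.lt μ ν)
  refine ⟨χ, h1 M hM b _ hΦ fun μ hμ h => hJ μ hμ ?_, fun N _ _ _ _ hN b' hb' => h2 N hN b' hb'⟩
  refine isAlgebraic_of_subfield_le (genField_mono hM (Set.union_subset_union_right _ ?_)) h
  rintro _ ⟨ν, hν, rfl⟩
  exact ⟨ν, hν.2, rfl⟩

/-- Generic solutions of a formula, in an elementary extension. -/
theorem exists_generic_solution {N : Type (max u v)} [Field N] [FirstOrder.Ring.CompatibleRing N]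
    [L.Structure N] [ρ.IsExpansionOn N] [CharZero K] (hK : AlgBounded L (dclEmpty ρ K))
    (hN : N ⊨ L.completeTheory K) {V : Type}
    (φ : L.Formula (V ⊕ N)) (J : Set V)
    (H : ∀ g : MvPolynomial J N, g ≠ 0 → ∃ z : V → N, φ.Realize (Sum.elim z id) ∧
      MvPolynomial.eval (fun μ : J => z μ) g ≠ 0) :
    ∃ (N' : Type (max u v)) (_ : Field N') (_ : FirstOrder.Ring.CompatibleRing N')
      (_ : L.Structure N') (_ : ρ.IsExpansionOn N') (_ : N' ⊨ L.completeTheory K)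
      (j : N ↪ₑ[L] N') (a : V → N'), φ.Realize (Sum.elim a j) ∧
        AclIndep L (Set.range j) (fun μ : J => a μ) ∧
        ∀ g : MvPolynomial J N, g ≠ 0 →
          g.eval₂ (elementaryRingHom ρ j) (fun μ : J => a μ) ≠ 0 := by
  obtain ⟨N', h1, h2, h3, h4, hN', j, a, h5, h6⟩ := exists_generic_extension (ρ := ρ) hN φ J H
  exact ⟨N', h1, h2, h3, h4, hN', j, a, h5,
    aclIndep_of_algebraicIndependent hK hN hN' j _ h6, h6⟩

end Large

/-! ### Passing between a class of differential fields and its theory -/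

section ClassTheory

set_option linter.unusedSectionVars false

variable {L : FirstOrder.Language.{u, v}} {ρ : FirstOrder.Language.ring →ᴸ L} {K : Type w} [Field K]
    [FirstOrder.Ring.CompatibleRing K] [L.Structure K] [ρ.IsExpansionOn K] {k : ℕ}

/-- The theory of a class of fields with derivations. -/
def classTheory (C : ∀ (M : Type (max u v)) [Field M] [FirstOrder.Ring.CompatibleRing M]
    [L.Structure M] [ρ.IsExpansionOn M], (Fin k → Derivation ℤ M M) → Prop) :
    (withDer L (Fin k)).Theory :=
  {σ | ∀ (M : Type (max u v)) [Field M] [FirstOrder.Ring.CompatibleRing M] [L.Structure M]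
      [ρ.IsExpansionOn M] (δ : Fin k → Derivation ℤ M M), C M δ →
        letI : (derLang (Fin k)).Structure M := derStructure (fun i => δ i)
        M ⊨ σ}

variable {C : ∀ (M : Type (max u v)) [Field M] [FirstOrder.Ring.CompatibleRing M]
    [L.Structure M] [ρ.IsExpansionOn M], (Fin k → Derivation ℤ M M) → Prop}
  {M : Type (max u v)} [Nonempty M] [L.Structure M] [(derLang (Fin k)).Structure M]

/-- A model of the theory need not belong to the class, but the universal closure of a formula valid
throughout the class is one of the axioms. -/
theorem realize_of_class (hM : M ⊨ classTheory C) {I : Type} [Finite I]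
    (φ : (withDer L (Fin k)).Formula I)
    (h : ∀ (N : Type (max u v)) [Field N] [FirstOrder.Ring.CompatibleRing N] [L.Structure N]
      [ρ.IsExpansionOn N] (δ : Fin k → Derivation ℤ N N), C N δ →
      letI : (derLang (Fin k)).Structure N := derStructure (fun i => δ i)
      ∀ b : I → N, φ.Realize b) (a : I → M) : φ.Realize a := by
  have hM' := hM.realize_of_mem (Formula.iAlls I (φ.relabel Sum.inr)) (by
    intro N _ _ _ _ δ hN
    let _ : (derLang (Fin k)).Structure N := derStructure (fun i => δ i)
    rw [Sentence.Realize, Formula.realize_iAlls]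
    intro b
    rw [Formula.realize_relabel]
    exact h N δ hN b)
  rw [Sentence.Realize, Formula.realize_iAlls] at hM'
  have := hM' a
  rwa [Formula.realize_relabel] at this

theorem realize_jet_of_class (hM : M ⊨ classTheory C) {I : Type} [Finite I]
    (β : L.Formula (I × List (Fin k)))
    (h : ∀ (N : Type (max u v)) [Field N] [FirstOrder.Ring.CompatibleRing N] [L.Structure N]
      [ρ.IsExpansionOn N] (δ : Fin k → Derivation ℤ N N), C N δ →
      ∀ b : I → N, β.Realize (jetGen (fun i => δ i) b)) (a : I → M) :
    β.Realize (jetGen (derMap (ι := Fin k) M) a) := by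
  rw [← realize_substJetGen]
  refine realize_of_class hM _ (fun N _ _ _ _ δ hN b => ?_) a
  let _ : (derLang (Fin k)).Structure N := derStructure (fun i => δ i)
  rw [realize_substJetGen]
  exact h N δ hN b

theorem exists_jet_of_class (hM : M ⊨ classTheory C) {I : Type} [Finite I]
    (χ : L.Formula (I × List (Fin k))) (β : L.Formula (Option I × List (Fin k)))
    (h : ∀ (N : Type (max u v)) [Field N] [FirstOrder.Ring.CompatibleRing N] [L.Structure N]
      [ρ.IsExpansionOn N] (δ : Fin k → Derivation ℤ N N), C N δ →
      ∀ b : I → N, χ.Realize (jetGen (fun i => δ i) b) →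
        ∃ d : N, β.Realize (jetGen (fun i => δ i) (fun o : Option I => o.elim d b)))
    (a : I → M) (ha : χ.Realize (jetGen (derMap (ι := Fin k) M) a)) :
    ∃ d : M, β.Realize (jetGen (derMap (ι := Fin k) M) (fun o : Option I => o.elim d a)) := by
  have hE : ∀ (N : Type (max u v)) [L.Structure N] [(derLang (Fin k)).Structure N] (b : I → N),
      Formula.Realize (Formula.iExs Unit ((substJetGen β).relabel
        (fun o : Option I => (o.elim (Sum.inr ()) Sum.inl : I ⊕ Unit)))) b ↔
        ∃ d : N, β.Realize (jetGen (derMap (ι := Fin k) N) (fun o : Option I => o.elim d b)) := by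
    intro N _ _ b
    rw [Formula.realize_iExs]
    have : ∀ d : Unit → N, (Sum.elim b d ∘ fun o : Option I => o.elim (Sum.inr ()) Sum.inl) =
        fun o : Option I => o.elim (d ()) b := by
      intro d; funext o; cases o <;> rfl
    simp only [Formula.realize_relabel, realize_substJetGen, this]
    exact ⟨fun ⟨d, hd⟩ => ⟨d (), hd⟩, fun ⟨d, hd⟩ => ⟨fun _ => d, hd⟩⟩
  have h1 := realize_of_class hM ((substJetGen χ).imp (Formula.iExs Unit ((substJetGen β).relabel
    (fun o : Option I => (o.elim (Sum.inr ()) Sum.inl : I ⊕ Unit)))))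
    (fun N _ _ _ _ δ hN b => by
      let _ : (derLang (Fin k)).Structure N := derStructure (fun i => δ i)
      rw [Formula.realize_imp, realize_substJetGen, hE]
      exact h N δ hN b) a
  rw [Formula.realize_imp, realize_substJetGen, hE] at h1
  exact h1 ha

theorem completeTheory_of_class
    (hC : ∀ (N : Type (max u v)) [Field N] [FirstOrder.Ring.CompatibleRing N] [L.Structure N]
      [ρ.IsExpansionOn N] (δ : Fin k → Derivation ℤ N N), C N δ → N ⊨ L.completeTheory K)
    (hM : M ⊨ classTheory C) : M ⊨ L.completeTheory K := by
  refine ⟨fun σ hσ => ?_⟩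
  have h := realize_jet_of_class hM (I := Empty) (Formula.relabel Empty.elim σ)
    (fun N _ _ _ _ δ hN b => by
      rw [Formula.realize_relabel]
      have h1 := (hC N δ hN).realize_of_mem σ hσ
      rw [Sentence.Realize] at h1
      convert h1) Empty.elim
  rw [Formula.realize_relabel] at h
  rw [Sentence.Realize]
  convert h

/-- Additivity, the Leibniz rule and compatibility with η are universal statements in jets, so they
pass from the class to every model of its theory. The axiom scheme itself is not transferred, and is
not needed for the model from which χ is extracted. -/
theorem exists_derivations {η : Fin k → Derivation ℤ (dclEmpty ρ K) (dclEmpty ρ K)}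
    (hC : ∀ (N : Type (max u v)) [Field N] [FirstOrder.Ring.CompatibleRing N] [L.Structure N]
      [ρ.IsExpansionOn N] (δ : Fin k → Derivation ℤ N N), C N δ → IsDerModel ρ K η N δ)
    (hM : M ⊨ classTheory C) : ∃ (_ : Field M) (_ : FirstOrder.Ring.CompatibleRing M)
      (_ : ρ.IsExpansionOn M) (δ : Fin k → Derivation ℤ M M),
      (derMap (ι := Fin k) M = fun i => ⇑(δ i)) ∧ IsDerModel ρ K η M δ := by
  have hT : M ⊨ L.completeTheory K := completeTheory_of_class (fun N _ _ _ _ δ hN => (hC N δ hN).1) hM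
  obtain ⟨hf, hr, he⟩ := exists_field_structure (ρ := ρ) hT
  have hadd : ∀ (i : Fin k) (y z : M), derMap M i (y + z) = derMap M i y + derMap M i z := by
    intro i y z
    have h := realize_jet_of_class hM (I := Fin 3)
      ((Term.equal (Term.var (2, [])) (ρ.onTerm (Term.var (0, []) + Term.var (1, []) :
        FirstOrder.Language.ring.Term _))).imp
        (Term.equal (Term.var (2, [i])) (ρ.onTerm (Term.var (0, [i]) + Term.var (1, [i]) :
        FirstOrder.Language.ring.Term _)))) (fun N _ _ _ _ δ hN b => by
      simp only [Formula.realize_imp, Formula.realize_equal, realize_ringTerm,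
        FirstOrder.Ring.realize_add, Term.realize_var]
      intro h
      change δ i (b 2) = δ i (b 0) + δ i (b 1)
      rw [show b 2 = b 0 + b 1 from h, map_add]) ![y, z, y + z]
    simp only [Formula.realize_imp, Formula.realize_equal, realize_ringTerm,
        FirstOrder.Ring.realize_add, Term.realize_var] at h
    exact h rfl
  have hmul : ∀ (i : Fin k) (y z : M), derMap M i (y * z) = y * derMap M i z + z * derMap M i y := by
    intro i y z
    have h := realize_jet_of_class hM (I := Fin 3)
      ((Term.equal (Term.var (2, [])) (ρ.onTerm (Term.var (0, []) * Term.var (1, []) :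
        FirstOrder.Language.ring.Term _))).imp
        (Term.equal (Term.var (2, [i])) (ρ.onTerm (Term.var (0, []) * Term.var (1, [i]) +
          Term.var (1, []) * Term.var (0, [i]) :
        FirstOrder.Language.ring.Term _)))) (fun N _ _ _ _ δ hN b => by
      simp only [Formula.realize_imp, Formula.realize_equal, realize_ringTerm,
        FirstOrder.Ring.realize_add, FirstOrder.Ring.realize_mul, Term.realize_var]
      intro h
      change δ i (b 2) = b 0 * δ i (b 1) + b 1 * δ i (b 0)
      rw [show b 2 = b 0 * b 1 from h, Derivation.leibniz]
      rfl) ![y, z, y * z]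
    simp only [Formula.realize_imp, Formula.realize_equal, realize_ringTerm,
        FirstOrder.Ring.realize_add, FirstOrder.Ring.realize_mul, Term.realize_var] at h
    exact h rfl
  refine ⟨hf, hr, he, fun i => Derivation.mk'
    (AddMonoidHom.mk' (derMap M i) (hadd i)).toIntLinearMap (hmul i), rfl, hT, ?_⟩
  intro i c ψ χ hψ hχ y hy
  have h := realize_jet_of_class hM (I := Unit)
    ((Formula.relabel (fun _ => ((), [])) ψ).imp (Formula.relabel (fun _ => ((), [i])) χ))
    (fun N _ _ _ _ δ hN b => by
      simp only [Formula.realize_imp, Formula.realize_relabel]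
      exact (hC N δ hN).2 i c ψ χ hψ hχ (b ())) (fun _ => y)
  simp only [Formula.realize_imp, Formula.realize_relabel] at h
  exact h hy

theorem derMap_comm_of_class
    (hC : ∀ (N : Type (max u v)) [Field N] [FirstOrder.Ring.CompatibleRing N] [L.Structure N]
      [ρ.IsExpansionOn N] (δ : Fin k → Derivation ℤ N N), C N δ →
        ∀ i i' y, δ i (δ i' y) = δ i' (δ i y))
    (hM : M ⊨ classTheory C) (i i' : Fin k) (y : M) :
    derMap M i (derMap M i' y) = derMap M i' (derMap M i y) := by
  have h := realize_jet_of_class hM (I := Unit)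
    (Term.equal (Term.var ((), [i, i'])) (Term.var ((), [i', i])))
    (fun N _ _ _ _ δ hN b => by
      rw [Formula.realize_equal]
      exact hC N δ hN i i' (b ())) (fun _ => y)
  rw [Formula.realize_equal] at h
  exact h

theorem IsDerModel.extendsDer {η : Fin k → Derivation ℤ (dclEmpty ρ K) (dclEmpty ρ K)}
    {M : Type x} [Field M] [FirstOrder.Ring.CompatibleRing M] [L.Structure M] [ρ.IsExpansionOn M]
    {δ : Fin k → Derivation ℤ M M} (h : IsDerModel ρ K η M δ) : ExtendsDer h.1 η δ := by
  intro i c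
  have h1 := h.2 i c _ _ (definesPoint_defFormula ρ K c) (definesPoint_defFormula ρ K (η i c))
    (dclHom h.1 c) ((realize_defFormula h.1 c _).2 rfl)
  exact (realize_defFormula h.1 (η i c) _).1 h1

/-- The theory of a class has jet-definable projections, if this holds locally. -/
theorem jetExists_classTheory {η : Fin k → Derivation ℤ (dclEmpty ρ K) (dclEmpty ρ K)}
    (comm : Prop)
    (hC : ∀ (N : Type (max u v)) [Field N] [FirstOrder.Ring.CompatibleRing N] [L.Structure N]
      [ρ.IsExpansionOn N] (δ : Fin k → Derivation ℤ N N), C N δ → IsDerModel ρ K η N δ ∧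
        (comm → ∀ i i' y, δ i (δ i' y) = δ i' (δ i y)))
    (H : ∀ (I : Type) [Finite I] (β : L.Formula (Option I × List (Fin k)))
      (M : Type (max u v)) [Field M] [FirstOrder.Ring.CompatibleRing M] [L.Structure M]
      [ρ.IsExpansionOn M] (δ : Fin k → Derivation ℤ M M), IsDerModel ρ K η M δ →
      (comm → ∀ i i' y, δ i (δ i' y) = δ i' (δ i y)) →
      ∀ (a : I → M) (c : M),
        β.Realize (jetGen (fun i => δ i) (fun o : Option I => o.elim c a)) →
        ∃ χ : L.Formula (I × List (Fin k)), χ.Realize (jetGen (fun i => δ i) a) ∧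
          ∀ (N : Type (max u v)) [Field N] [FirstOrder.Ring.CompatibleRing N] [L.Structure N]
            [ρ.IsExpansionOn N] (δ : Fin k → Derivation ℤ N N), C N δ →
            ∀ b : I → N, χ.Realize (jetGen (fun i => δ i) b) →
              ∃ d : N, β.Realize (jetGen (fun i => δ i) (fun o : Option I => o.elim d b))) :
    JetExists (classTheory C) := by
  refine jetExists_of_local fun I _ β M _ _ _ hM a c hc => ?_
  obtain ⟨hf, hr, he, δ, hδ, hder⟩ :=
    exists_derivations (fun N _ _ _ _ δ hN => (hC N δ hN).1) hM
  have hcom : comm → ∀ i i' y, δ i (δ i' y) = δ i' (δ i y) := fun hc i i' y => by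
    have := derMap_comm_of_class (fun N _ _ _ _ δ hN => (hC N δ hN).2 hc) hM i i' y
    rwa [hδ] at this
  rw [hδ] at hc
  obtain ⟨χ, h1, h2⟩ := H I β M δ hder hcom a c hc
  refine ⟨χ, by rwa [hδ], fun N _ _ _ hN b hb => exists_jet_of_class hN χ β h2 b hb⟩

theorem completeTheory_models_classTheory
    (hC : ∀ (N : Type (max u v)) [Field N] [FirstOrder.Ring.CompatibleRing N] [L.Structure N]
      [ρ.IsExpansionOn N] (δ : Fin k → Derivation ℤ N N), C N δ → N ⊨ L.completeTheory K)
    (σ : L.Sentence) (hσ : σ ∈ L.completeTheory K) :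
    classTheory C ⊨ᵇ (LHom.sumInl : L →ᴸ withDer L (Fin k)).onSentence σ := by
  refine Theory.models_sentence_of_mem ?_
  intro N _ _ _ _ δ hN
  let _ : (derLang (Fin k)).Structure N := derStructure (fun i => δ i)
  rw [LHom.realize_onSentence]
  exact (hC N δ hN).realize_of_mem σ hσ

end ClassTheory

theorem ncGenericTheory_eq {L : FirstOrder.Language.{u, v}} (ρ : FirstOrder.Language.ring →ᴸ L)
    (K : Type w) [Field K] [FirstOrder.Ring.CompatibleRing K] [L.Structure K] [ρ.IsExpansionOn K]
    {k : ℕ} (η : Fin k → Derivation ℤ (dclEmpty ρ K) (dclEmpty ρ K)) :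
    ncGenericTheory ρ K η = classTheory (ρ := ρ) (fun M _ _ _ _ δ =>
      IsDerModel ρ K η M δ ∧ NcDeep L (fun i => δ i)) := by
  ext σ
  exact ⟨fun h M _ _ _ _ δ hδ => h M δ hδ.1 hδ.2, fun h M _ _ _ _ δ h1 h2 => h M δ ⟨h1, h2⟩⟩

theorem commGenericTheory_eq {L : FirstOrder.Language.{u, v}} (ρ : FirstOrder.Language.ring →ᴸ L)
    (K : Type w) [Field K] [FirstOrder.Ring.CompatibleRing K] [L.Structure K] [ρ.IsExpansionOn K]
    {k : ℕ} (η : Fin k → Derivation ℤ (dclEmpty ρ K) (dclEmpty ρ K)) :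
    commGenericTheory ρ K η = classTheory (ρ := ρ) (fun M _ _ _ _ δ =>
      IsDerModel ρ K η M δ ∧ (∀ i i' y, δ i (δ i' y) = δ i' (δ i y)) ∧ KDeep ρ δ) := by
  ext σ
  exact ⟨fun h M _ _ _ _ δ hδ => h M δ hδ.1 hδ.2.1 hδ.2.2,
    fun h M _ _ _ _ δ h1 h2 h3 => h M δ ⟨h1, h2, h3⟩⟩

theorem eval₂_congr_supported {F : Type w} [CommRing F] {N : Type x} [CommRing N] {σ : Type*}
    (f : F →+* N) {g g' : σ → N} {S : Set σ} {q : MvPolynomial σ F}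
    (hq : q ∈ MvPolynomial.supported F S) (h : ∀ z ∈ S, g z = g' z) :
    q.eval₂ f g = q.eval₂ f g' :=
  MvPolynomial.eval₂Hom_congr' rfl
    (fun z hz _ => h z (MvPolynomial.mem_supported.1 hq (Finset.mem_coe.2 hz))) rfl

namespace Eqns

open MvPolynomial

section JetPoly

variable {ι Θ : Type} {fr : Frame ι Θ} {ld : Leaders fr} {F : Type w} [CommRing F] {I : Type}
  (E : Eqns ld F I)

/-- The polynomials that represent the jets of the parameters and of an additional element. -/
noncomputable def jetPoly (cls : List ι → Θ) : Option I × List ι → E.U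
  | (some z, γ) => X (ld.ij I (z, γ))
  | (none, γ) => E.G (cls γ)

variable {N : Type x} [Field N] (f : F →+* N)

theorem ev_jetPoly {D : ι → Derivation ℤ N N} {e : Θ → N} {a : I → N} {c : N}
    (h : E.IsDerEval (E.evU f (Sum.elim (jetGen (fun i => D i) a) (fun μ : ld.Vars => e μ))) D e)
    {cls : List ι → Θ} (hcls : ∀ γ, e (cls γ) = applyWord (fun i => D i) γ c)
    (y : Option I × List ι) :
    E.evU f (Sum.elim (jetGen (fun i => D i) a) (fun μ : ld.Vars => e μ)) (E.jetPoly cls y) =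
      jetGen (fun i => D i) (fun o : Option I => o.elim c a) y := by
  obtain ⟨_ | z, γ⟩ := y
  · rw [jetPoly, h.ev_G, hcls]
    rfl
  · rw [jetPoly, evU_inl]
    rfl

end JetPoly

section Realize

variable {L : FirstOrder.Language.{u, v}} {ρ : FirstOrder.Language.ring →ᴸ L} {K : Type w} [Field K]
    [FirstOrder.Ring.CompatibleRing K] [L.Structure K] [ρ.IsExpansionOn K]
    {ι Θ : Type} {fr : Frame ι Θ} {ld : Leaders fr} {I : Type} (E : Eqns ld (dclEmpty ρ K) I)
    {M : Type x} [Field M] [FirstOrder.Ring.CompatibleRing M]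
    [L.Structure M] [ρ.IsExpansionOn M] {hM : M ⊨ L.completeTheory K}

theorem isDerEval_of_extendsDer {D : ι → Derivation ℤ M M}
    (hD : ExtendsDer hM E.d D) {e : Θ → M} (he : ∀ i μ, D i (e μ) = e (fr.s i μ)) {a : I → M}
    (h : ∀ π, (E.p π).eval₂ (dclHom hM)
        (Sum.elim (jetGen (fun i => D i) a) (fun μ : ld.Vars => e μ)) = 0 ∧
      (E.sep π).eval₂ (dclHom hM)
        (Sum.elim (jetGen (fun i => D i) a) (fun μ : ld.Vars => e μ)) ≠ 0) :
    E.IsDerEval (E.evU (dclHom hM)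
      (Sum.elim (jetGen (fun i => D i) a) (fun μ : ld.Vars => e μ))) D e :=
  E.isDerEval_evU (dclHom hM) hD (fun _ _ _ => rfl) he (fun π => (h π).1) (fun π => (h π).2)

/-- The jet formula holds for the values of `e`, a solution of the differential equations. -/
theorem realize_jetFormula_jet {D : ι → Derivation ℤ M M}
    (hD : ExtendsDer hM E.d D) {e : Θ → M} (he : ∀ i μ, D i (e μ) = e (fr.s i μ)) (a : I → M) {c : M}
    {cls : List ι → Θ} (hcls : ∀ γ, e (cls γ) = applyWord (fun i => D i) γ c)
    (qs : Finset (MvPolynomial ((I × List ι) ⊕ ld.Vars) (dclEmpty ρ K)))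
    {Y : Type} (β : L.Formula Y) (y : Y → Option I × List ι) :
    (E.jetFormula qs β (fun z => E.jetPoly cls (y z))).Realize
        (Sum.elim (jetGen (fun i => D i) a) (fun μ : ld.Vars => e μ)) ↔
      (∀ π, (E.p π).eval₂ (dclHom hM)
        (Sum.elim (jetGen (fun i => D i) a) (fun μ : ld.Vars => e μ)) = 0 ∧
        (E.sep π).eval₂ (dclHom hM)
          (Sum.elim (jetGen (fun i => D i) a) (fun μ : ld.Vars => e μ)) ≠ 0) ∧
      (∀ q ∈ qs, q.eval₂ (dclHom hM)
        (Sum.elim (jetGen (fun i => D i) a) (fun μ : ld.Vars => e μ)) = 0) ∧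
      β.Realize (fun z => jetGen (fun i => D i) (fun o : Option I => o.elim c a) (y z)) := by
  rw [E.realize_jetFormula hM]
  refine and_congr_right fun h => and_congr_right fun _ => ?_
  simp only [E.ev_jetPoly _ (E.isDerEval_of_extendsDer hD he h) hcls]

end Realize

end Eqns

/-! ### Non-commuting derivations -/

section NonCommuting

/-- The words in `k` letters, with the length-lexicographic order. -/
def wordFrame (k : ℕ) : Frame (Fin k) (List (Fin k)) where
  lt := List.Shortlex (· < ·)
  wo :=
    { trichotomous := (List.Shortlex.trichotomous (r := fun i j : Fin k => i < j)).trichotomous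
      wf := List.Shortlex.wf wellFounded_lt }
  s := List.cons
  s_mono := fun _ _ _ h => List.shortlex_cons_iff.2 h
  lt_s := fun _ _ => List.Shortlex.of_length_lt (Nat.lt_succ_self _)

theorem length_le_of_wordFrame {k : ℕ} {γ γ' : List (Fin k)}
    (h : (wordFrame k).lt γ γ' ∨ γ = γ') : γ.length ≤ γ'.length := by
  rcases h with h | rfl
  · rcases List.shortlex_def.1 h with h | h
    · exact h.le
    · exact h.1.le
  · exact le_rfl

open Classical in
/-- The leaders generated by the words of length at most `m` in `S`, for `S` closed under
derivations. -/
noncomputable def wordLeaders {k : ℕ} (S : Set (List (Fin k))) (m : ℕ) : Leaders (wordFrame k) where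
  Lead := fun α => ∃ π ∈ S, π.length ≤ m ∧ π <:+ α
  P := (List.finite_length_le (Fin k) m).toFinset.filter
    (fun π => π ∈ S ∧ ∀ π' ∈ S, π' <:+ π → π' = π)
  P_lead := fun π hπ => by
    simp only [Finset.mem_filter, Set.Finite.mem_toFinset] at hπ
    exact ⟨π, hπ.2.1, hπ.1, List.suffix_rfl⟩
  lead_cases := fun α ⟨π, h1, h2, h3⟩ => by
    simp only [Finset.mem_filter, Set.Finite.mem_toFinset]
    -- Either α has no proper suffix in S, and then it is minimal; or a proper suffix of length at
    -- most m exists, which persists after deleting the first letter of α.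
    by_cases h : ∀ π' ∈ S, π' <:+ α → π' = α
    · have h4 := h π h1 h3
      subst h4
      exact Or.inl ⟨h2, h1, h⟩
    · push Not at h
      right
      obtain ⟨π', h5, h6, h7⟩ : ∃ π' ∈ S, (π' <:+ α ∧ π' ≠ α) ∧ π'.length ≤ m := by
        obtain ⟨π', h5, h6, h7⟩ := h
        rcases le_or_gt π'.length m with h8 | h8
        · exact ⟨π', h5, ⟨h6, h7⟩, h8⟩
        · refine ⟨π, h1, ⟨h3, fun h9 => ?_⟩, h2⟩
          have := h6.length_le
          rw [← h9] at this
          omega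
      cases α with
      | nil => exact absurd (List.suffix_nil.1 h6.1) h6.2
      | cons i α' =>
        exact ⟨i, α', ⟨π', h5, h7, (List.suffix_cons_iff.1 h6.1).resolve_left h6.2⟩, rfl⟩

variable {k : ℕ} {S : Set (List (Fin k))} {m : ℕ}

theorem mem_wordLeaders_P {π : List (Fin k)} :
    π ∈ (wordLeaders S m).P ↔ π.length ≤ m ∧ π ∈ S ∧ ∀ π' ∈ S, π' <:+ π → π' = π := by
  classical
  simp only [wordLeaders, Finset.mem_filter, Set.Finite.mem_toFinset]
  rfl

/-- A proper suffix of a variable is free. -/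
theorem wordLeaders_free_of_suffix {γ γ' : List (Fin k)}
    (h : ¬ (wordLeaders S m).Lead γ' ∨ γ' ∈ (wordLeaders S m).P) (h1 : γ <:+ γ') (h2 : γ' ≠ γ) :
    ¬ (wordLeaders S m).Lead γ := by
  rintro ⟨π, h3, h4, h5⟩
  rcases h with h | h
  · exact h ⟨π, h3, h4, h5.trans h1⟩
  · have h6 := (mem_wordLeaders_P.1 h).2.2 π h3 (h5.trans h1)
    subst h6
    exact h2 (h5.eq_of_length_le h1.length_le)

open Classical in
/-- The variables of length at most `m`. -/
noncomputable def wordVars (S : Set (List (Fin k))) (m : ℕ) : Finset (List (Fin k)) :=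
  (List.finite_length_le (Fin k) m).toFinset.filter
    (fun γ => ¬ (wordLeaders S m).Lead γ ∨ γ ∈ (wordLeaders S m).P)

theorem mem_wordVars {γ : List (Fin k)} : γ ∈ wordVars S m ↔
    γ.length ≤ m ∧ (¬ (wordLeaders S m).Lead γ ∨ γ ∈ (wordLeaders S m).P) := by
  classical
  simp only [wordVars, Finset.mem_filter, Set.Finite.mem_toFinset]
  rfl

variable {L : FirstOrder.Language.{u, v}} {ρ : FirstOrder.Language.ring →ᴸ L} {K : Type w} [Field K]
    [FirstOrder.Ring.CompatibleRing K] [L.Structure K] [ρ.IsExpansionOn K] {I : Type}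

/-- The jet formula depends only on short words. -/
theorem realize_jetFormula_words (E : Eqns (wordLeaders S m) (dclEmpty ρ K) I)
    {M : Type x} [Field M] [FirstOrder.Ring.CompatibleRing M]
    [L.Structure M] [ρ.IsExpansionOn M] (hM : M ⊨ L.completeTheory K)
    {Y : Type} (β : L.Formula Y) (y : Y → Option I × List (Fin k)) (hy : ∀ z, (y z).2.length ≤ m)
    {b : I × List (Fin k) → M} {z z' : (wordLeaders S m).Vars → M}
    (hz : ∀ μ : (wordLeaders S m).Vars, (μ : List (Fin k)) ∈ wordVars S m → z μ = z' μ)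
    (h : (E.jetFormula ∅ β (fun z => E.jetPoly id (y z))).Realize (Sum.elim b z)) :
    (E.jetFormula ∅ β (fun z => E.jetPoly id (y z))).Realize (Sum.elim b z') := by
  have hsupp : ∀ (π : (wordLeaders S m).P) (t : (I × List (Fin k)) ⊕ (wordLeaders S m).Vars),
      t ∈ (wordLeaders S m).allowed I π → Sum.elim b z t = Sum.elim b z' t := by
    rintro π (t | μ) ht
    · rfl
    · refine hz μ (mem_wordVars.2 ⟨?_, μ.2⟩)
      have hπ := (mem_wordLeaders_P.1 π.2).1
      rcases ht μ rfl with rfl | h1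
      · exact hπ
      · exact (length_le_of_wordFrame (Or.inl h1.2)).trans hπ
  have hs : ∀ π, (E.sep π).eval₂ (dclHom hM) (Sum.elim b z) =
      (E.sep π).eval₂ (dclHom hM) (Sum.elim b z') := fun π =>
    eval₂_congr_supported _ (Eqns.pderiv_mem_supported _ (E.p_mem π)) (hsupp π)
  rw [E.realize_jetFormula hM] at h ⊢
  refine ⟨fun π => ?_, fun q hq => by simp at hq, ?_⟩
  · rw [← hs, ← eval₂_congr_supported _ (E.p_mem π) (hsupp π)]
    exact h.1 π
  · convert h.2.2 using 1
    funext w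
    have hw := hy w
    generalize y w = t at hw
    obtain ⟨_ | t, γ⟩ := t
    · refine eval₂_congr_supported _ (E.G_mem γ) ?_
      rintro ((t | μ) | π) ht
      · rfl
      · refine (hz μ (mem_wordVars.2 ⟨?_, μ.2⟩)).symm
        exact (length_le_of_wordFrame (E.ix_mem_upTo.1 ht)).trans hw
      · exact (congrArg _ (hs π)).symm
    · rw [Eqns.jetPoly, E.evU_inl, E.evU_inl]
      rfl

/-- One step of quantifier elimination, for non-commuting derivations. -/
theorem exists_formula_nc [CharZero K] (hK : AlgBounded L (dclEmpty ρ K))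
    {η : Fin k → Derivation ℤ (dclEmpty ρ K) (dclEmpty ρ K)} (β : L.Formula (Option I × List (Fin k)))
    (M : Type (max u v)) [Field M] [FirstOrder.Ring.CompatibleRing M] [L.Structure M]
    [ρ.IsExpansionOn M] (δ : Fin k → Derivation ℤ M M) (hM : IsDerModel ρ K η M δ)
    (a : I → M) (c : M) (hc : β.Realize (jetGen (fun i => δ i) (fun o : Option I => o.elim c a))) :
    ∃ χ : L.Formula (I × List (Fin k)), χ.Realize (jetGen (fun i => δ i) a) ∧
      ∀ (N : Type (max u v)) [Field N] [FirstOrder.Ring.CompatibleRing N] [L.Structure N]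
        [ρ.IsExpansionOn N] (δ : Fin k → Derivation ℤ N N),
        IsDerModel ρ K η N δ ∧ NcDeep L (fun i => δ i) →
        ∀ b : I → N, χ.Realize (jetGen (fun i => δ i) b) →
          ∃ d : N, β.Realize (jetGen (fun i => δ i) (fun o : Option I => o.elim d b)) := by
  classical
  have := charZero_model (ρ := ρ) hM.1
  obtain ⟨s, ψ, hψ⟩ := exists_finset_formula.{u, v, 0, max u v} β
  -- There are infinite antichains of words, so minimal leaders are taken only up to the length of
  -- the longest word in β. Longer words do not affect the formula, whether or not they are
  -- algebraic.
  let m := s.sup (fun y => y.2.length)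
  have hm : ∀ y : s, (y : Option I × List (Fin k)).2.length ≤ m := fun y =>
    Finset.le_sup (f := fun y : Option I × List (Fin k) => y.2.length) y.2
  let e : List (Fin k) → M := fun γ => applyWord (fun i => δ i) γ c
  have he : ∀ i μ, δ i (e μ) = e ((wordFrame k).s i μ) := fun _ _ => rfl
  let Al : List (Fin k) → Prop :=
    AlgLead hM.1 ρ (wordFrame k) (Set.range (jetGen (fun i => δ i) a)) e
  have hAl : ∀ i α, Al α → Al (i :: α) := fun i α h =>
    AlgLead.s_lead hM.extendsDer (by rintro i _ ⟨⟨z, γ⟩, rfl⟩; exact ⟨(z, i :: γ), rfl⟩) he i h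
  let ld := wordLeaders {γ | Al γ} m
  have hL : ∀ α, ld.Lead α → Al α := by
    rintro α ⟨π, h1, -, ⟨γ, rfl⟩⟩
    induction γ with
    | nil => exact h1
    | cons i γ ih => exact hAl i _ ih
  have hJ : ∀ γ : List (Fin k), γ.length ≤ m → ¬ ld.Lead γ → ¬ Al γ :=
    fun γ h1 h2 h3 => h2 ⟨γ, h3, h1, List.suffix_rfl⟩
  obtain ⟨E, hEd, hE⟩ := exists_eqns ld hM.1 η (jetGen (fun i => δ i) a) e hL
  let Φ := E.jetFormula ∅ ψ (fun y : s => E.jetPoly id y)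
  have hΦ : Φ.Realize (Sum.elim (jetGen (fun i => δ i) a) (fun μ : ld.Vars => e μ)) :=
    (E.realize_jetFormula_jet (by rw [hEd]; exact hM.extendsDer) he a (fun _ => rfl) ∅ ψ _).2
      ⟨hE, fun q hq => by simp at hq, (hψ M _).2 hc⟩
  obtain ⟨χ, h1, h2⟩ := exists_large_jetFormula ld hK hM.1 _ e
    {μ : ld.Vars | ¬ ld.Lead μ ∧ (μ : List (Fin k)).length ≤ m} (fun μ hμ => hJ _ hμ.2 hμ.1) Φ hΦ
  refine ⟨χ, h1, fun N _ _ _ _ δ' hN b hb => ?_⟩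
  have hdeep := hN.2 (wordVars {γ | Al γ} m) (fun γ γ' h h' => by
    rw [mem_wordVars] at h ⊢
    refine ⟨h'.length_le.trans h.1, ?_⟩
    by_cases hne : γ' = γ
    · rw [← hne]; exact h.2
    · exact Or.inl (wordLeaders_free_of_suffix h.2 h' hne))
  -- The scheme concerns a finite set of words; all other variables get the value 0, harmless by
  -- `realize_jetFormula_words`.
  let F : (I × List (Fin k)) ⊕ ld.Vars → (wordVars {γ | Al γ} m) ⊕ N :=
    Sum.elim (fun p => Sum.inr (jetGen (fun i => δ' i) b p))
      (fun μ => if h : (μ : List (Fin k)) ∈ wordVars {γ | Al γ} m then Sum.inl ⟨μ, h⟩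
        else Sum.inr 0)
  have hF : ∀ z : wordVars {γ | Al γ} m → N, Sum.elim z id ∘ F =
      Sum.elim (jetGen (fun i => δ' i) b) (fun μ : ld.Vars =>
        if h : (μ : List (Fin k)) ∈ wordVars {γ | Al γ} m then z ⟨μ, h⟩ else 0) := by
    intro z
    funext t
    rcases t with t | μ
    · rfl
    · change Sum.elim z id (if h : (μ : List (Fin k)) ∈ wordVars {γ | Al γ} m then Sum.inl ⟨μ, h⟩
        else Sum.inr 0) = _
      rw [Sum.elim_inr]
      split_ifs <;> rfl
  obtain ⟨d, hd⟩ := hdeep (Formula.relabel F Φ) (by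
    -- The scheme asks for largeness only on proper suffixes of variables. They are free and of
    -- length at most m, hence among the coordinates controlled by χ.
    let J : Set (wordVars {γ | Al γ} m) := {γ | ∃ γ', γ' ≠ γ ∧ (γ : List (Fin k)) <:+ γ'}
    have hJf : ∀ γ : J, ¬ ld.Lead (γ : wordVars {γ | Al γ} m) := by
      rintro ⟨γ, γ', h3, h4⟩
      exact wordLeaders_free_of_suffix (mem_wordVars.1 γ'.2).2 h4 (fun h => h3 (Subtype.ext h))
    let i : J → {μ : ld.Vars | ¬ ld.Lead μ ∧ (μ : List (Fin k)).length ≤ m} := fun γ =>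
      ⟨⟨γ, Or.inl (hJf γ)⟩, hJf γ, (mem_wordVars.1 (γ : wordVars {γ | Al γ} m).2).1⟩
    have hi : Function.Injective i := by
      intro γ γ' h
      have h3 : (i γ : ld.Vars) = i γ' := congrArg Subtype.val h
      exact Subtype.ext (Subtype.ext (congrArg (fun t : ld.Vars => (t : List (Fin k))) h3))
    obtain ⟨N', -, -, h3, -, -, j, z, h5, h6, -⟩ := exists_generic_solution (ρ := ρ) hK hN.1.1
      (Formula.relabel F Φ) J (fun g hg => by
      obtain ⟨z, h3, h4⟩ := h2 N hN.1.1 _ hb (MvPolynomial.rename i g)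
        (fun h0 => hg (MvPolynomial.rename_injective i hi (h0.trans (map_zero _).symm)))
      refine ⟨fun γ => z ⟨γ, (mem_wordVars.1 γ.2).2⟩, ?_, ?_⟩
      · rw [Formula.realize_relabel, hF]
        refine realize_jetFormula_words E hN.1.1 ψ _ hm (fun μ hμ => ?_) h3
        rw [dif_pos hμ]
      · rw [MvPolynomial.eval_rename] at h4
        exact h4)
    exact ⟨N', h3, j, z, h5, h6⟩)
  rw [Formula.realize_relabel, hF] at hd
  -- Replace the zeros by the true derivatives of d, so that the whole family is differential.
  have hd' := realize_jetFormula_words E hN.1.1 ψ _ hm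
    (z' := fun μ : ld.Vars => applyWord (fun i => δ' i) μ d) (fun μ hμ => by rw [dif_pos hμ]) hd
  have h3 := (E.realize_jetFormula_jet (by rw [hEd]; exact hN.1.extendsDer)
    (e := fun γ => applyWord (fun i => δ' i) γ d) (fun _ _ => rfl) b (fun _ => rfl) ∅ ψ _).1 hd'
  exact ⟨d, (hψ N _).1 h3.2.2⟩

theorem jetExists_ncGenericTheory [CharZero K] (hK : AlgBounded L (dclEmpty ρ K))
    (η : Fin k → Derivation ℤ (dclEmpty ρ K) (dclEmpty ρ K)) :
    JetExists (ncGenericTheory ρ K η) := by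
  rw [ncGenericTheory_eq]
  refine jetExists_classTheory False (fun N _ _ _ _ δ hN => ⟨hN.1, False.elim⟩) ?_
  intro I _ β M _ _ _ _ δ hM _ a c hc
  exact exists_formula_nc hK β M δ hM a c hc

end NonCommuting

/-! ### Extending derivations to rational functions -/

section FractionDerivation

/-- Derivations extend to fields of fractions. -/
theorem exists_derivation_fractionField {A : Type*} [CommRing A] [IsDomain A] {Q : Type*} [Field Q]
    [Algebra A Q] [IsFractionRing A Q] (D : A →+ Q)
    (hD : ∀ a b, D (a * b) = algebraMap A Q a * D b + algebraMap A Q b * D a) :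
    ∃ D' : Q →+ Q, (∀ p q, D' (p * q) = p * D' q + q * D' p) ∧
      ∀ a, D' (algebraMap A Q a) = D a := by
  have h1 : D 1 = 0 := by
    have := hD 1 1
    rw [mul_one, RingHom.map_one, one_mul] at this
    exact left_eq_add.1 this
  -- A derivation is a homomorphism a ↦ a + D(a)ε to dual numbers. Nonzero elements become units
  -- there, so it extends to fractions, and the ε-part of the extension is the wanted derivation.
  let φ : A →+* TrivSqZeroExt Q Q :=
    { toFun := fun a => TrivSqZeroExt.inl (algebraMap A Q a) + TrivSqZeroExt.inr (D a)
      map_zero' := by simp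
      map_one' := by simp [h1]
      map_add' := fun a b => by
        refine TrivSqZeroExt.ext ?_ ?_ <;> simp
      map_mul' := fun a b => by
        refine TrivSqZeroExt.ext ?_ ?_
        · simp
        · simp [hD, mul_comm (D a)] }
  have hunit : ∀ y : nonZeroDivisors A, IsUnit (φ y) := by
    intro y
    rw [TrivSqZeroExt.isUnit_iff_isUnit_fst]
    have : (φ y).fst = algebraMap A Q y := by simp [φ]
    rw [this]
    exact IsLocalization.map_units Q y
  let ψ : Q →+* TrivSqZeroExt Q Q := IsLocalization.lift (M := nonZeroDivisors A) hunit
  have hψ : ∀ a, ψ (algebraMap A Q a) = φ a := fun a => IsLocalization.lift_eq hunit a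
  have hfst : ∀ q, (ψ q).fst = q := by
    have : (TrivSqZeroExt.fstHom Q Q Q).toRingHom.comp ψ = RingHom.id Q := by
      refine IsLocalization.ringHom_ext (nonZeroDivisors A) (RingHom.ext fun a => ?_)
      change (ψ (algebraMap A Q a)).fst = algebraMap A Q a
      rw [hψ]
      simp [φ]
    exact fun q => RingHom.congr_fun this q
  refine ⟨AddMonoidHom.mk' (fun q => (ψ q).snd) (fun p q => by
    rw [map_add, TrivSqZeroExt.snd_add]), fun p q => ?_, fun a => ?_⟩
  · change (ψ (p * q)).snd = p * (ψ q).snd + q * (ψ p).snd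
    rw [map_mul, TrivSqZeroExt.snd_mul, hfst, hfst, smul_eq_mul, op_smul_eq_smul, smul_eq_mul]
  · change (ψ (algebraMap A Q a)).snd = D a
    rw [hψ]
    simp [φ]

open MvPolynomial

theorem mkDerivation_eq_sum {N : Type*} [CommRing N] {V : Type*} {Q : Type*} [CommRing Q]
    [Algebra N Q] [Algebra (MvPolynomial V N) Q] [IsScalarTower N (MvPolynomial V N) Q] (g : V → Q)
    (p : MvPolynomial V N) :
    mkDerivation N g p = ∑ μ ∈ p.vars, algebraMap (MvPolynomial V N) Q (pderiv μ p) * g μ := by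
  classical
  have h : ∀ S : Finset V, p.vars ⊆ S →
      mkDerivation N g p = ∑ μ ∈ S, algebraMap (MvPolynomial V N) Q (pderiv μ p) * g μ := by
    intro S hS
    let D : Derivation N (MvPolynomial V N) Q :=
      ∑ μ ∈ S, (LinearMap.toSpanSingleton (MvPolynomial V N) Q (g μ)).compDer (pderiv μ)
    have hD : ∀ q, D q = ∑ μ ∈ S, algebraMap (MvPolynomial V N) Q (pderiv μ q) * g μ := by
      intro q
      have := map_sum (Derivation.coeFnAddMonoidHom (R := N) (A := MvPolynomial V N) (M := Q))
        (fun μ => (LinearMap.toSpanSingleton (MvPolynomial V N) Q (g μ)).compDer (pderiv μ)) S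
      have h2 := congrFun this q
      rw [Finset.sum_apply] at h2
      refine h2.trans (Finset.sum_congr rfl fun μ _ => ?_)
      change pderiv μ q • g μ = _
      rw [Algebra.smul_def]
    rw [← hD]
    refine derivation_eq_of_forall_mem_vars fun i hi => ?_
    rw [mkDerivation_X, hD, Finset.sum_eq_single i]
    · simp
    · intro μ _ hμ
      rw [pderiv_X_of_ne (Ne.symm hμ), map_zero, zero_mul]
    · exact fun h => absurd (hS hi) h
  exact h _ subset_rfl

/-- A derivation of a field extends to rational functions, with given values on the variables. -/
theorem exists_derivation_rational {N : Type x} [Field N] {V : Type} {Q : Type*} [Field Q]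
    [Algebra (MvPolynomial V N) Q] [IsFractionRing (MvPolynomial V N) Q] (δ : Derivation ℤ N N)
    (g : V → Q) :
    ∃ R : Derivation ℤ Q Q, ∀ p : MvPolynomial V N, R (algebraMap _ _ p) =
        algebraMap (MvPolynomial V N) Q (coeffDer δ p) +
          ∑ μ ∈ p.vars, algebraMap (MvPolynomial V N) Q (pderiv μ p) * g μ := by
  let _ : Algebra N Q := ((algebraMap (MvPolynomial V N) Q).comp C).toAlgebra
  have : IsScalarTower N (MvPolynomial V N) Q := IsScalarTower.of_algebraMap_eq fun _ => rfl
  obtain ⟨R, hR', hR⟩ := exists_derivation_fractionField (A := MvPolynomial V N) (Q := Q)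
    (((algebraMap (MvPolynomial V N) Q : _ →+ _).comp
      (coeffDerivation V δ).toLinearMap.toAddMonoidHom) +
      (mkDerivation N g).toLinearMap.toAddMonoidHom) (fun p q => by
      change algebraMap (MvPolynomial V N) Q
          (coeffDerivation V δ (p * q)) + mkDerivation N g (p * q) =
        algebraMap _ _ p * (algebraMap _ _ (coeffDerivation V δ q) + mkDerivation N g q) +
        algebraMap _ _ q * (algebraMap _ _ (coeffDerivation V δ p) + mkDerivation N g p)
      rw [Derivation.leibniz, Derivation.leibniz, map_add, smul_eq_mul, smul_eq_mul, map_mul,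
        map_mul, Algebra.smul_def, Algebra.smul_def]
      ring)
  refine ⟨Derivation.mk' R.toIntLinearMap hR', fun p => (hR p).trans ?_⟩
  rw [← mkDerivation_eq_sum]
  rfl

end FractionDerivation

/-! ### Exponents, Dickson's lemma and canonical words -/

section CommFrame

variable {k : ℕ}

theorem sum_add_single (μ : Theta k) (i : Fin k) :
    ∑ j, (μ + Pi.single i 1 : Theta k) j = ∑ j, μ j + 1 := by
  simp [Finset.sum_add_distrib]

theorem degLexLT_add_single (i : Fin k) {μ ν : Theta k} (h : degLexLT μ ν) :
    degLexLT (μ + Pi.single i 1) (ν + Pi.single i 1) := by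
  rw [degLexLT, sum_add_single, sum_add_single]
  rcases h with h | ⟨h1, j, h2, h3⟩
  · exact Or.inl (by omega)
  · refine Or.inr ⟨by omega, j, fun l hl => ?_, ?_⟩
    · exact congrArg (· + (Pi.single i 1 : Theta k) l) (h2 l hl)
    · exact Nat.add_lt_add_right h3 _

theorem isWellOrder_degLexLT (k : ℕ) : IsWellOrder (Theta k) degLexLT where
  trichotomous := fun μ ν h h' => by
    rw [degLexLT, not_or, not_and] at h h'
    have h1 : ∑ i, μ i = ∑ i, ν i := le_antisymm (not_lt.1 h'.1) (not_lt.1 h.1)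
    exact toLex.injective (le_antisymm (not_lt.1 (h'.2 h1.symm)) (not_lt.1 (h.2 h1)))
  wf := by
    refine Subrelation.wf (r := InvImage (Prod.Lex (· < ·) (· < ·))
      (fun μ : Theta k => (∑ i, μ i, toLex μ))) (fun {μ ν} h => ?_)
      (InvImage.wf _ (WellFounded.prod_lex wellFounded_lt wellFounded_lt))
    exact Prod.lex_def.2 h

/-- The commutative monoid, with the degree-lexicographic order. -/
abbrev commFrame (k : ℕ) : Frame (Fin k) (Theta k) where
  lt := degLexLT
  wo := isWellOrder_degLexLT k
  s := fun i μ => μ + Pi.single i 1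
  s_mono := fun i _ _ h => degLexLT_add_single i h
  lt_s := fun i μ => Or.inl (by rw [sum_add_single]; exact Nat.lt_succ_self _)

/-- The leaders generated by a finite set. -/
abbrev commLeaders (P : Finset (Theta k)) : Leaders (commFrame k) where
  Lead := IsLeader P
  P := P
  P_lead := fun π hπ => ⟨π, hπ, le_rfl⟩
  lead_cases := fun α ⟨π, hπ, h⟩ => by
    by_cases hα : π = α
    · exact Or.inl (hα ▸ hπ)
    · obtain ⟨i, hi⟩ := Pi.lt_def.1 (lt_of_le_of_ne h hα) |>.2
      refine Or.inr ⟨i, α - Pi.single i 1, ⟨π, hπ, fun j => ?_⟩, ?_⟩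
      · rw [Pi.sub_apply]
        by_cases hj : j = i
        · subst hj
          rw [Pi.single_eq_same]
          exact Nat.le_sub_one_of_lt hi
        · rw [Pi.single_eq_of_ne hj]
          exact h j
      · refine (tsub_add_cancel_of_le fun j => ?_).symm
        by_cases hj : j = i
        · subst hj
          rw [Pi.single_eq_same]
          exact Nat.one_le_of_lt hi
        · rw [Pi.single_eq_of_ne hj]
          exact Nat.zero_le _

/-- The minimal elements of a set of exponents, a finite set by Dickson's lemma. -/
theorem exists_minimal_finset (S : Set (Theta k)) (hS : ∀ i, ∀ μ ∈ S, μ + Pi.single i 1 ∈ S) :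
    ∃ P : Finset (Theta k), IsAntichain (· ≤ ·) (P : Set (Theta k)) ∧ ∀ μ, IsLeader P μ ↔ μ ∈ S := by
  have hup : ∀ μ ∈ S, ∀ ν, μ + ν ∈ S := by
    intro μ hμ ν
    induction h : ∑ i, ν i generalizing ν with
    | zero =>
      have : ν = 0 := funext fun i => (Finset.sum_eq_zero_iff.1 h) i (Finset.mem_univ i)
      rwa [this, add_zero]
    | succ n ih =>
      obtain ⟨i, -, hi⟩ := Finset.exists_ne_zero_of_sum_ne_zero (h.trans_ne n.succ_ne_zero)
      have h1 : ν = (ν - Pi.single i 1) + Pi.single i 1 := by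
        refine (tsub_add_cancel_of_le fun j => ?_).symm
        by_cases hj : j = i
        · subst hj
          rw [Pi.single_eq_same]
          exact Nat.one_le_iff_ne_zero.2 hi
        · rw [Pi.single_eq_of_ne hj]
          exact Nat.zero_le _
      rw [h1, sum_add_single] at h
      rw [h1, ← add_assoc]
      exact hS i _ (ih _ (by omega))
  -- Dickson's lemma: antichains of exponents are finite, and every element of S lies above a
  -- minimal one.
  have hpwo : S.IsPWO := Set.isPWO_of_wellQuasiOrderedLE S
  have hanti : IsAntichain (· ≤ ·) {μ | Minimal (· ∈ S) μ} := setOfPred_minimal_antichain _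
  have hfin : {μ | Minimal (· ∈ S) μ}.Finite :=
    hanti.finite_of_partiallyWellOrderedOn (hpwo.mono fun μ hμ => hμ.1)
  refine ⟨hfin.toFinset, by rwa [hfin.coe_toFinset], fun μ => ⟨?_, fun hμ => ?_⟩⟩
  · rintro ⟨π, hπ, h⟩
    rw [← add_tsub_cancel_of_le h]
    exact hup π (hfin.mem_toFinset.1 hπ).1 _
  · obtain ⟨π, h1, h2⟩ := hpwo.exists_le_minimal hμ
    exact ⟨π, hfin.mem_toFinset.2 h2, h1⟩

theorem wordClass_cons (i : Fin k) (γ : List (Fin k)) :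
    wordClass (i :: γ) = wordClass γ + Pi.single i 1 := by
  funext j
  rw [wordClass, Pi.add_apply, List.count_cons, wordClass]
  by_cases h : j = i
  · subst h; simp
  · simp [h, Ne.symm h]

theorem foldr_add_single (v : List (Fin k)) (μ : Theta k) :
    v.foldr (commFrame k).s μ = wordClass v + μ := by
  induction v with
  | nil =>
    have : wordClass ([] : List (Fin k)) = 0 := funext fun i => rfl
    rw [this, zero_add]
    rfl
  | cons i v ih =>
    rw [List.foldr_cons, ih, wordClass_cons]
    exact add_right_comm _ _ _

/-- Bounds the words of bounded degree, so that only finitely many have to be compared for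
commutation. -/
theorem length_le_sum (v : List (Fin k)) (μ : Theta k) :
    v.length ≤ ∑ i, (wordClass v + μ) i := by
  induction v with
  | nil => exact Nat.zero_le _
  | cons i v ih =>
    rw [wordClass_cons, add_right_comm, sum_add_single, List.length_cons]
    exact Nat.succ_le_succ ih

theorem count_canonicalWord (μ : Theta k) (i : Fin k) : (canonicalWord μ).count i = μ i := by
  rw [canonicalWord, List.count_flatMap]
  have h : ∀ l : List (Fin k), l.Nodup →
      (l.map (List.count i ∘ fun j => List.replicate (μ j) j)).sum = if i ∈ l then μ i else 0 := by
    intro l hl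
    induction l with
    | nil => rfl
    | cons j l ih =>
      rw [List.nodup_cons] at hl
      rw [List.map_cons, List.sum_cons, ih hl.2, Function.comp_apply, List.count_replicate]
      by_cases hj : j = i
      · subst hj
        simp [hl.1]
      · simp [hj, Ne.symm hj]
  rw [h _ (List.nodup_finRange k), if_pos (List.mem_finRange i)]

theorem applyWord_perm {M : Type x} {d : Fin k → M → M}
    (hd : ∀ i i' y, d i (d i' y) = d i' (d i y)) {γ γ' : List (Fin k)} (h : γ.Perm γ') (c : M) :
    applyWord d γ c = applyWord d γ' c := by
  have : LeftCommutative d := ⟨hd⟩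
  exact h.foldr_eq c

theorem applyWord_canonicalWord_wordClass {M : Type x} {d : Fin k → M → M}
    (hd : ∀ i i' y, d i (d i' y) = d i' (d i y)) (γ : List (Fin k)) (c : M) :
    applyWord d (canonicalWord (wordClass γ)) c = applyWord d γ c :=
  applyWord_perm hd (List.perm_iff_count.2 fun i => count_canonicalWord _ i) c

theorem apply_applyWord_canonicalWord {M : Type x} {d : Fin k → M → M}
    (hd : ∀ i i' y, d i (d i' y) = d i' (d i y)) (i : Fin k) (μ : Theta k) (c : M) :
    d i (applyWord d (canonicalWord μ) c) = applyWord d (canonicalWord (μ + Pi.single i 1)) c := by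
  change applyWord d (i :: canonicalWord μ) c = _
  refine applyWord_perm hd (List.perm_iff_count.2 fun j => ?_) c
  rw [count_canonicalWord, List.count_cons, count_canonicalWord, Pi.add_apply]
  by_cases h : j = i
  · subst h; simp
  · simp [h, Ne.symm h]

end CommFrame

/-! ### Specialized equations, prolongations and commutation -/

namespace Eqns

open MvPolynomial

variable {k : ℕ} {P : Finset (Theta k)} {F : Type w} [CommRing F] {I : Type}
  (E : Eqns (commLeaders P) F I) {N : Type x} [Field N] (f : F →+* N) (b : I × List (Fin k) → N)

section Specialize

variable (P) in
/-- Specialize the parameters in a polynomial. -/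
noncomputable def specialize :
    MvPolynomial ((I × List (Fin k)) ⊕ VSet P) F →+* MvPolynomial (VSet P) N :=
  eval₂Hom (C.comp f) (Sum.elim (fun t => C (b t)) X)

theorem specialize_C (c : F) : specialize P f b (C c) = C (f c) := by simp [specialize]

theorem specialize_inl (t : I × List (Fin k)) : specialize P f b (X (Sum.inl t)) = C (b t) := by
  simp [specialize]

theorem specialize_inr (μ : VSet P) : specialize P f b (X (Sum.inr μ)) = X μ := by
  simp [specialize]

theorem eval₂_specialize {N' : Type*} [CommRing N'] (r : N →+* N') (a : VSet P → N')
    (q : MvPolynomial ((I × List (Fin k)) ⊕ VSet P) F) :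
    (specialize P f b q).eval₂ r a = q.eval₂ (r.comp f) (Sum.elim (fun t => r (b t)) a) := by
  have h : (eval₂Hom r a).comp (specialize P f b) =
      eval₂Hom (r.comp f) (Sum.elim (fun t => r (b t)) a) := by
    refine MvPolynomial.ringHom_ext (fun c => ?_) (fun t => ?_)
    · rw [RingHom.comp_apply, specialize_C]
      simp
    · rcases t with t | μ
      · rw [RingHom.comp_apply, specialize_inl]; simp
      · rw [RingHom.comp_apply, specialize_inr]; simp
  exact RingHom.congr_fun h q

theorem pderiv_specialize (μ : VSet P) (q : MvPolynomial ((I × List (Fin k)) ⊕ VSet P) F) :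
    pderiv μ (specialize P f b q) = specialize P f b (pderiv (Sum.inr μ) q) := by
  induction q using MvPolynomial.induction_on with
  | C c => rw [specialize_C, pderiv_C, pderiv_C, map_zero]
  | add p q hp hq => rw [map_add, map_add, map_add, map_add, hp, hq]
  | mul_X p z hp =>
    have h : pderiv μ (specialize P f b (X z)) = specialize P f b (pderiv (Sum.inr μ) (X z)) := by
      rcases z with t | ν
      · rw [specialize_inl, pderiv_C, pderiv_X_of_ne (by simp), map_zero]
      · rw [specialize_inr]
        by_cases h : ν = μ
        · subst h
          rw [pderiv_X_self, pderiv_X_self, map_one]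
        · rw [pderiv_X_of_ne h, pderiv_X_of_ne (by simpa using h), map_zero]
    rw [map_mul, Derivation.leibniz, hp, h, Derivation.leibniz, map_add, smul_eq_mul, smul_eq_mul,
      smul_eq_mul, smul_eq_mul, map_mul, map_mul]

theorem specialize_mem_supported {S : Set ((I × List (Fin k)) ⊕ VSet P)}
    {q : MvPolynomial ((I × List (Fin k)) ⊕ VSet P) F} (hq : q ∈ supported F S) :
    specialize P f b q ∈ supported N {μ | Sum.inr μ ∈ S} := by
  rw [supported] at hq
  induction hq using Algebra.adjoin_induction with
  | mem p hp =>
    obtain ⟨t | μ, hi, rfl⟩ := hp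
    · rw [specialize_inl]
      exact Subalgebra.algebraMap_mem _ (b t)
    · rw [specialize_inr]
      exact Algebra.subset_adjoin ⟨μ, hi, rfl⟩
  | algebraMap c =>
    rw [algebraMap_eq, specialize_C]
    exact Subalgebra.algebraMap_mem _ (f c)
  | add p q _ _ h h' => rw [map_add]; exact add_mem h h'
  | mul p q _ _ h h' => rw [map_mul]; exact mul_mem h h'

theorem specialize_p_vars {π : P} {μ : VSet P} (hμ : μ ∈ (specialize P f b (E.p π)).vars) :
    μ = ofP π ∨ (¬ IsLeader P (μ : Theta k) ∧ degLexLT (μ : Theta k) π) :=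
  mem_supported.1 (specialize_mem_supported f b (E.p_mem π)) (Finset.mem_coe.2 hμ) μ rfl

end Specialize

section Prolongation

variable (Q : Type y) [Field Q] [Algebra (MvPolynomial (VSet P) N) Q]

/-- Evaluation of the universal ring in rational functions. -/
noncomputable def evRat : E.U →+* Q :=
  E.evU ((algebraMap (MvPolynomial (VSet P) N) Q).comp (C.comp f))
    (Sum.elim (fun t => algebraMap (MvPolynomial (VSet P) N) Q (C (b t)))
      (fun μ => algebraMap (MvPolynomial (VSet P) N) Q (X μ)))

theorem evRat_C (c : F) : E.evRat f b Q (C c) = algebraMap (MvPolynomial (VSet P) N) Q (C (f c)) :=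
  E.evU_C _ _ c

theorem evRat_ij (t : I × List (Fin k)) : E.evRat f b Q (X (Leaders.ij _ I t)) =
    algebraMap (MvPolynomial (VSet P) N) Q (C (b t)) :=
  E.evU_inl _ _ _

theorem evRat_ix (μ : VSet P) : E.evRat f b Q (X (Leaders.ix _ I μ)) =
    algebraMap (MvPolynomial (VSet P) N) Q (X μ) :=
  E.evU_inl _ _ _

theorem evRat_rename (q : MvPolynomial ((I × List (Fin k)) ⊕ VSet P) F) :
    E.evRat f b Q (rename Sum.inl q) =
      algebraMap (MvPolynomial (VSet P) N) Q (specialize P f b q) := by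
  refine (E.evU_rename _ _ q).trans ?_
  have h : eval₂Hom ((algebraMap (MvPolynomial (VSet P) N) Q).comp (C.comp f))
      (Sum.elim (fun t => algebraMap (MvPolynomial (VSet P) N) Q (C (b t)))
      (fun μ => algebraMap (MvPolynomial (VSet P) N) Q (X μ))) =
      (algebraMap (MvPolynomial (VSet P) N) Q).comp (specialize P f b) := by
    refine MvPolynomial.ringHom_ext (fun c => ?_) (fun t => ?_)
    · rw [RingHom.comp_apply, specialize_C]
      simp
    · rcases t with t | μ
      · rw [RingHom.comp_apply, specialize_inl]; simp
      · rw [RingHom.comp_apply, specialize_inr]; simp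
  exact RingHom.congr_fun h q

variable [IsFractionRing (MvPolynomial (VSet P) N) Q]

theorem evRat_sU_mul (hsep : ∀ π, specialize P f b (E.sep π) ≠ 0) (π : P) :
    E.evRat f b Q (E.sU π) * E.evRat f b Q (X (Leaders.it _ I π)) = 1 := by
  have h : E.evRat f b Q (X (Leaders.it _ I π)) = (E.evRat f b Q (E.sU π))⁻¹ := by
    rw [sU, evRat, evU_rename, ← evU_inr]
  rw [h]
  refine mul_inv_cancel₀ ?_
  rw [sU, evRat_rename]
  exact fun h0 => hsep π (IsFractionRing.injective _ Q (h0.trans (map_zero _).symm))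

variable {δ : Derivation ℤ N N} {i : Fin k}

/-- The derivation of the field of rational functions that corresponds to the one of the
universal ring. -/
theorem exists_derivation_evRat (hδ : ∀ c, δ (f c) = f (E.d i c))
    (hb : ∀ z γ, δ (b (z, γ)) = b (z, i :: γ)) (hsep : ∀ π, specialize P f b (E.sep π) ≠ 0) :
    ∃ R : Q →+ Q, (∀ p q, R (p * q) = p * R q + q * R p) ∧
      (∀ m, R (algebraMap (MvPolynomial (VSet P) N) Q (C m)) =
        algebraMap (MvPolynomial (VSet P) N) Q (C (δ m))) ∧
      ∀ u, R (E.evRat f b Q u) = E.evRat f b Q (E.R E.G i u) := by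
  obtain ⟨R, hR⟩ := exists_derivation_rational (V := VSet P) (Q := Q) δ
    (fun μ => E.evRat f b Q (E.g3 E.G i (Leaders.ix _ I μ)))
  have hC : ∀ m, R (algebraMap (MvPolynomial (VSet P) N) Q (C m)) =
        algebraMap (MvPolynomial (VSet P) N) Q (C (δ m)) := by
    intro m
    rw [hR, vars_C, Finset.sum_empty, add_zero]
    exact congrArg _ (coeffDerivation_C δ m)
  have hX : ∀ μ, R (algebraMap (MvPolynomial (VSet P) N) Q (X μ)) =
        E.evRat f b Q (E.g3 E.G i (Leaders.ix _ I μ)) := by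
    intro μ
    rw [hR, vars_X, Finset.sum_singleton, pderiv_X_self, map_one, one_mul]
    have : coeffDer δ (X μ : MvPolynomial (VSet P) N) = 0 := coeffDerivation_X δ μ
    rw [this, map_zero, zero_add]
  have hC' : ∀ c, R (E.evRat f b Q (C c)) = E.evRat f b Q (C (E.d i c)) := by
    intro c
    rw [evRat_C, evRat_C, hC, hδ]
  have hz : ∀ z, R (E.evRat f b Q (X (Sum.inl z))) = E.evRat f b Q (E.g3 E.G i (Sum.inl z)) := by
    rintro (⟨z, γ⟩ | μ)
    · rw [evRat_ij, hC, hb]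
      exact (E.evRat_ij f b Q _).symm
    · rw [evRat_ix, hX]
  refine ⟨R.toLinearMap.toAddMonoidHom, R.leibniz, hC, fun u =>
    der_eval _ R (E.d i) (E.g3 E.G i) hC' (S := Set.univ) (fun z _ => ?_)
    (by rw [supported_univ]; exact Algebra.mem_top)⟩
  rcases z with z | π
  · exact hz z
  · have hs := E.evRat_sU_mul f b Q hsep π
    have h2 : R (E.evRat f b Q (E.sU π)) =
        E.evRat f b Q (derOf (E.d i) (E.g2 E.G i) (E.sU π)) :=
      der_eval _ R (E.d i) (E.g2 E.G i) hC' (S := Set.range Sum.inl) (by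
        rintro _ ⟨z, rfl⟩
        exact hz z) (supported_mono (Set.image_subset_range _ _) (E.sU_mem π))
    have h3 := congrArg R hs
    rw [R.leibniz, Derivation.map_one_eq_zero, h2, smul_eq_mul, smul_eq_mul] at h3
    change R (E.evRat f b Q (X (Leaders.it _ I π))) =
      E.evRat f b Q (-(X (Leaders.it _ I π) * X (Leaders.it _ I π) *
        derOf (E.d i) (E.g2 E.G i) (E.sU π)))
    rw [map_neg, map_mul, map_mul]
    linear_combination (E.evRat f b Q (X (Leaders.it _ I π))) * h3 -
      R (E.evRat f b Q (X (Leaders.it _ I π))) * hs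

open Classical in
/-- The formula for the derivatives of the elements of `P`. -/
theorem evRat_A (hδ : ∀ c, δ (f c) = f (E.d i c))
    (hb : ∀ z γ, δ (b (z, γ)) = b (z, i :: γ)) (π : P) :
    E.evRat f b Q (E.A E.G i π) =
      algebraMap (MvPolynomial (VSet P) N) Q (coeffDer δ (specialize P f b (E.p π))) +
        ∑ μ ∈ (specialize P f b (E.p π)).vars.erase (ofP π),
          algebraMap (MvPolynomial (VSet P) N) Q (pderiv μ (specialize P f b (E.p π))) *
            E.evRat f b Q (E.G ((μ : Theta k) + Pi.single i 1)) := by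
  -- Leaders are treated as constants, as in `g1`; hence x_π contributes nothing and is erased from
  -- the sum.
  let g : VSet P → Q := fun μ => if IsLeader P (μ : Theta k) then 0 else
    E.evRat f b Q (E.G ((μ : Theta k) + Pi.single i 1))
  obtain ⟨R, hR⟩ := exists_derivation_rational (V := VSet P) (Q := Q) δ g
  have hC : ∀ m, R (algebraMap (MvPolynomial (VSet P) N) Q (C m)) =
        algebraMap (MvPolynomial (VSet P) N) Q (C (δ m)) := by
    intro m
    rw [hR, vars_C, Finset.sum_empty, add_zero]
    exact congrArg _ (coeffDerivation_C δ m)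
  have hX : ∀ μ, R (algebraMap (MvPolynomial (VSet P) N) Q (X μ)) = g μ := by
    intro μ
    rw [hR, vars_X, Finset.sum_singleton, pderiv_X_self, map_one, one_mul]
    have : coeffDer δ (X μ : MvPolynomial (VSet P) N) = 0 := coeffDerivation_X δ μ
    rw [this, map_zero, zero_add]
  have h1 := der_eval (E.evRat f b Q) R (E.d i) (E.g1 E.G i) (fun c => by
    rw [evRat_C, evRat_C, hC, hδ]) (fun z hz => ?_) (E.pU_mem π)
  · rw [A, ← h1, pU, evRat_rename, hR]
    congr 1
    have h0 : g (ofP π) = 0 := if_pos ⟨π, π.2, le_rfl⟩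
    rw [← Finset.sum_erase (a := ofP π) _ (by rw [h0, mul_zero])]
    refine Finset.sum_congr rfl fun μ hμ => ?_
    have h2 := (E.specialize_p_vars f b (Finset.mem_of_mem_erase hμ)).resolve_left
      (Finset.ne_of_mem_erase hμ)
    rw [show g μ = _ from if_neg h2.1]
  · rcases E.mem_allowedU hz with ⟨p, rfl⟩ | rfl | ⟨μ, h1, h2, rfl⟩
    · rw [evRat_ij, hC, hb]
      exact (E.evRat_ij f b Q _).symm
    · rw [evRat_ix, hX]
      simp only [g1, if_pos (lead_ofP (ld := commLeaders P) π), map_zero]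
      exact if_pos (lead_ofP (ld := commLeaders P) π)
    · rw [evRat_ix, hX]
      simp only [g1, if_neg h1]
      exact if_neg h1

end Prolongation

end Eqns

/-- The ℤ-algebra structure of a ring is unique, so the choice of it is irrelevant. -/
theorem exists_derivation_of_addMonoidHom {Q : Type*} [CommRing Q] [hQ : Algebra ℤ Q] (D : Q →+ Q)
    (hD : ∀ p q, D (p * q) = p * D q + q * D p) : ∃ D' : Derivation ℤ Q Q, ∀ q, D' q = D q := by
  obtain rfl := Subsingleton.elim hQ (Ring.toIntAlgebra Q)
  exact ⟨Derivation.mk' D.toIntLinearMap hD, fun _ => rfl⟩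

namespace Eqns

open MvPolynomial

section Config

variable {k : ℕ} {P : Finset (Theta k)} {F : Type w} [CommRing F] {I : Type}
  (E : Eqns (commLeaders P) F I) {N : Type x} [Field N] (f : F →+* N) (b : I × List (Fin k) → N)

open Classical in
/-- The configuration given by the equations, for given values of the parameters. -/
noncomputable abbrev config (hP : IsAntichain (· ≤ ·) (P : Set (Theta k)))
    (hfree : ∃ μ : Theta k, ¬ IsLeader P μ)
    (qs : Finset (MvPolynomial ((I × List (Fin k)) ⊕ VSet P) F))
    (hsep : ∀ π, specialize P f b (E.sep π) ≠ 0) : Configuration k N where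
  P := P
  antichain := hP
  free_nonempty := hfree
  p := fun π => specialize P f b (E.p π)
  vars_p := fun _ _ hμ => E.specialize_p_vars f b hμ
  -- A nonzero separant forces x_π to occur.
  degree_p := fun π h => by
    refine hsep π ?_
    refine (pderiv_specialize f b (ofP π) (E.p π)).symm.trans (pderiv_eq_zero_of_notMem_vars ?_)
    rw [vars_def, Multiset.mem_toFinset]
    rw [degreeOf_def] at h
    exact Multiset.count_eq_zero.1 h
  eqs := qs.image (specialize P f b)

variable {E f b} {hP : IsAntichain (· ≤ ·) (P : Set (Theta k))}
    {hfree : ∃ μ : Theta k, ¬ IsLeader P μ}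
    {qs : Finset (MvPolynomial ((I × List (Fin k)) ⊕ VSet P) F)}
    {hsep : ∀ π, specialize P f b (E.sep π) ≠ 0}

theorem memW_config {N' : Type y} [Field N'] (r : N →+* N') (a : VSet P → N') :
    (E.config f b hP hfree qs hsep).MemW r a ↔
      (∀ π, (E.p π).eval₂ (r.comp f) (Sum.elim (fun t => r (b t)) a) = 0 ∧
        (E.sep π).eval₂ (r.comp f) (Sum.elim (fun t => r (b t)) a) ≠ 0) ∧
      ∀ q ∈ qs, q.eval₂ (r.comp f) (Sum.elim (fun t => r (b t)) a) = 0 := by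
  classical
  have h1 : (E.config f b hP hfree qs hsep).MemW r a ↔
      (∀ π : P, (specialize P f b (E.p π)).eval₂ r a = 0 ∧
        (pderiv (ofP π) (specialize P f b (E.p π))).eval₂ r a ≠ 0) ∧
      ∀ q ∈ qs.image (specialize P f b), q.eval₂ r a = 0 := Iff.rfl
  rw [h1]
  simp only [pderiv_specialize, eval₂_specialize, Finset.forall_mem_image]
  rfl

/-- The rational functions that correspond to the polynomials `E.G α` are a prolongation. -/
theorem exists_isProlongation {δ : Fin k → Derivation ℤ N N} (hδ : ∀ i c, δ i (f c) = f (E.d i c))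
    (hb : ∀ i z γ, δ i (b (z, γ)) = b (z, i :: γ)) :
    ∃ R : Fin k → Derivation ℤ (E.config f b hP hfree qs hsep).Rat
        (E.config f b hP hfree qs hsep).Rat,
      (E.config f b hP hfree qs hsep).IsProlongation δ R
        (fun α => E.evRat f b (FractionRing (MvPolynomial (VSet P) N)) (E.G α)) ∧
      ∀ v (π : P), applyWord (fun i => R i) v
          ((E.config f b hP hfree qs hsep).toRat (X (ofP π))) =
        E.evRat f b (FractionRing (MvPolynomial (VSet P) N))
          (applyWord (fun i => E.R E.G i) v (X (Leaders.ix _ I (ofP π)))) := by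
  classical
  have hR0 : ∀ i, ∃ R :
      Derivation ℤ (E.config f b hP hfree qs hsep).Rat (E.config f b hP hfree qs hsep).Rat,
      (∀ m, R ((E.config f b hP hfree qs hsep).toRat (C m)) =
        (E.config f b hP hfree qs hsep).toRat (C (δ i m))) ∧
      ∀ u, R (E.evRat f b (FractionRing (MvPolynomial (VSet P) N)) u) =
        E.evRat f b (FractionRing (MvPolynomial (VSet P) N)) (E.R E.G i u) := by
    intro i
    obtain ⟨R, h0, h1, h2⟩ :=
      E.exists_derivation_evRat f b (FractionRing (MvPolynomial (VSet P) N)) (hδ i) (hb i) hsep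
    obtain ⟨R', hR'⟩ := exists_derivation_of_addMonoidHom R h0
    exact ⟨R', fun m => (hR' _).trans (h1 m), fun u => (hR' _).trans (h2 u)⟩
  choose R hRC hRev using hR0
  have hword : ∀ v (π : P),
      applyWord (fun i => R i) v ((E.config f b hP hfree qs hsep).toRat (X (ofP π))) =
        E.evRat f b (FractionRing (MvPolynomial (VSet P) N))
          (applyWord (fun i => E.R E.G i) v (X (Leaders.ix _ I (ofP π)))) := by
    intro v π
    induction v with
    | nil => exact (E.evRat_ix f b (FractionRing (MvPolynomial (VSet P) N)) (ofP π)).symm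
    | cons i v ih =>
      change R i (applyWord (fun i => R i) v ((E.config f b hP hfree qs hsep).toRat (X (ofP π)))) = _
      rw [ih, hRev]
      rfl
  refine ⟨R, ?_, hword⟩
  refine ⟨hRC, fun μ => ?_, fun α hα => ?_, fun i μ hμ => ?_, fun i π => ?_⟩
  · exact (congrArg (E.evRat f b (FractionRing (MvPolynomial (VSet P) N))) (E.G_var μ)).trans
      (E.evRat_ix f b (FractionRing (MvPolynomial (VSet P) N)) μ)
  · obtain ⟨v, π, h1, h2⟩ := E.exists_word α hα
    refine ⟨v, π, ?_, ?_⟩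
    · rw [← h1, foldr_add_single]
    · exact (congrArg (E.evRat f b (FractionRing (MvPolynomial (VSet P) N))) h2).trans (hword v π).symm
  · refine (congrArg (R i) (E.evRat_ix f b (FractionRing (MvPolynomial (VSet P) N)) μ).symm).trans
      ((hRev i _).trans ?_)
    refine congrArg _ ((derOf_X _ _ _).trans ?_)
    exact E.g2_free E.G i hμ
  · refine (congrArg (R i) (E.evRat_ix f b (FractionRing (MvPolynomial (VSet P) N)) (ofP π)).symm).trans
      ((hRev i _).trans ?_)
    have h1 : E.R E.G i (X (Leaders.ix _ I (ofP π))) = -(X (Leaders.it _ I π) * E.A E.G i π) :=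
      (derOf_X _ _ _).trans (E.g2_ofP E.G i π)
    have h2 := E.evRat_A f b (FractionRing (MvPolynomial (VSet P) N)) (hδ i) (hb i) π
    have h3 : E.evRat f b (FractionRing (MvPolynomial (VSet P) N)) (X (Leaders.it _ I π)) =
        ((E.config f b hP hfree qs hsep).toRat (pderiv (ofP π) (specialize P f b (E.p π))))⁻¹ := by
      have h4 := E.evRat_sU_mul f b (FractionRing (MvPolynomial (VSet P) N)) hsep π
      rw [sU, evRat_rename, sep] at h4
      rw [pderiv_specialize]
      exact eq_inv_of_mul_eq_one_right h4
    rw [h1, map_neg, map_mul, h2, h3, mul_comm, ← div_eq_mul_inv]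
    rfl

end Config

section Commute

variable {k : ℕ} {P : Finset (Theta k)} {F : Type w} [CommRing F] {I : Type}
  (E : Eqns (commLeaders P) F I)

/-- Finitely many polynomials express that the configuration commutes. -/
theorem exists_commute_eqs : ∃ qs : Finset (MvPolynomial ((I × List (Fin k)) ⊕ VSet P) F),
    (∀ (M : Type x) [Field M] (f : F →+* M) (D : Fin k → Derivation ℤ M M) (e : Theta k → M)
      (b : I × List (Fin k) → M),
      E.IsDerEval (E.evU f (Sum.elim b (fun μ : VSet P => e μ))) D e →
      ∀ q ∈ qs, q.eval₂ f (Sum.elim b (fun μ : VSet P => e μ)) = 0) ∧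
    ∀ (Q : Type x) [Field Q] (ev : E.U →+* Q) (_ : ∀ π, ev (E.sU π) * ev (X (Leaders.it _ I π)) = 1)
      (v v' : List (Fin k)) (π π' : P), wordClass v + π = wordClass v' + π' →
      ∑ i, (wordClass v + π : Theta k) i ≤ ∑ i, P.sup id i →
      ∃ (n : ℕ), ∃ q ∈ qs,
        (ev (applyWord (fun i => E.R E.G i) v (X (Leaders.ix _ I (ofP π)))) -
          ev (applyWord (fun i => E.R E.G i) v' (X (Leaders.ix _ I (ofP π'))))) *
          (∏ π, ev (E.sU π)) ^ n = ev (rename Sum.inl q) := by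
  classical
  let u : (List (Fin k) × P) × (List (Fin k) × P) → E.U := fun t =>
    applyWord (fun i => E.R E.G i) t.1.1 (X (Leaders.ix _ I (ofP t.1.2))) -
      applyWord (fun i => E.R E.G i) t.2.1 (X (Leaders.ix _ I (ofP t.2.2)))
  choose n q hq using fun t => E.exists_clear.{w, x} (u t)
  -- A word v with [v]π of degree at most that of the least upper bound has at most this length.
  let W : Finset (List (Fin k)) := (List.finite_length_le (Fin k) (∑ i, P.sup id i)).toFinset
  let T : Finset ((List (Fin k) × P) × (List (Fin k) × P)) :=
    ((W ×ˢ Finset.univ) ×ˢ (W ×ˢ Finset.univ)).filter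
      (fun t => wordClass t.1.1 + t.1.2 = wordClass t.2.1 + (t.2.2 : Theta k))
  refine ⟨T.image q, fun M _ f D e b h => ?_, fun Q _ ev hev v v' π π' h1 h2 => ?_⟩
  · rw [Finset.forall_mem_image]
    intro t ht
    have h1 := (Finset.mem_filter.1 ht).2
    rw [← E.evU_rename, ← hq t M _ h.hs]
    have h2 : E.evU f (Sum.elim b (fun μ : VSet P => e μ)) (u t) = 0 := by
      rw [map_sub, h.ev_word, h.ev_word, sub_eq_zero, foldr_add_single, foldr_add_single]
      exact congrArg e h1
    rw [h2, zero_mul]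
  · have hT : ((v, π), (v', π')) ∈ T := Finset.mem_filter.2 ⟨?_, h1⟩
    refine ⟨n ((v, π), (v', π')), _, Finset.mem_image_of_mem q hT, ?_⟩
    · rw [← hq _ Q ev hev, map_sub]
    · have h3 := (length_le_sum v π).trans h2
      have h4 := (length_le_sum v' π').trans (h1 ▸ h2)
      simp only [Finset.mem_product, Finset.mem_univ, and_true, W, Set.Finite.mem_toFinset]
      exact ⟨h3, h4⟩

end Commute

end Eqns

/-! ### Commuting derivations -/

section Commuting

open MvPolynomial

variable {L : FirstOrder.Language.{u, v}} {ρ : FirstOrder.Language.ring →ᴸ L} {K : Type w} [Field K]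
    [FirstOrder.Ring.CompatibleRing K] [L.Structure K] [ρ.IsExpansionOn K] {I : Type}
    {k : ℕ} {P : Finset (Theta k)} (E : Eqns (commLeaders P) (dclEmpty ρ K) I)

/-- The jet formula, with fixed parameters. -/
noncomputable def paramFormula {N : Type x} (bb : I × List (Fin k) → N)
    (Φ : L.Formula ((I × List (Fin k)) ⊕ VSet P)) : L.Formula (VSet P ⊕ N) :=
  Formula.relabel (Sum.elim (fun t => Sum.inr (bb t)) Sum.inl) Φ

theorem realize_paramFormula {N : Type x} (bb : I × List (Fin k) → N)
    (Φ : L.Formula ((I × List (Fin k)) ⊕ VSet P)) {N' : Type y} [L.Structure N'] (j : N → N')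
    (z : VSet P → N') : (paramFormula bb Φ).Realize (Sum.elim z j) ↔
      Φ.Realize (Sum.elim (fun t => j (bb t)) z) := by
  rw [paramFormula, Formula.realize_relabel]
  have : Sum.elim z j ∘ Sum.elim (fun t => Sum.inr (bb t)) Sum.inl =
      Sum.elim (fun t => j (bb t)) z := by
    funext t; rcases t with t | t <;> rfl
  rw [this]

variable {N : Type (max u v)} [Field N] [FirstOrder.Ring.CompatibleRing N] [L.Structure N]
    [ρ.IsExpansionOn N] (hN : N ⊨ L.completeTheory K)

theorem memW_of_realize {bb : I × List (Fin k) → N} {hP : IsAntichain (· ≤ ·) (P : Set (Theta k))}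
    {hfree : ∃ μ : Theta k, ¬ IsLeader P μ}
    {qs : Finset (MvPolynomial ((I × List (Fin k)) ⊕ VSet P) (dclEmpty ρ K))}
    {hsep : ∀ π, Eqns.specialize P (dclHom (ρ := ρ) hN) bb (E.sep π) ≠ 0} {Y : Type}
    {β : L.Formula Y} {Q : Y → E.U} {N' : Type (max u v)} [Field N']
    [FirstOrder.Ring.CompatibleRing N'] [L.Structure N'] [ρ.IsExpansionOn N']
    (hN' : N' ⊨ L.completeTheory K) (r : N →+* N') (hr : r.comp (dclHom hN) = dclHom (ρ := ρ) hN')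
    {z : VSet P → N'}
    (h : (E.jetFormula qs β Q).Realize (Sum.elim (fun t => r (bb t)) z)) :
    (E.config (dclHom hN) bb hP hfree qs hsep).MemW r z := by
  rw [E.realize_jetFormula hN'] at h
  rw [Eqns.memW_config, hr]
  exact ⟨h.1, h.2.1⟩

/-- Solutions of the jet formula in models of the scheme `KDeep`. -/
theorem exists_jet_of_kDeep [CharZero K] (hK : AlgBounded L (dclEmpty ρ K))
    {δ : Fin k → Derivation ℤ N N} (hD : ExtendsDer hN E.d δ) (hdeep : KDeep ρ δ)
    (hP : IsAntichain (· ≤ ·) (P : Set (Theta k)))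
    {qs : Finset (MvPolynomial ((I × List (Fin k)) ⊕ VSet P) (dclEmpty ρ K))}
    (hqs : ∀ (Q : Type (max u v)) [Field Q] (ev : E.U →+* Q)
      (_ : ∀ π, ev (E.sU π) * ev (X (Leaders.it _ I π)) = 1)
      (v v' : List (Fin k)) (π π' : P), wordClass v + π = wordClass v' + π' →
      ∑ i, (wordClass v + π : Theta k) i ≤ ∑ i, P.sup id i →
      ∃ (n : ℕ), ∃ q ∈ qs,
        (ev (applyWord (fun i => E.R E.G i) v (X (Leaders.ix _ I (ofP π)))) -
          ev (applyWord (fun i => E.R E.G i) v' (X (Leaders.ix _ I (ofP π'))))) *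
          (∏ π, ev (E.sU π)) ^ n = ev (rename Sum.inl q))
    {Y : Type} (β : L.Formula Y) (Q : Y → E.U) (b : I → N)
    (H : ∀ g : MvPolynomial (freeSet P) N, g ≠ 0 → ∃ z : VSet P → N,
      (E.jetFormula qs β Q).Realize (Sum.elim (jetGen (fun i => δ i) b) z) ∧
        eval (fun μ : freeSet P => z μ) g ≠ 0) :
    ∃ d : N, (E.jetFormula qs β Q).Realize (Sum.elim (jetGen (fun i => δ i) b)
      (fun μ : VSet P => applyWord (fun i => δ i) (canonicalWord μ) d)) := by
  classical
  -- A configuration must have a free element, so the case where 0 is a leader is treated apart.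
  by_cases hfree : ∃ μ : Theta k, ¬ IsLeader P μ
  · let bb : I × List (Fin k) → N := jetGen (fun i => δ i) b
    obtain ⟨N', h1, h2, h3, h4, hN', j, z, hz, hind, -⟩ := exists_generic_solution (ρ := ρ) hK hN
      (paramFormula bb (E.jetFormula qs β Q)) (freeSet P) (fun g hg => by
        obtain ⟨z, h1, h2⟩ := H g hg
        exact ⟨z, (realize_paramFormula bb _ id z).2 h1, h2⟩)
    have hz' := (realize_paramFormula bb _ j z).1 hz
    have hr : (elementaryRingHom ρ j).comp (dclHom hN) = dclHom (ρ := ρ) hN' :=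
      RingHom.ext fun c => (dclHom_elementary hN hN' j c).symm
    have hsep : ∀ π, Eqns.specialize P (dclHom (ρ := ρ) hN) bb (E.sep π) ≠ 0 := by
      intro π h0
      have h5 := (((E.realize_jetFormula hN' _ _ _ _).1 hz').1 π).2
      have h6 := Eqns.eval₂_specialize (dclHom (ρ := ρ) hN) bb (elementaryRingHom ρ j) z (E.sep π)
      rw [h0, eval₂_zero, hr] at h6
      exact h5 h6.symm
    let S := E.config (dclHom hN) bb hP hfree qs hsep
    have hlarge : S.IsLarge L ρ :=
      ⟨N', h1, h2, h3, h4, j, elementaryRingHom ρ j, z, fun _ => rfl,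
        memW_of_realize E hN hN' _ hr hz', hind⟩
    have hcomm : S.Commutes L ρ δ := by
      obtain ⟨R, hR, hword⟩ := Eqns.exists_isProlongation (E := E) (f := dclHom hN) (b := bb)
        (hP := hP) (hfree := hfree) (qs := qs) (hsep := hsep) hD (fun _ _ _ => rfl)
      refine ⟨R, _, hR, fun α hα v v' π π' hv hv' N'' _ _ _ _ j'' r a hgen => ?_⟩
      have hsum : ∑ i, (wordClass v + π : Theta k) i ≤ ∑ i, P.sup id i := by
        rw [hv]
        rcases hα with rfl | hα | hα
        · exact le_rfl
        · exact hα.le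
        · exact hα.1.le
      -- Cleared of denominators, the difference of the two functions is one of the equations of W,
      -- and the denominators are products of separants, nonzero on W. So it vanishes at every point
      -- of W.
      obtain ⟨n, q, hq, heq⟩ := hqs _ (E.evRat (dclHom hN) bb (FractionRing (MvPolynomial (VSet P) N)))
        (E.evRat_sU_mul _ _ _ hsep) v v' π π' (hv.trans hv'.symm) hsum
      have hmem := (Eqns.memW_config r a).1 hgen.2.1
      refine ⟨Eqns.specialize P (dclHom hN) bb q,
        (∏ π, Eqns.specialize P (dclHom hN) bb (E.sep π)) ^ n, ?_, ?_, ?_⟩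
      · rw [Eqns.evRat_rename, ← hword, ← hword] at heq
        refine Eq.trans ?_ heq
        congr 1
        refine (map_pow (algebraMap (MvPolynomial (VSet P) N)
          (FractionRing (MvPolynomial (VSet P) N))) _ n).trans ?_
        rw [map_prod]
        congr 1
        exact Finset.prod_congr rfl fun π _ => (E.evRat_rename _ _ _ _).symm
      · rw [← coe_eval₂Hom, map_pow, map_prod]
        refine pow_ne_zero _ (Finset.prod_ne_zero_iff.2 fun π _ => ?_)
        rw [coe_eval₂Hom, Eqns.eval₂_specialize]
        exact (hmem.1 π).2
      · rw [Eqns.eval₂_specialize]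
        exact hmem.2 q hq
    obtain ⟨d, hd⟩ := hdeep S hlarge hcomm (paramFormula bb (E.jetFormula qs β Q)) (fun a ha =>
      memW_of_realize E hN hN (RingHom.id N) (RingHom.id_comp _)
        ((realize_paramFormula bb _ id a).1 ha)) ⟨N', h3, j, z, hz, hind⟩
    exact ⟨d, (realize_paramFormula bb _ id _).1 hd⟩
  -- Here 0 lies in the antichain P, so 0 is the only variable, and any solution of the formula is
  -- already the required element d.
  · push Not at hfree
    obtain ⟨π, hπ, hπ0⟩ := hfree 0
    obtain rfl : π = 0 := le_antisymm hπ0 fun _ => Nat.zero_le _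
    obtain ⟨z, hz, -⟩ := H 1 one_ne_zero
    refine ⟨z ⟨0, Or.inr hπ⟩, ?_⟩
    have : (fun μ : VSet P => applyWord (fun i => δ i) (canonicalWord μ) (z ⟨0, Or.inr hπ⟩)) = z := by
      funext ⟨μ, hμ⟩
      have h0 : (0 : Theta k) = μ := hP.eq hπ (hμ.resolve_left (not_not.2 (hfree μ)))
        fun _ => Nat.zero_le _
      subst h0
      have : canonicalWord (0 : Theta k) = [] := by
        rw [canonicalWord, List.flatMap_eq_nil_iff]
        intro i _
        rfl
      rw [this]
      rfl
    rwa [this]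

/-- One step of quantifier elimination, for commuting derivations. -/
theorem exists_formula_comm [CharZero K] (hK : AlgBounded L (dclEmpty ρ K))
    {η : Fin k → Derivation ℤ (dclEmpty ρ K) (dclEmpty ρ K)} (β : L.Formula (Option I × List (Fin k)))
    (M : Type (max u v)) [Field M] [FirstOrder.Ring.CompatibleRing M] [L.Structure M]
    [ρ.IsExpansionOn M] (δ : Fin k → Derivation ℤ M M) (hM : IsDerModel ρ K η M δ)
    (hcom : ∀ i i' y, δ i (δ i' y) = δ i' (δ i y))
    (a : I → M) (c : M) (hc : β.Realize (jetGen (fun i => δ i) (fun o : Option I => o.elim c a))) :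
    ∃ χ : L.Formula (I × List (Fin k)), χ.Realize (jetGen (fun i => δ i) a) ∧
      ∀ (N : Type (max u v)) [Field N] [FirstOrder.Ring.CompatibleRing N] [L.Structure N]
        [ρ.IsExpansionOn N] (δ : Fin k → Derivation ℤ N N),
        IsDerModel ρ K η N δ ∧ (∀ i i' y, δ i (δ i' y) = δ i' (δ i y)) ∧ KDeep ρ δ →
        ∀ b : I → N, χ.Realize (jetGen (fun i => δ i) b) →
          ∃ d : N, β.Realize (jetGen (fun i => δ i) (fun o : Option I => o.elim d b)) := by
  have := charZero_model (ρ := ρ) hM.1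
  let e : Theta k → M := fun μ => applyWord (fun i => δ i) (canonicalWord μ) c
  have he : ∀ i μ, δ i (e μ) = e ((commFrame k).s i μ) := fun i μ =>
    apply_applyWord_canonicalWord hcom i μ c
  obtain ⟨P, hP, hlead⟩ := exists_minimal_finset
    {μ | AlgLead hM.1 ρ (commFrame k) (Set.range (jetGen (fun i => δ i) a)) e μ}
    (fun i α h => AlgLead.s_lead hM.extendsDer
      (by rintro i _ ⟨⟨z, γ⟩, rfl⟩; exact ⟨(z, i :: γ), rfl⟩) he i h)
  obtain ⟨E, hEd, hE⟩ := exists_eqns (commLeaders P) hM.1 η (jetGen (fun i => δ i) a) e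
    (fun α h => (hlead α).1 h)
  have hD : ExtendsDer hM.1 E.d δ := by rw [hEd]; exact hM.extendsDer
  -- The original solution satisfies the commutation equations, so imposing them on W loses nothing.
  obtain ⟨qs, hq1, hq2⟩ := Eqns.exists_commute_eqs.{w, max u v} E
  let Φ := E.jetFormula qs β (fun y => E.jetPoly wordClass (id y))
  have hΦ : Φ.Realize (Sum.elim (jetGen (fun i => δ i) a) (fun μ : VSet P => e μ)) :=
    (E.realize_jetFormula_jet hD he a
      (fun γ => applyWord_canonicalWord_wordClass hcom γ c) qs β id).2
      ⟨hE, hq1 M _ δ e _ (E.isDerEval_of_extendsDer hD he hE), hc⟩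
  obtain ⟨χ, h1, h2⟩ := exists_large_jetFormula (commLeaders P) hK hM.1 _ e (freeSet P)
    (fun μ hμ h => hμ ((hlead _).2 h)) Φ hΦ
  refine ⟨χ, h1, fun N _ _ _ _ δ' hN b hb => ?_⟩
  have hD' : ExtendsDer hN.1.1 E.d δ' := by rw [hEd]; exact hN.1.extendsDer
  obtain ⟨d, hd⟩ := exists_jet_of_kDeep E hN.1.1 hK hD' hN.2.2 hP hq2 β _ b (h2 N hN.1.1 _ hb)
  have h3 := (E.realize_jetFormula_jet hD'
    (e := fun μ => applyWord (fun i => δ' i) (canonicalWord μ) d)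
    (fun i μ => apply_applyWord_canonicalWord hN.2.1 i μ d) b
    (fun γ => applyWord_canonicalWord_wordClass hN.2.1 γ d) qs β id).1 hd
  exact ⟨d, h3.2.2⟩

theorem jetExists_commGenericTheory [CharZero K] (hK : AlgBounded L (dclEmpty ρ K))
    (η : Fin k → Derivation ℤ (dclEmpty ρ K) (dclEmpty ρ K)) :
    JetExists (commGenericTheory ρ K η) := by
  rw [commGenericTheory_eq]
  refine jetExists_classTheory True (fun N _ _ _ _ δ hN => ⟨hN.1, fun _ => hN.2.1⟩) ?_
  intro I _ β M _ _ _ _ δ hM hcom a c hc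
  exact exists_formula_comm hK β M δ hM (hcom trivial) a c hc

end Commuting

/-! ### Conclusion: the generic theories satisfy the hypotheses of (A) -/

section Models

variable {L : FirstOrder.Language.{u, v}} {ρ : FirstOrder.Language.ring →ᴸ L} {K : Type w} [Field K]
    [FirstOrder.Ring.CompatibleRing K] [L.Structure K] [ρ.IsExpansionOn K] {k : ℕ}
    (η : Fin k → Derivation ℤ (dclEmpty ρ K) (dclEmpty ρ K))

theorem completeTheory_models_ncGenericTheory (σ : L.Sentence) (hσ : σ ∈ L.completeTheory K) :
    ncGenericTheory ρ K η ⊨ᵇ (LHom.sumInl : L →ᴸ withDer L (Fin k)).onSentence σ := by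
  rw [ncGenericTheory_eq]
  exact completeTheory_models_classTheory (fun N _ _ _ _ δ hN => hN.1.1) σ hσ

theorem completeTheory_models_commGenericTheory (σ : L.Sentence) (hσ : σ ∈ L.completeTheory K) :
    commGenericTheory ρ K η ⊨ᵇ (LHom.sumInl : L →ᴸ withDer L (Fin k)).onSentence σ := by
  rw [commGenericTheory_eq]
  exact completeTheory_models_classTheory (fun N _ _ _ _ δ hN => hN.1.1) σ hσ

end Models

end GenDer

theorem mainTheorem5 (L : FirstOrder.Language.{u, v}) :
    (∀ (ι : Type w) (U : L.Theory) (U' : (GenDer.withDer L ι).Theory),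
      (∀ σ ∈ U, U' ⊨ᵇ (LHom.sumInl : L →ᴸ GenDer.withDer L ι).onSentence σ) →
      (∀ (n : ℕ) (α : (GenDer.withDer L ι).Formula (Fin n)),
        ∃ β : L.Formula (Fin n × List ι), U' ⊨ᵇ α.iff (GenDer.substJet β)) →
      (∀ (M : Type x) [Nonempty M] [L.Structure M] [(GenDer.derLang ι).Structure M],
        M ⊨ U' → ∀ (n : ℕ) (a a' : Fin n → M) (B : Set M),
          GenDer.typeOver L (GenDer.jetSet (GenDer.derMap (ι := ι) M) B)
              (GenDer.jet (GenDer.derMap (ι := ι) M) a) =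
            GenDer.typeOver L (GenDer.jetSet (GenDer.derMap (ι := ι) M) B)
              (GenDer.jet (GenDer.derMap (ι := ι) M) a') →
          GenDer.typeOver (GenDer.withDer L ι) B a =
            GenDer.typeOver (GenDer.withDer L ι) B a') ∧
      (GenDer.IsStable U → GenDer.IsStable U') ∧
      (GenDer.IsNIP U → GenDer.IsNIP U')) ∧
    (∀ (ρ : FirstOrder.Language.ring →ᴸ L) (K : Type w) [Field K] [CharZero K] [FirstOrder.Ring.CompatibleRing K]
      [L.Structure K] [ρ.IsExpansionOn K],
      GenDer.AlgBounded L (GenDer.dclEmpty ρ K) →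
      ∀ (k : ℕ) (η : Fin k → Derivation ℤ (GenDer.dclEmpty ρ K) (GenDer.dclEmpty ρ K)),
        (GenDer.IsStable (L.completeTheory K) → GenDer.IsStable (GenDer.ncGenericTheory ρ K η)) ∧
        (GenDer.IsNIP (L.completeTheory K) → GenDer.IsNIP (GenDer.ncGenericTheory ρ K η)) ∧
        ((∀ i i' c, η i (η i' c) = η i' (η i c)) →
          (GenDer.IsStable (L.completeTheory K) →
            GenDer.IsStable (GenDer.commGenericTheory ρ K η)) ∧
          (GenDer.IsNIP (L.completeTheory K) →
            GenDer.IsNIP (GenDer.commGenericTheory ρ K η)))) := by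
  refine ⟨fun ι U U' hU hred => ⟨?_, ?_, ?_⟩, fun ρ K _ _ _ _ _ hK k η => ⟨?_, ?_, ?_⟩⟩
  · intro M _ _ _ hM n a a' B h
    exact GenDer.typeOver_eq_of_jet hred M hM n a a' B h
  · rw [GenDer.isStable_iff, GenDer.isStable_iff]
    exact fun h h' => h (h'.of_reduction hU hred)
  · rw [GenDer.isNIP_iff, GenDer.isNIP_iff]
    exact fun h h' => h (h'.of_reduction hU hred)
  · rw [GenDer.isStable_iff, GenDer.isStable_iff]
    exact fun h h' => h (h'.of_reduction (GenDer.completeTheory_models_ncGenericTheory η)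
      fun n α => GenDer.JetDef.models_iff (GenDer.jetExists_ncGenericTheory hK η) α)
  · rw [GenDer.isNIP_iff, GenDer.isNIP_iff]
    exact fun h h' => h (h'.of_reduction (GenDer.completeTheory_models_ncGenericTheory η)
      fun n α => GenDer.JetDef.models_iff (GenDer.jetExists_ncGenericTheory hK η) α)
  · intro _
    rw [GenDer.isStable_iff, GenDer.isStable_iff, GenDer.isNIP_iff, GenDer.isNIP_iff]
    have hU := GenDer.completeTheory_models_commGenericTheory (ρ := ρ) (K := K) η
    have hred := fun n α => GenDer.JetDef.models_iff (n := n)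
      (GenDer.jetExists_commGenericTheory hK η) α
    exact ⟨fun h h' => h (h'.of_reduction hU hred), fun h h' => h (h'.of_reduction hU hred)⟩
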